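/- Setting. Let $F$ be a non-archimedean local field with ring of integers $\mathcal O$, maximal ideal $\mathfrak p$, residue field $\kappa$ with $q$ elements, normalized valuation $\mathrm{val}$, and a fixed uniformizer $\varpi$. Let $n\ge 2$ with $n\mid q-1$, let $\mu_n$ be the group of $n$-th roots of unity (identified with the $n$-th roots of unity of $\kappa$ by reduction), and let $(a,b)_n=\overline{c}^{\,(q-1)/n}$, $c=(-1)^{\mathrm{val}(a)\mathrm{val}(b)}a^{\mathrm{val}(b)}/b^{\mathrm{val}(a)}$, be the $n$-th Hilbert symbol. Put $X\begin{pmatrix}a&b\\c&d\end{pmatrix}=c$ if $c\ne0$, and $=d$ if $c=0$. Let $\widetilde G=\mathrm{GL}_2(F)\times\mu_n$ with Kubota's multiplication $(g_1,\zeta_1)(g_2,\zeta_2)=(g_1g_2,\beta'(g_1,g_2)\zeta_1\zeta_2)$, $\beta'(g_1,g_2)=\Big(\frac{X(g_1g_2)}{X(g_1)},\frac{X(g_1g_2)}{X(g_2)\det g_1}\Big)_n$. Let $T$, $B$, $K=\mathrm{GL}_2(\mathcal O)$ and $T^1=T\cap \mathrm{SL}_2(F)$ be the diagonal torus, the upper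 triangular Borel subgroup, the standard maximal compact subgroup and the torus of $\mathrm{SL}_2(F)$; a tilde denotes the inverse image in $\widetilde G$. For $l\ge1$ let $K_l=\{g\in K: g\equiv 1 \bmod \mathfrak p^l\}$, regarded as the subgroup $K_l\times\{1\}$ of $\widetilde G$. Let $Z(\widetilde T)$ be the centre of $\widetilde T$ and $A=C_{\widetilde T}(\widetilde T\cap\widetilde K)$, which contains $\widetilde T\cap\widetilde K$ and $Z(\widetilde T)$. A character $\gamma$ of a subgroup $D\subseteq\widetilde G$ is primitive mod $m$ if $m$ is the smallest positive integer such that $\gamma$ is trivial on $D\cap K_m$. Write $\mathrm{dg}(s,t)$ for the diagonal matrix with entries $s,t$, and $\varpi(a)=(\varpi,a)_n$. Fix a faithful character $\epsilon:\mu_n\to\mathbb C^\times$. Let $\rho'$ be a smooth irreducible complex representation of $\widetilde T$ on which $\mu_n$ acts by $\epsilon$, with central character $\chi'$ (a character of $Z(\widetilde T)$), and let $\chi'$ be primitive mod $m$. Let $\chi'_0$ be any extension of $\chi'$ to $A$, and for $0\le i,j<n$ let $\chi'_{i,j}$ be the character of $A$ $$\chi'_{i,j}(\mathrm{dg}(s,t),\zeta)=\chi'_0\big(\mathrm{dg}(s,t),\varpi(s)^{-j}\varpi(t)^{-i}\zeta\big).$$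 Let $\mathrm{Ind}_{\widetilde B}^{\widetilde G}\rho'$ and $\mathrm{Ind}_{\widetilde B\cap\widetilde K}^{\widetilde K}\chi'_{i,j}$ denote smooth (non-normalized) induction, where $\rho'$ and $\chi'_{i,j}|_{\widetilde T\cap\widetilde K}$ are extended trivially over the unipotent radical. For $l>m$ let $$\widetilde W'_{i,j,l}=\big(\mathrm{Ind}_{\widetilde B\cap\widetilde K}^{\widetilde K}\chi'_{i,j}\big)^{K_l}\big/\big(\mathrm{Ind}_{\widetilde B\cap\widetilde K}^{\widetilde K}\chi'_{i,j}\big)^{K_{l-1}}.$$ Corollary. (1) As representations of $\widetilde K$, $$\mathrm{Res}_{\widetilde K}\mathrm{Ind}_{\widetilde B}^{\widetilde G}\rho'\;\cong\;\bigoplus_{i,j=0}^{n-1}\Big(\big(\mathrm{Ind}_{\widetilde B\cap\widetilde K}^{\widetilde K}\chi'_{i,j}\big)^{K_m}\oplus\bigoplus_{l>m}\widetilde W'_{i,j,l}\Big).$$ (2) For all $0\le i,j<n$ and all $l>m$ the representation $\widetilde W'_{i,j,l}$ is irreducible. (3) Assume moreover that the restriction of $\chi'$ to $Z(\widetilde T)\cap\widetilde{T^1}$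 is also primitive mod $m$. (a) If for no $0\le k<n$ one has $\chi'_{0,0}(\mathrm{dg}(a,a^{-1}),1)=\epsilon(\varpi(a))^k$ for all $a\in\mathcal O^\times$, then all the level $m$ pieces $\big(\mathrm{Ind}_{\widetilde B\cap\widetilde K}^{\widetilde K}\chi'_{i,j}\big)^{K_m}$ are irreducible. (b) If $0\le k<n$ and $\chi'_{0,0}(\mathrm{dg}(a,a^{-1}),1)=\epsilon(\varpi(a))^k$ for all $a\in\mathcal O^\times$, then there are exactly $n$ pairs $(i,j)$, $0\le i,j<n$, with $j-i\equiv k \pmod n$. For each of these pairs $\big(\mathrm{Ind}_{\widetilde B\cap\widetilde K}^{\widetilde K}\chi'_{i,j}\big)^{K_m}$ is the direct sum of two irreducible subrepresentations, and for all other pairs it is irreducible. -/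

import Mathlib

set_option linter.unusedSectionVars false
set_option linter.unusedSimpArgs false

open scoped ValuativeRel MatrixGroups DirectSum

namespace CoverGL2

section Symbol

variable {F : Type*} [Field F] [ValuativeRel F] [TopologicalSpace F]
  [IsNonarchimedeanLocalField F]

/-- The normalized valuation `val : Fˣ → ℤ` of a non-archimedean local field. -/
noncomputable def val (x : Fˣ) : ℤ :=
  -WithZero.log (IsNonarchimedeanLocalField.valueGroupWithZeroIsoInt F
    (ValuativeRel.valuation F (x : F)))

theorem val_mul (x y : Fˣ) : val (x * y) = val x + val y := by
  unfold val
  rw [Units.val_mul, map_mul, map_mul, WithZero.log_mul]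
  · ring
  · simp
  · simp

theorem val_one : val (1 : Fˣ) = 0 := by simp [val]

/-- `val` as a homomorphism. -/
noncomputable def valHom : Fˣ →* Multiplicative ℤ where
  toFun x := Multiplicative.ofAdd (val x)
  map_one' := by simp [val_one]
  map_mul' x y := by simp [val_mul]

theorem val_inv (x : Fˣ) : val x⁻¹ = -val x := by
  have := val_mul x x⁻¹
  rw [mul_inv_cancel, val_one] at this
  omega

theorem val_div (x y : Fˣ) : val (x / y) = val x - val y := by
  rw [div_eq_mul_inv, val_mul, val_inv]; ring

theorem val_zpow (x : Fˣ) (k : ℤ) : val (x ^ k) = k * val x := by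
  have := map_zpow (valHom (F := F)) x k
  have h2 := congrArg Multiplicative.toAdd this
  simpa [valHom] using h2

theorem val_eq_zero_iff (x : Fˣ) : val x = 0 ↔ ValuativeRel.valuation F (x : F) = 1 := by
  have h0 : IsNonarchimedeanLocalField.valueGroupWithZeroIsoInt F
    (ValuativeRel.valuation F (x : F)) ≠ 0 := by simp
  unfold val
  rw [neg_eq_zero]
  constructor
  · intro h
    have := WithZero.exp_log h0
    rw [h, WithZero.exp_zero] at this
    have h3 := this.symm
    rwa [map_eq_one_iff _ (EquivLike.injective _)] at h3
  · intro h
    simp [h]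

theorem val_nonneg_iff (x : Fˣ) : 0 ≤ val x ↔ ValuativeRel.valuation F (x : F) ≤ 1 := by
  have h0 : IsNonarchimedeanLocalField.valueGroupWithZeroIsoInt F
    (ValuativeRel.valuation F (x : F)) ≠ 0 := by simp
  unfold val
  rw [neg_nonneg, WithZero.log_le_iff_le_exp h0, WithZero.exp_zero,
    ← map_one (IsNonarchimedeanLocalField.valueGroupWithZeroIsoInt F)]
  exact map_le_map_iff _

theorem val_neg_one : val (-1 : Fˣ) = 0 := by
  rw [val_eq_zero_iff]; simp

variable (F) in
/-- The unit group `𝒪ˣ`, as a subgroup of `Fˣ`. -/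
noncomputable def unitsO : Subgroup Fˣ where
  carrier := {x | val x = 0}
  one_mem' := val_one
  mul_mem' {x y} hx hy := by
    have hx' : val x = 0 := hx
    have hy' : val y = 0 := hy
    change val (x * y) = 0
    rw [val_mul, hx', hy', add_zero]
  inv_mem' {x} hx := by
    have hx' : val x = 0 := hx
    change val x⁻¹ = 0
    rw [val_inv, hx', neg_zero]

theorem mem_unitsO {x : Fˣ} : x ∈ unitsO F ↔ val x = 0 := Iff.rfl

/-- An element of valuation `0` as a unit of the ring of integers. -/
noncomputable def toIntegerUnit : unitsO F →* (𝒪[F])ˣ where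
  toFun x :=
    { val := ⟨((x : Fˣ) : F), ((val_eq_zero_iff _).1 x.2).le⟩
      inv := ⟨(((x : Fˣ)⁻¹ : Fˣ) : F), ((val_eq_zero_iff _).1 (x⁻¹).2).le⟩
      val_inv := by ext; simp
      inv_val := by ext; simp }
  map_one' := by ext; simp
  map_mul' x y := by ext; simp

/-- Reduction `𝒪ˣ → κˣ` modulo the maximal ideal. -/
noncomputable def reduce : unitsO F →* (𝓀[F])ˣ :=
  (Units.map (IsLocalRing.residue 𝒪[F]).toMonoidHom).comp toIntegerUnit

/-- The element `c = (-1)^{val a val b} a^{val b} / b^{val a}`, which has valuation zero. -/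
noncomputable def symbolArg (a b : Fˣ) : unitsO F :=
  ⟨(-1) ^ (val a * val b) * (a ^ val b / b ^ val a), by
    rw [mem_unitsO, val_mul, val_zpow, val_neg_one, val_div, val_zpow, val_zpow]; ring⟩

variable (n : ℕ) [hn : Fact (n ∣ Nat.card 𝓀[F] - 1)]

/-- The `n`-th Hilbert symbol `(a,b)_n = c̄^{(q-1)/n}`, `c = (-1)^{val a val b} a^{val b} / b^{val a}`,
for `n ∣ q - 1`. Its values are `n`-th roots of unity in the residue field; reduction identifies
the group `μ_n` of `n`-th roots of unity of `F` with them. -/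
noncomputable def hilbert (a b : Fˣ) : rootsOfUnity n 𝓀[F] :=
  ⟨reduce (symbolArg a b) ^ ((Nat.card 𝓀[F] - 1) / n), by
    rw [mem_rootsOfUnity, ← pow_mul, Nat.div_mul_cancel hn.out, ← Nat.card_units]
    exact pow_card_eq_one'⟩

theorem symbolArg_mul_left (a a' b : Fˣ) :
    symbolArg (a * a') b = symbolArg a b * symbolArg a' b := by
  apply Subtype.ext
  simp only [symbolArg, Subgroup.coe_mul, val_mul, add_mul, zpow_add, mul_zpow]
  simp only [div_eq_mul_inv, mul_inv]
  ac_rfl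

theorem symbolArg_mul_right (a b b' : Fˣ) :
    symbolArg a (b * b') = symbolArg a b * symbolArg a b' := by
  apply Subtype.ext
  simp only [symbolArg, Subgroup.coe_mul, val_mul, mul_add, zpow_add, mul_zpow]
  simp only [div_eq_mul_inv, mul_inv]
  ac_rfl

theorem hilbert_mul_left (a a' b : Fˣ) :
    hilbert n (a * a') b = hilbert n a b * hilbert n a' b := by
  apply Subtype.ext
  simp [hilbert, symbolArg_mul_left, mul_pow]

theorem hilbert_mul_right (a b b' : Fˣ) :
    hilbert n a (b * b') = hilbert n a b * hilbert n a b' := by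
  apply Subtype.ext
  simp [hilbert, symbolArg_mul_right, mul_pow]

/-- Elements of `1 + 𝔭`. -/
def IsPrincipal (x : Fˣ) : Prop := ∃ h : x ∈ unitsO F, reduce ⟨x, h⟩ = 1

theorem hilbert_of_isPrincipal_symbolArg (a b : Fˣ) (h : reduce (symbolArg a b) = 1) :
    hilbert n a b = 1 := by
  apply Subtype.ext
  simp [hilbert, h]

theorem hilbert_principal_left (a b : Fˣ) (ha : IsPrincipal a) : hilbert n a b = 1 := by
  obtain ⟨h, h1⟩ := ha
  apply hilbert_of_isPrincipal_symbolArg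
  have : symbolArg a b = ⟨a, h⟩ ^ val b := by
    apply Subtype.ext
    simp [symbolArg, mem_unitsO.1 h]
  rw [this, map_zpow, h1, one_zpow]

theorem hilbert_principal_right (a b : Fˣ) (hb : IsPrincipal b) : hilbert n a b = 1 := by
  obtain ⟨h, h1⟩ := hb
  apply hilbert_of_isPrincipal_symbolArg
  have : symbolArg a b = ⟨b, h⟩ ^ (-val a) := by
    apply Subtype.ext
    simp [symbolArg, mem_unitsO.1 h]
  rw [this, map_zpow, h1, one_zpow]

theorem hilbert_units (a b : Fˣ) (ha : val a = 0) (hb : val b = 0) : hilbert n a b = 1 := by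
  apply hilbert_of_isPrincipal_symbolArg
  have : symbolArg a b = 1 := by
    apply Subtype.ext
    simp [symbolArg, ha, hb]
  rw [this, map_one]

theorem hilbert_skew (a b : Fˣ) : hilbert n a b * hilbert n b a = 1 := by
  have : symbolArg a b * symbolArg b a = 1 := by
    apply Subtype.ext
    simp only [symbolArg, Subgroup.coe_mul, Subgroup.coe_one]
    rw [mul_comm (val b) (val a)]
    have h1 : ((-1 : Fˣ) ^ (val a * val b)) * (-1) ^ (val a * val b) = 1 := by
      rw [← mul_zpow]; simp
    calc _ = ((-1 : Fˣ) ^ (val a * val b) * (-1) ^ (val a * val b)) *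
        ((a ^ val b / b ^ val a) * (b ^ val a / a ^ val b)) := by ac_rfl
      _ = 1 := by rw [h1]; simp
  apply Subtype.ext
  have h2 : reduce (symbolArg a b) * reduce (symbolArg b a) = 1 := by
    rw [← map_mul, this, map_one]
  simp [hilbert, ← mul_pow, h2]

theorem hilbert_neg_self (a : Fˣ) : hilbert n a (-a) = 1 := by
  apply hilbert_of_isPrincipal_symbolArg
  have : symbolArg a (-a) = 1 := by
    apply Subtype.ext
    have hv : val (-a) = val a := by
      rw [← neg_one_mul, val_mul, val_neg_one, zero_add]
    simp only [symbolArg, Subgroup.coe_one, hv]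
    rw [← neg_one_mul a, mul_zpow]
    have hev : Even (val a * val a + val a) := by
      have := Int.even_mul_succ_self (val a)
      rwa [mul_add, mul_one] at this
    have h1 : (-1 : Fˣ) ^ (val a * val a) = (-1) ^ (val a) := by
      rcases Int.even_or_odd (val a) with h | h
      · rw [h.neg_one_zpow, (h.mul_right _).neg_one_zpow]
      · rw [h.neg_one_zpow, (h.mul h).neg_one_zpow]
    rw [h1, div_eq_mul_inv, mul_inv]
    calc _ = ((-1 : Fˣ) ^ val a * ((-1) ^ val a)⁻¹) * (a ^ val a * (a ^ val a)⁻¹) := by ac_rfl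
      _ = 1 := by simp
  rw [this, map_one]

theorem isPrincipal_of (x : Fˣ) (h : ∃ y ∈ 𝓂[F], (x : F) = 1 + (y : 𝒪[F])) : IsPrincipal x := by
  obtain ⟨y, hy, hxy⟩ := h
  have hu : IsUnit (1 + y) := by
    by_contra hc
    have h1 : 1 + y ∈ 𝓂[F] := (IsLocalRing.mem_maximalIdeal _).2 hc
    have h2 : (1 : 𝒪[F]) ∈ 𝓂[F] := by simpa using Ideal.sub_mem _ h1 hy
    exact (Ideal.ne_top_iff_one _).1 (IsLocalRing.maximalIdeal.isMaximal _).ne_top h2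
  have hx : x ∈ unitsO F := by
    rw [mem_unitsO, val_eq_zero_iff, hxy]
    have := (Valuation.integer.integers (ValuativeRel.valuation F)).isUnit_iff_valuation_eq_one.1 hu
    exact this
  refine ⟨hx, ?_⟩
  apply Units.ext
  have hh : ((toIntegerUnit ⟨x, hx⟩ : (𝒪[F])ˣ) : 𝒪[F]) = 1 + y := by
    apply Subtype.ext
    simpa [toIntegerUnit] using hxy
  have hy0 : IsLocalRing.residue 𝒪[F] y = 0 := (IsLocalRing.residue_eq_zero_iff _).2 hy
  simp [reduce, hh, hy0]

theorem isPrincipal_one_sub (a b : Fˣ) (hab : (a : F) + b = 1) (ha : 0 < val a) :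
    IsPrincipal b := by
  have hva := (val_nonneg_iff a).1 ha.le
  have hne : ValuativeRel.valuation F (a : F) ≠ 1 := fun h =>
    ha.ne' ((val_eq_zero_iff a).2 h)
  refine isPrincipal_of b ⟨-⟨a, hva⟩, ?_, ?_⟩
  · rw [neg_mem_iff, IsLocalRing.mem_maximalIdeal, mem_nonunits_iff]
    intro hc
    exact hne ((Valuation.integer.integers
      (ValuativeRel.valuation F)).isUnit_iff_valuation_eq_one.1 hc)
  · push_cast
    rw [← hab]; simp

theorem val_of_add_eq_one (a b : Fˣ) (hab : (a : F) + b = 1) (ha : val a < 0) :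
    val b = val a := by
  have h1 : (((-a⁻¹ * b : Fˣ)) : F) + (a⁻¹ : Fˣ) = 1 := by
    push_cast
    have : (b : F) = 1 - a := by rw [← hab]; ring
    rw [this]; field_simp; ring
  have h2 := isPrincipal_one_sub (a⁻¹) (-a⁻¹ * b) (by rw [add_comm]; exact h1)
    (by rw [val_inv]; omega)
  have h3 := mem_unitsO.1 h2.1
  rw [← neg_one_mul, mul_assoc, val_mul, val_mul, val_neg_one, val_inv] at h3
  omega

theorem hilbert_steinberg (a b : Fˣ) (hab : (a : F) + b = 1) : hilbert n a b = 1 := by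
  rcases lt_trichotomy (val a) 0 with h | h | h
  · have hv := val_of_add_eq_one a b hab h
    have h1 : (((-a⁻¹ * b : Fˣ)) : F) + (a⁻¹ : Fˣ) = 1 := by
      push_cast
      have : (b : F) = 1 - a := by rw [← hab]; ring
      rw [this]; field_simp; ring
    have h2 := isPrincipal_one_sub (a⁻¹) (-a⁻¹ * b) (by rw [add_comm]; exact h1)
      (by rw [val_inv]; omega)
    have h3 : b = (-a) * (-a⁻¹ * b) := by simp
    rw [h3, hilbert_mul_right, hilbert_neg_self, hilbert_principal_right _ _ _ h2, one_mul]
  · rcases lt_trichotomy (val b) 0 with h' | h' | h'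
    · have := val_of_add_eq_one b a (by rw [add_comm]; exact hab) h'
      omega
    · exact hilbert_units n a b h h'
    · exact hilbert_principal_left n a b
        (isPrincipal_one_sub b a (by rw [add_comm]; exact hab) h')
  · exact hilbert_principal_right n a b (isPrincipal_one_sub a b hab h)

end Symbol

section X
variable {F : Type*} [Field F]

open Classical in
/-- `X (a b; c d) = c` if `c ≠ 0`, and `d` otherwise. -/
noncomputable def X (g : GL (Fin 2) F) : Fˣ :=
  if hc : g.val 1 0 = 0 then
    Units.mk0 (g.val 1 1) (by
      intro hd
      have h := g.det.ne_zero
      rw [Matrix.GeneralLinearGroup.val_det_apply, Matrix.det_fin_two] at h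
      apply h; simp [hc, hd])
  else Units.mk0 (g.val 1 0) hc

theorem X_of_eq {g : GL (Fin 2) F} (h : g.val 1 0 = 0) : (X g : F) = g.val 1 1 := by simp [X, h]
theorem X_of_ne {g : GL (Fin 2) F} (h : g.val 1 0 ≠ 0) : (X g : F) = g.val 1 0 := by simp [X, h]

theorem mul_apply_one_zero (g h : GL (Fin 2) F) : (g * h).val 1 0 =
    g.val 1 0 * h.val 0 0 + g.val 1 1 * h.val 1 0 := by
  simp [Matrix.mul_apply, Fin.sum_univ_two]
theorem mul_apply_one_one (g h : GL (Fin 2) F) : (g * h).val 1 1 =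
    g.val 1 0 * h.val 0 1 + g.val 1 1 * h.val 1 1 := by
  simp [Matrix.mul_apply, Fin.sum_univ_two]
theorem det_eq (g : GL (Fin 2) F) : ((Matrix.GeneralLinearGroup.det g : Fˣ) : F) =
    g.val 0 0 * g.val 1 1 - g.val 0 1 * g.val 1 0 := by
  rw [Matrix.GeneralLinearGroup.val_det_apply, Matrix.det_fin_two]

theorem X_mul_left {g h : GL (Fin 2) F} (hg : g.val 1 0 = 0) : X (g * h) = X g * X h := by
  have hd : g.val 1 1 ≠ 0 := by rw [← X_of_eq hg]; exact (X g).ne_zero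
  have e := mul_apply_one_zero g h
  rw [hg, zero_mul, zero_add] at e
  apply Units.ext
  rw [Units.val_mul, X_of_eq hg]
  by_cases hh : h.val 1 0 = 0
  · rw [hh, mul_zero] at e
    rw [X_of_eq hh, X_of_eq e, mul_apply_one_one, hg]; ring
  · have e' : (g * h).val 1 0 ≠ 0 := by rw [e]; exact mul_ne_zero hd hh
    rw [X_of_ne hh, X_of_ne e', e]

theorem X_mul_right_ne {g h : GL (Fin 2) F} (hh : h.val 1 0 = 0) (hg : g.val 1 0 ≠ 0) :
    X (g * h) * X h = X g * Matrix.GeneralLinearGroup.det h := by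
  have e := mul_apply_one_zero g h
  rw [hh, mul_zero, add_zero] at e
  have hd : h.val 0 0 ≠ 0 := by
    intro h0
    have := (Matrix.GeneralLinearGroup.det h).ne_zero
    rw [det_eq] at this
    apply this; rw [h0, hh]; ring
  have e' : (g * h).val 1 0 ≠ 0 := by rw [e]; exact mul_ne_zero hg hd
  apply Units.ext
  rw [Units.val_mul, Units.val_mul, X_of_eq hh, X_of_ne hg, X_of_ne e', e, det_eq, hh]; ring

/-- Plücker relation between lower left entries. -/
theorem plucker (g₁ g₂ g₃ : GL (Fin 2) F) :
    (g₁ * g₂).val 1 0 * (g₂ * g₃).val 1 0 - (g₁ * g₂ * g₃).val 1 0 * g₂.val 1 0 =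
      g₁.val 1 0 * g₃.val 1 0 * (Matrix.GeneralLinearGroup.det g₂ : Fˣ) := by
  rw [det_eq, mul_apply_one_zero (g₁ * g₂) g₃, mul_apply_one_one, mul_apply_one_zero g₁,
    mul_apply_one_zero g₂]
  ring

/-- The cocycle identity, from bilinearity and the Steinberg relations. -/
theorem cocycle_identity {A : Type*} [AddCommGroup A] (s : Fˣ → Fˣ → A)
    (hl : ∀ a b c, s (a * b) c = s a c + s b c) (hr : ∀ a b c, s a (b * c) = s a b + s a c)
    (hskew : ∀ a b, s a b + s b a = 0) (hneg : ∀ a, s a (-a) = 0)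
    (hst : ∀ a b : Fˣ, (a : F) + b = 1 → s a b = 0) (g₁ g₂ g₃ : GL (Fin 2) F) :
    s (X (g₁ * g₂) / X g₁) (X (g₁ * g₂) / (X g₂ * Matrix.GeneralLinearGroup.det g₁)) +
      s (X (g₁ * g₂ * g₃) / X (g₁ * g₂))
        (X (g₁ * g₂ * g₃) / (X g₃ * Matrix.GeneralLinearGroup.det (g₁ * g₂))) =
    s (X (g₂ * g₃) / X g₂) (X (g₂ * g₃) / (X g₃ * Matrix.GeneralLinearGroup.det g₂)) +
    s (X (g₁ * g₂ * g₃) / X g₁)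
        (X (g₁ * g₂ * g₃) / (X (g₂ * g₃) * Matrix.GeneralLinearGroup.det g₁)) := by
  have hl1 : ∀ c, s 1 c = 0 := fun c => by simpa using hl 1 1 c
  have hr1 : ∀ c, s c 1 = 0 := fun c => by simpa using hr c 1 1
  have hli : ∀ a c, s a⁻¹ c = - s a c := fun a c => by
    have := hl a a⁻¹ c
    rw [mul_inv_cancel, hl1] at this
    exact (neg_eq_of_add_eq_zero_right this.symm).symm
  have hri : ∀ a c, s a c⁻¹ = - s a c := fun a c => by
    have := hr a c c⁻¹
    rw [mul_inv_cancel, hr1] at this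
    exact (neg_eq_of_add_eq_zero_right this.symm).symm
  have hneg' : ∀ a b, s a (-b) = s a b - s a a := fun a b => by
    have h1 : -b = (-a) * (a⁻¹ * b) := by simp
    rw [h1, hr, hneg, hr, hri]; abel
  rw [map_mul]
  generalize hD1 : Matrix.GeneralLinearGroup.det g₁ = D₁
  generalize hD2 : Matrix.GeneralLinearGroup.det g₂ = D₂
  by_cases h1 : g₁.val 1 0 = 0
  · have e1 := X_mul_left (h := g₂) h1
    have e2 := X_mul_left (h := g₂ * g₃) h1
    rw [← mul_assoc] at e2
    rw [e1, e2]
    generalize X g₁ = x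
    generalize X g₂ = y
    generalize X g₃ = z
    generalize X (g₂ * g₃) = q
    simp only [div_eq_mul_inv, mul_inv, hl, hr, hli, hri]
    have := hskew; grind
  have hx := X_of_ne h1
  by_cases h2 : g₂.val 1 0 = 0
  · have e1 := X_mul_left (h := g₃) h2
    have e2 := X_mul_right_ne h2 h1
    rw [hD2] at e2
    rw [e1, eq_div_of_mul_eq' e2]
    generalize X g₁ = x
    generalize X g₂ = y
    generalize X g₃ = z
    generalize X (g₁ * g₂ * g₃) = r
    simp only [div_eq_mul_inv, mul_inv, hl, hr, hli, hri, inv_inv, neg_neg]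
    have := hskew; grind
  have hy := X_of_ne h2
  by_cases h12 : (g₁ * g₂).val 1 0 = 0
  · have e1 := X_mul_left (h := g₃) h12
    have hp := X_of_eq h12
    have e2 : D₂ = -(X (g₁ * g₂) * X g₂ / X g₁) := by
      rw [eq_comm, neg_eq_iff_eq_neg, div_eq_iff_eq_mul]
      apply Units.ext
      rw [← hD2]
      push_cast
      rw [det_eq, hx, hy, hp, mul_apply_one_one]
      rw [mul_apply_one_zero] at h12
      linear_combination (g₂.val 1 1) * h12
    by_cases h3 : g₃.val 1 0 = 0
    · have e3 := X_mul_right_ne h3 h2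
      rw [eq_div_of_mul_eq' e3, e1, e2]
      generalize X g₁ = x
      generalize X g₂ = y
      generalize X g₃ = z
      generalize X (g₁ * g₂) = p
      simp only [div_eq_mul_inv, mul_inv, inv_neg, hneg', hl, hr, hli, hri, inv_inv, neg_neg]
      have := hskew; grind
    · rw [e1, e2]
      generalize X g₁ = x
      generalize X g₂ = y
      generalize X g₃ = z
      generalize X (g₁ * g₂) = p
      generalize X (g₂ * g₃) = q
      simp only [div_eq_mul_inv, mul_inv, inv_neg, hneg', hl, hr, hli, hri, inv_inv, neg_neg]
      have := hskew; grind
  have hp := X_of_ne h12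
  by_cases h3 : g₃.val 1 0 = 0
  · have e3 := X_mul_right_ne h3 h2
    have e4 := X_mul_right_ne h3 h12
    rw [eq_div_of_mul_eq' e3, eq_div_of_mul_eq' e4]
    generalize X g₁ = x
    generalize X g₂ = y
    generalize X g₃ = z
    generalize X (g₁ * g₂) = p
    simp only [div_eq_mul_inv, mul_inv, hl, hr, hli, hri, inv_inv, neg_neg]
    have := hskew; grind
  have hz := X_of_ne h3
  have hP := plucker g₁ g₂ g₃
  rw [hD2] at hP
  by_cases h123 : (g₁ * g₂ * g₃).val 1 0 = 0
  · rw [h123, zero_mul, sub_zero] at hP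
    have h23 : (g₂ * g₃).val 1 0 ≠ 0 := by
      intro h0
      rw [h0, mul_zero] at hP
      exact mul_ne_zero (mul_ne_zero h1 h3) D₂.ne_zero hP.symm
    have hq := X_of_ne h23
    have e : D₂ = X (g₁ * g₂) * X (g₂ * g₃) / (X g₁ * X g₃) := by
      rw [eq_div_iff_mul_eq']
      apply Units.ext
      push_cast
      rw [hx, hz, hp, hq, hP]; ring
    rw [e]
    generalize X g₁ = x
    generalize X g₂ = y
    generalize X g₃ = z
    generalize X (g₁ * g₂) = p
    generalize X (g₂ * g₃) = q
    generalize X (g₁ * g₂ * g₃) = r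
    simp only [div_eq_mul_inv, mul_inv, hl, hr, hli, hri, inv_inv, neg_neg]
    have := hskew; grind
  have hr' := X_of_ne h123
  by_cases h23 : (g₂ * g₃).val 1 0 = 0
  · have e : D₂ = -(X (g₁ * g₂ * g₃) * X g₂ / (X g₁ * X g₃)) := by
      rw [eq_comm, neg_eq_iff_eq_neg, div_eq_iff_eq_mul]
      apply Units.ext
      push_cast
      rw [hx, hz, hy, hr']
      rw [h23] at hP
      linear_combination -hP
    rw [e]
    generalize X g₁ = x
    generalize X g₂ = y
    generalize X g₃ = z
    generalize X (g₁ * g₂) = p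
    generalize X (g₂ * g₃) = q
    generalize X (g₁ * g₂ * g₃) = r
    simp only [div_eq_mul_inv, mul_inv, inv_neg, hneg', hl, hr, hli, hri, inv_inv, neg_neg]
    have := hskew; grind
  · have hq := X_of_ne h23
    have hS := hst (X (g₁ * g₂ * g₃) * X g₂ / (X (g₁ * g₂) * X (g₂ * g₃)))
      (X g₁ * X g₃ * D₂ / (X (g₁ * g₂) * X (g₂ * g₃))) (by
        push_cast
        rw [← add_div, div_eq_one_iff_eq (mul_ne_zero (Units.ne_zero _) (Units.ne_zero _)),
          hx, hz, hy, hr', hp, hq]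
        linear_combination -hP)
    revert hS
    generalize X g₁ = x
    generalize X g₂ = y
    generalize X g₃ = z
    generalize X (g₁ * g₂) = p
    generalize X (g₂ * g₃) = q
    generalize X (g₁ * g₂ * g₃) = r
    simp only [div_eq_mul_inv, mul_inv, hl, hr, hli, hri, neg_neg]
    intro hS
    clear hst hneg hneg' hli hri hl hr hl1 hr1 hP hx hy hz hp hq hr'
    have k1 := hskew r x
    have k2 := hskew r p
    have k3 := hskew x p
    have k4 := hskew x y
    have k5 := hskew x q
    have k6 := hskew p q
    have k7 := hskew p p
    have k8 := hskew q q
    have k9 := hskew y p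
    clear hskew
    grind
end X

section Cover

variable (n : ℕ) (F : Type*) [Field F] [ValuativeRel F] [TopologicalSpace F]
  [IsNonarchimedeanLocalField F]

/-- The underlying set `GL₂(F) × μ_n` of the `n`-fold cover `G̃` of `GL₂(F)`. -/
@[ext]
structure Cover where
  /-- the image in `GL₂(F)` -/
  mat : GL (Fin 2) F
  /-- the component in `μ_n` -/
  root : rootsOfUnity n 𝓀[F]

variable {F} [hn : Fact (n ∣ Nat.card 𝓀[F] - 1)]

/-- Kubota's cocycle
`β'(g₁,g₂) = (X(g₁g₂)/X(g₁), X(g₁g₂)/(X(g₂) det g₁))_n` on `GL₂(F)`. On `SL₂(F)` it is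
`(X(g₁g₂)/X(g₁), X(g₁g₂)/X(g₂))_n`. -/
noncomputable def cocycle (g h : GL (Fin 2) F) : rootsOfUnity n 𝓀[F] :=
  hilbert n (X (g * h) / X g) (X (g * h) / (X h * Matrix.GeneralLinearGroup.det g))

theorem cocycle_mul (g₁ g₂ g₃ : GL (Fin 2) F) :
    cocycle n g₁ g₂ * cocycle n (g₁ * g₂) g₃ = cocycle n g₂ g₃ * cocycle n g₁ (g₂ * g₃) := by
  have h := cocycle_identity (A := Additive (rootsOfUnity n 𝓀[F]))
    (fun a b => Additive.ofMul (hilbert n a b))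
    (fun a b c => by rw [hilbert_mul_left, ofMul_mul])
    (fun a b c => by rw [hilbert_mul_right, ofMul_mul])
    (fun a b => by rw [← ofMul_mul, hilbert_skew, ofMul_one])
    (fun a => by rw [hilbert_neg_self, ofMul_one])
    (fun a b hab => by rw [hilbert_steinberg n a b hab, ofMul_one]) g₁ g₂ g₃
  have h' := congrArg Additive.toMul h
  simp only [toMul_add, toMul_ofMul] at h'
  simpa only [cocycle, mul_assoc g₁ g₂ g₃] using h'

theorem hilbert_one_left (a : Fˣ) : hilbert n 1 a = 1 := by
  simpa using hilbert_mul_left n 1 1 a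

theorem hilbert_one_right (a : Fˣ) : hilbert n a 1 = 1 := by
  simpa using hilbert_mul_right n a 1 1

theorem X_one : X (1 : GL (Fin 2) F) = 1 := by
  apply Units.ext; rw [X_of_eq (by simp)]; simp

theorem cocycle_one_left (g : GL (Fin 2) F) : cocycle n 1 g = 1 := by
  simp [cocycle, X_one, hilbert_one_right]

theorem cocycle_one_right (g : GL (Fin 2) F) : cocycle n g 1 = 1 := by
  simp [cocycle, hilbert_one_left]

namespace Cover

noncomputable instance : Mul (Cover n F) :=
  ⟨fun x y => ⟨x.mat * y.mat, cocycle n x.mat y.mat * (x.root * y.root)⟩⟩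

noncomputable instance : One (Cover n F) := ⟨⟨1, 1⟩⟩

noncomputable instance : Inv (Cover n F) :=
  ⟨fun x => ⟨x.mat⁻¹, (cocycle n x.mat⁻¹ x.mat)⁻¹ * x.root⁻¹⟩⟩

theorem mul_def (x y : Cover n F) :
    x * y = ⟨x.mat * y.mat, cocycle n x.mat y.mat * (x.root * y.root)⟩ := rfl
theorem one_def : (1 : Cover n F) = ⟨1, 1⟩ := rfl
theorem inv_def (x : Cover n F) :
    x⁻¹ = ⟨x.mat⁻¹, (cocycle n x.mat⁻¹ x.mat)⁻¹ * x.root⁻¹⟩ := rfl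

/-- The group `G̃ = GL₂(F) × μ_n` with
`(g₁, ζ₁)(g₂, ζ₂) = (g₁g₂, β'(g₁,g₂)ζ₁ζ₂)`. -/
noncomputable instance : Group (Cover n F) :=
  Group.ofLeftAxioms
    (fun x y z => by
      have h := cocycle_mul n x.mat y.mat z.mat
      simp only [mul_def]
      refine Cover.ext (mul_assoc _ _ _) ?_
      calc _ = (cocycle n x.mat y.mat * cocycle n (x.mat * y.mat) z.mat) *
            (x.root * y.root * z.root) := by ac_rfl
        _ = _ := by rw [h]; ac_rfl)
    (fun x => by
      simp only [mul_def, one_def]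
      refine Cover.ext (one_mul _) ?_
      simp [cocycle_one_left])
    (fun x => by
      simp only [mul_def, one_def, inv_def]
      refine Cover.ext (inv_mul_cancel _) ?_
      calc _ = (cocycle n x.mat⁻¹ x.mat * (cocycle n x.mat⁻¹ x.mat)⁻¹) *
            (x.root⁻¹ * x.root) := by ac_rfl
        _ = 1 := by simp)

@[simp] theorem mat_mul (x y : Cover n F) : (x * y).mat = x.mat * y.mat := rfl
@[simp] theorem root_mul (x y : Cover n F) :
    (x * y).root = cocycle n x.mat y.mat * (x.root * y.root) := rfl
@[simp] theorem mat_one : (1 : Cover n F).mat = 1 := rfl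
@[simp] theorem root_one : (1 : Cover n F).root = 1 := rfl
@[simp] theorem mat_inv (x : Cover n F) : (x⁻¹).mat = x.mat⁻¹ := rfl

/-- The projection `p : G̃ → GL₂(F)`. -/
noncomputable def proj : Cover n F →* GL (Fin 2) F where
  toFun := mat
  map_one' := rfl
  map_mul' _ _ := rfl

/-- The embedding `i : μ_n → G̃`. -/
noncomputable def incl : rootsOfUnity n 𝓀[F] →* Cover n F where
  toFun z := ⟨1, z⟩
  map_one' := rfl
  map_mul' a b := by
    refine Cover.ext (by simp) ?_
    simp [cocycle_one_left]

theorem mul_incl (x : Cover n F) (z : rootsOfUnity n 𝓀[F]) :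
    x * incl n z = ⟨x.mat, x.root * z⟩ := by
  refine Cover.ext (by simp [incl]) ?_
  simp [incl, cocycle_one_right]

theorem incl_mul (x : Cover n F) (z : rootsOfUnity n 𝓀[F]) :
    incl n z * x = ⟨x.mat, x.root * z⟩ := by
  refine Cover.ext (by simp [incl]) ?_
  simp [incl, cocycle_one_left, mul_comm]

theorem commute_incl (x : Cover n F) (z : rootsOfUnity n 𝓀[F]) : Commute (incl n z) x := by
  rw [Commute, SemiconjBy, mul_incl, incl_mul]

end Cover

/-! ### Congruence subgroups -/

variable (F) in
/-- `K = GL₂(𝒪)` as a subgroup of `GL₂(F)`. -/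
noncomputable def maxCompact : Subgroup (GL (Fin 2) F) :=
  (Matrix.GeneralLinearGroup.map (n := Fin 2) (𝒪[F]).subtype).range

variable (F) in
/-- `K_l = {g ∈ GL₂(𝒪) | g ≡ 1 mod 𝔭^l}` as a subgroup of `GL₂(F)`. -/
noncomputable def congruence (l : ℕ) : Subgroup (GL (Fin 2) F) :=
  (Matrix.GeneralLinearGroup.map (n := Fin 2) (Ideal.Quotient.mk (𝓂[F] ^ l))).ker.map
    (Matrix.GeneralLinearGroup.map (n := Fin 2) (𝒪[F]).subtype)

theorem congruence_le (l : ℕ) : congruence F l ≤ maxCompact F := by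
  rintro _ ⟨g, _, rfl⟩
  exact ⟨g, rfl⟩

theorem exists_of_mem_congruence {l : ℕ} {u : GL (Fin 2) F} (hu : u ∈ congruence F l) :
    ∃ M : Matrix (Fin 2) (Fin 2) 𝒪[F], (∀ i j, M i j ∈ 𝓂[F] ^ l) ∧
      u.val = 1 + M.map (𝒪[F]).subtype := by
  obtain ⟨g, hg, rfl⟩ := hu
  refine ⟨g.val - 1, fun i j => ?_, ?_⟩
  · have hg' : Matrix.GeneralLinearGroup.map (Ideal.Quotient.mk (𝓂[F] ^ l)) g = 1 := hg
    have h1 := congrArg (fun t => t.val i j) hg'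
    rw [← Ideal.Quotient.eq_zero_iff_mem, Matrix.sub_apply, map_sub]
    have h2 : Ideal.Quotient.mk (𝓂[F] ^ l) (g.val i j) =
      (1 : Matrix (Fin 2) (Fin 2) (𝒪[F] ⧸ 𝓂[F] ^ l)) i j := by simpa using h1
    rw [h2]
    by_cases hij : i = j <;> simp [Matrix.one_apply, hij]
  · ext i j
    by_cases hij : i = j <;> simp [Matrix.one_apply, hij]

theorem mem_congruence_of {l : ℕ} (hl : 1 ≤ l) {u : GL (Fin 2) F}
    (M : Matrix (Fin 2) (Fin 2) 𝒪[F]) (hM : ∀ i j, M i j ∈ 𝓂[F] ^ l)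
    (hu : u.val = 1 + M.map (𝒪[F]).subtype) : u ∈ congruence F l := by
  have hle : 𝓂[F] ^ l ≤ 𝓂[F] := Ideal.pow_le_self (by omega)
  have hdet : IsUnit (1 + M).det := by
    have h0 : ∃ y ∈ 𝓂[F], (1 + M).det = 1 + y := by
      refine ⟨(1 + M).det - 1, ?_, by ring⟩
      rw [Matrix.det_fin_two]
      simp only [Matrix.add_apply, Matrix.one_apply_eq, ne_eq, zero_ne_one, not_false_eq_true,
        Matrix.one_apply_ne, one_ne_zero, zero_add]
      have : (1 + M 0 0) * (1 + M 1 1) - M 0 1 * M 1 0 - 1 =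
        M 0 0 + (1 + M 0 0) * M 1 1 - M 0 1 * M 1 0 := by ring
      rw [this]
      exact Ideal.sub_mem _ (Ideal.add_mem _ (hle (hM _ _)) (Ideal.mul_mem_left _ _ (hle (hM _ _))))
        (Ideal.mul_mem_left _ _ (hle (hM _ _)))
    obtain ⟨y, hy, h1⟩ := h0
    rw [h1]
    by_contra hc
    have h1 : 1 + y ∈ 𝓂[F] := (IsLocalRing.mem_maximalIdeal _).2 hc
    have h2 : (1 : 𝒪[F]) ∈ 𝓂[F] := by simpa using Ideal.sub_mem _ h1 hy
    exact (Ideal.ne_top_iff_one _).1 (IsLocalRing.maximalIdeal.isMaximal _).ne_top h2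
  obtain ⟨g, hg⟩ : ∃ g : GL (Fin 2) 𝒪[F], g.val = 1 + M :=
    ⟨Matrix.GeneralLinearGroup.mk'' (1 + M) hdet, rfl⟩
  refine ⟨g, ?_, ?_⟩
  · change Matrix.GeneralLinearGroup.map (Ideal.Quotient.mk (𝓂[F] ^ l)) g = 1
    ext i j
    have : Ideal.Quotient.mk (𝓂[F] ^ l) (M i j) = 0 := Ideal.Quotient.eq_zero_iff_mem.2 (hM i j)
    by_cases hij : i = j
    · subst hij; simp [hg, this]
    · simp [hg, this, hij]
  · ext i j
    rw [hu]
    by_cases hij : i = j <;> simp [hg, hij]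

theorem congruence_anti {l l' : ℕ} (hl : 1 ≤ l) (h : l ≤ l') :
    congruence F l' ≤ congruence F l := by
  intro u hu
  obtain ⟨M, hM, e⟩ := exists_of_mem_congruence hu
  exact mem_congruence_of hl M (fun i j => Ideal.pow_le_pow_right h (hM i j)) e

theorem IsPrincipal.mul {x y : Fˣ} (hx : IsPrincipal x) (hy : IsPrincipal y) :
    IsPrincipal (x * y) := by
  obtain ⟨h, e⟩ := hx
  obtain ⟨h', e'⟩ := hy
  refine ⟨mul_mem h h', ?_⟩
  have : (⟨x * y, mul_mem h h'⟩ : unitsO F) = ⟨x, h⟩ * ⟨y, h'⟩ := rfl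
  rw [this, map_mul, e, e', one_mul]

theorem IsPrincipal.inv {x : Fˣ} (hx : IsPrincipal x) : IsPrincipal x⁻¹ := by
  obtain ⟨h, e⟩ := hx
  refine ⟨inv_mem h, ?_⟩
  have : (⟨x⁻¹, inv_mem h⟩ : unitsO F) = (⟨x, h⟩ : unitsO F)⁻¹ := rfl
  rw [this, map_inv, e, inv_one]

theorem IsPrincipal.div {x y : Fˣ} (hx : IsPrincipal x) (hy : IsPrincipal y) :
    IsPrincipal (x / y) := by
  rw [div_eq_mul_inv]; exact hx.mul hy.inv

theorem IsPrincipal.neg_val {x : Fˣ} (hx : IsPrincipal x) : val x = 0 := hx.1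

/-- The data of an element of `K₁` which enter the cocycle. -/
theorem exists_diag_of_mem {u : GL (Fin 2) F} (hu : u ∈ congruence F 1) :
    ∃ a d : Fˣ, (a : F) = u.val 0 0 ∧ (d : F) = u.val 1 1 ∧ IsPrincipal a ∧ IsPrincipal d ∧
      IsPrincipal (Matrix.GeneralLinearGroup.det u) := by
  obtain ⟨M, hM, e⟩ := exists_of_mem_congruence hu
  simp only [pow_one] at hM
  have key : ∀ y ∈ 𝓂[F], ∃ a : Fˣ, (a : F) = 1 + (y : 𝒪[F]) ∧ IsPrincipal a := by
    intro y hy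
    have h0 : (1 + (y : F)) ≠ 0 := by
      intro h
      have h1 : (1 : 𝒪[F]) + y = 0 := by apply Subtype.ext; simpa using h
      have h2 : (1 : 𝒪[F]) ∈ 𝓂[F] := by
        rw [eq_neg_of_add_eq_zero_left h1]; exact neg_mem hy
      exact (Ideal.ne_top_iff_one _).1 (IsLocalRing.maximalIdeal.isMaximal _).ne_top h2
    exact ⟨Units.mk0 _ h0, rfl, isPrincipal_of _ ⟨y, hy, rfl⟩⟩
  obtain ⟨a, ha, pa⟩ := key _ (hM 0 0)
  obtain ⟨d, hd, pd⟩ := key _ (hM 1 1)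
  refine ⟨a, d, by rw [ha, e]; simp, by rw [hd, e]; simp, pa, pd, ?_⟩
  refine isPrincipal_of _ ⟨M 0 0 + (1 + M 0 0) * M 1 1 - M 0 1 * M 1 0, ?_, ?_⟩
  · exact Ideal.sub_mem _ (Ideal.add_mem _ ((hM _ _)) (Ideal.mul_mem_left _ _ ((hM _ _))))
        (Ideal.mul_mem_left _ _ ((hM _ _)))
  · rw [det_eq, e]
    simp
    ring

/-- The cocycle is trivial on `K₁`. -/
theorem cocycle_congruence {u v : GL (Fin 2) F} (hu : u ∈ congruence F 1)
    (hv : v ∈ congruence F 1) : cocycle n u v = 1 := by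
  obtain ⟨a₁, d₁, ha₁, hd₁, pa₁, pd₁, pD₁⟩ := exists_diag_of_mem hu
  obtain ⟨a₂, d₂, ha₂, hd₂, pa₂, pd₂, pD₂⟩ := exists_diag_of_mem hv
  obtain ⟨a, d, ha, hd, pa, pd, pD⟩ := exists_diag_of_mem (mul_mem hu hv)
  unfold cocycle
  by_cases h1 : u.val 1 0 = 0
  · have hx : X u = d₁ := Units.ext (by rw [X_of_eq h1, hd₁])
    rw [X_mul_left h1]
    apply hilbert_principal_right
    have : X u * X v / (X v * Matrix.GeneralLinearGroup.det u) =
      d₁ / Matrix.GeneralLinearGroup.det u := by rw [hx, mul_comm (X v), mul_div_mul_right_eq_div]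
    rw [this]
    exact pd₁.div pD₁
  by_cases h2 : v.val 1 0 = 0
  · have hx : X v = d₂ := Units.ext (by rw [X_of_eq h2, hd₂])
    apply hilbert_principal_left
    rw [eq_div_of_mul_eq' (X_mul_right_ne h2 h1), hx, mul_div_assoc, mul_div_cancel_left]
    exact pD₂.div pd₂
  have hx := X_of_ne h1
  have hy := X_of_ne h2
  by_cases h12 : (u * v).val 1 0 = 0
  · have hp : X (u * v) = d := Units.ext (by rw [X_of_eq h12, hd])
    have e : X v = -(X u * a₂ / d₁) := by
      rw [eq_comm, neg_eq_iff_eq_neg, div_eq_iff_eq_mul]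
      apply Units.ext
      push_cast
      rw [mul_apply_one_zero] at h12
      rw [hx, hy, ha₂, hd₁]
      linear_combination h12
    have e2 : X (u * v) / (X v * Matrix.GeneralLinearGroup.det u) =
        (-(X (u * v) / X u)) * (d₁ / (a₂ * Matrix.GeneralLinearGroup.det u)) := by
      rw [e]
      apply Units.ext
      push_cast
      field_simp
    rw [e2, hilbert_mul_right, hilbert_neg_self, one_mul]
    exact hilbert_principal_right _ _ _ (pd₁.div (pa₂.mul pD₁))
  · have hp := X_of_ne h12
    have hS := hilbert_steinberg n (X u * a₂ / X (u * v)) (d₁ * X v / X (u * v)) (by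
      push_cast
      rw [← add_div, div_eq_one_iff_eq (Units.ne_zero _), hx, hy, hp, ha₂, hd₁,
        mul_apply_one_zero])
    have e1 : X u * a₂ / X (u * v) = (X (u * v) / X u)⁻¹ * a₂ := by
      rw [inv_div]; simp only [div_eq_mul_inv]; ac_rfl
    have e2 : d₁ * X v / X (u * v) = (X (u * v) / (X v * Matrix.GeneralLinearGroup.det u))⁻¹ *
        (d₁ / Matrix.GeneralLinearGroup.det u) := by
      rw [inv_div, div_mul_div_comm, div_eq_div_iff_mul_eq_mul]
      ac_rfl
    have hinvl : ∀ x y : Fˣ, hilbert n x⁻¹ y = (hilbert n x y)⁻¹ := fun x y => by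
      rw [eq_inv_iff_mul_eq_one, ← hilbert_mul_left, inv_mul_cancel, hilbert_one_left]
    have hinvr : ∀ x y : Fˣ, hilbert n x y⁻¹ = (hilbert n x y)⁻¹ := fun x y => by
      rw [eq_inv_iff_mul_eq_one, ← hilbert_mul_right, inv_mul_cancel, hilbert_one_right]
    rw [e1, e2, hilbert_mul_left, hilbert_mul_right, hilbert_principal_left _ _ _ pa₂,
      hilbert_principal_right _ _ _ (pd₁.div pD₁), mul_one, mul_one, hinvl, hinvr,
      inv_inv] at hS
    exact hS

variable (F) in
/-- The homomorphism `u ↦ (u, 1)` from `K₁` to `G̃`. -/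
noncomputable def congSection : congruence F 1 →* Cover n F where
  toFun u := ⟨u, 1⟩
  map_one' := rfl
  map_mul' u v := by
    refine Cover.ext rfl ?_
    simp [cocycle_congruence n u.2 v.2]

/-- The diagonal matrix `dg(t, s)`. -/
def dg (t s : Fˣ) : GL (Fin 2) F :=
  ⟨!![(t : F), 0; 0, (s : F)], !![((t⁻¹ : Fˣ) : F), 0; 0, ((s⁻¹ : Fˣ) : F)],
    by ext i j; fin_cases i <;> fin_cases j <;> simp [Matrix.mul_apply, Fin.sum_univ_two],
    by ext i j; fin_cases i <;> fin_cases j <;> simp [Matrix.mul_apply, Fin.sum_univ_two]⟩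

/-- Lower unitriangular matrices. -/
def lt (x : F) : GL (Fin 2) F :=
  ⟨!![1, 0; x, 1], !![1, 0; -x, 1],
    by ext i j; fin_cases i <;> fin_cases j <;> simp [Matrix.mul_apply, Fin.sum_univ_two],
    by ext i j; fin_cases i <;> fin_cases j <;> simp [Matrix.mul_apply, Fin.sum_univ_two]⟩

/-- Upper unitriangular matrices. -/
def ut (x : F) : GL (Fin 2) F :=
  ⟨!![1, x; 0, 1], !![1, -x; 0, 1],
    by ext i j; fin_cases i <;> fin_cases j <;> simp [Matrix.mul_apply, Fin.sum_univ_two],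
    by ext i j; fin_cases i <;> fin_cases j <;> simp [Matrix.mul_apply, Fin.sum_univ_two]⟩

theorem lt_add (x y : F) : lt (x + y) = lt x * lt y := by
  ext i j; fin_cases i <;> fin_cases j <;> simp [lt, Matrix.mul_apply, Fin.sum_univ_two]

theorem ut_add (x y : F) : ut (x + y) = ut x * ut y := by
  ext i j; fin_cases i <;> fin_cases j <;> simp [ut, Matrix.mul_apply, Fin.sum_univ_two, add_comm]

theorem lt_nsmul (k : ℕ) (x : F) : lt ((k : F) * x) = lt x ^ k := by
  induction k with
  | zero => ext i j; fin_cases i <;> fin_cases j <;> simp [lt]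
  | succ k ih => rw [pow_succ, ← ih, ← lt_add]; push_cast; ring_nf

theorem ut_nsmul (k : ℕ) (x : F) : ut ((k : F) * x) = ut x ^ k := by
  induction k with
  | zero => ext i j; fin_cases i <;> fin_cases j <;> simp [ut]
  | succ k ih => rw [pow_succ, ← ih, ← ut_add]; push_cast; ring_nf

theorem lt_mem {l : ℕ} (hl : 1 ≤ l) (x : 𝒪[F]) (hx : x ∈ 𝓂[F] ^ l) :
    lt (x : F) ∈ congruence F l :=
  mem_congruence_of hl !![0, 0; x, 0]
    (by intro i j; fin_cases i <;> fin_cases j <;> simp [hx])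
    (by ext i j; fin_cases i <;> fin_cases j <;> simp [lt])

theorem ut_mem {l : ℕ} (hl : 1 ≤ l) (x : 𝒪[F]) (hx : x ∈ 𝓂[F] ^ l) :
    ut (x : F) ∈ congruence F l :=
  mem_congruence_of hl !![0, x; 0, 0]
    (by intro i j; fin_cases i <;> fin_cases j <;> simp [hx])
    (by ext i j; fin_cases i <;> fin_cases j <;> simp [ut])

theorem isUnit_natCast : IsUnit (n : 𝒪[F]) := by
  by_contra hc
  have h1 : (n : 𝒪[F]) ∈ 𝓂[F] := (IsLocalRing.mem_maximalIdeal _).2 hc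
  have h2 : (n : 𝓀[F]) = 0 := by
    have := (IsLocalRing.residue_eq_zero_iff (n : 𝒪[F])).2 h1
    simpa using this
  obtain ⟨k, hk⟩ := hn.out
  have h3 : ((Nat.card 𝓀[F] - 1 : ℕ) : 𝓀[F]) = 0 := by rw [hk]; push_cast; rw [h2, zero_mul]
  have : Fintype 𝓀[F] := Fintype.ofFinite _
  rw [Nat.cast_sub Nat.card_pos, Nat.card_eq_fintype_card, FiniteField.cast_card_eq_zero] at h3
  simp at h3

/-- A congruence matrix factors as lower unitriangular, diagonal, upper unitriangular, with factors
in the same congruence subgroup. -/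
theorem exists_factor {l : ℕ} (hl : 1 ≤ l) {u : GL (Fin 2) F} (hu : u ∈ congruence F l) :
    ∃ (x y : 𝒪[F]) (t s : Fˣ), x ∈ 𝓂[F] ^ l ∧ y ∈ 𝓂[F] ^ l ∧ dg t s ∈ congruence F l ∧
      u = lt (x : F) * dg t s * ut (y : F) := by
  obtain ⟨M, hM, e⟩ := exists_of_mem_congruence hu
  obtain ⟨a, d, ha, hd, pa, pd, pD⟩ := exists_diag_of_mem (congruence_anti le_rfl hl hu)
  have hva : ValuativeRel.valuation F ((a⁻¹ : Fˣ) : F) = 1 :=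
    (val_eq_zero_iff _).1 pa.inv.neg_val
  let a' : 𝒪[F] := ⟨((a⁻¹ : Fˣ) : F), hva.le⟩
  have hx : M 1 0 * a' ∈ 𝓂[F] ^ l := Ideal.mul_mem_right _ _ (hM _ _)
  have hy : a' * M 0 1 ∈ 𝓂[F] ^ l := Ideal.mul_mem_left _ _ (hM _ _)
  have ex : (M 1 0 * a' : 𝒪[F]) = ((u.val 1 0 * (a⁻¹ : Fˣ) : F)) := by rw [e]; simp [a']
  have ey : (a' * M 0 1 : 𝒪[F]) = (((a⁻¹ : Fˣ) * u.val 0 1 : F)) := by rw [e]; simp [a']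
  have hfac : u = lt ((M 1 0 * a' : 𝒪[F]) : F) *
      dg a (Matrix.GeneralLinearGroup.det u * a⁻¹) * ut ((a' * M 0 1 : 𝒪[F]) : F) := by
    have ha0 : (a : F) ≠ 0 := a.ne_zero
    rw [ex, ey]
    ext i j
    fin_cases i <;> fin_cases j <;>
      simp [lt, ut, dg, Matrix.mul_apply, Fin.sum_univ_two, ha]
    · rw [← ha]; field_simp
    · rw [← ha]; field_simp
    · rw [← ha, Matrix.det_fin_two, ← ha]; field_simp; ring
  refine ⟨M 1 0 * a', a' * M 0 1, a, Matrix.GeneralLinearGroup.det u * a⁻¹, hx, hy, ?_, hfac⟩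
  have : dg a (Matrix.GeneralLinearGroup.det u * a⁻¹) =
      (lt ((M 1 0 * a' : 𝒪[F]) : F))⁻¹ * u * (ut ((a' * M 0 1 : 𝒪[F]) : F))⁻¹ := by
    conv_rhs => rw [hfac]
    group
  rw [this]
  exact mul_mem (mul_mem (inv_mem (lt_mem hl _ hx)) hu) (inv_mem (ut_mem hl _ hy))

/-- `(g, ζ)(u, 1)(g, ζ)⁻¹ = (gug⁻¹, 1)` for `u ∈ K_l`, when `g K_l g⁻¹ ⊆ K₁`. -/
theorem conj_congruence {l : ℕ} (hl : 1 ≤ l) (y : Cover n F)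
    (hy : ∀ u ∈ congruence F l, y.mat * u * y.mat⁻¹ ∈ congruence F 1)
    (u : GL (Fin 2) F) (hu : u ∈ congruence F l) :
    y * ⟨u, 1⟩ * y⁻¹ = ⟨y.mat * u * y.mat⁻¹, 1⟩ := by
  have hle : congruence F l ≤ congruence F 1 := congruence_anti le_rfl hl
  have hsec : ∀ v w : GL (Fin 2) F, v ∈ congruence F 1 → w ∈ congruence F 1 →
      (⟨v * w, 1⟩ : Cover n F) = ⟨v, 1⟩ * ⟨w, 1⟩ := fun v w hv hw => by
    have := (congSection n F).map_mul ⟨v, hv⟩ ⟨w, hw⟩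
    exact this
  have hmul : ∀ v w : GL (Fin 2) F, v ∈ congruence F l → w ∈ congruence F l →
      y * ⟨v, 1⟩ * y⁻¹ = ⟨y.mat * v * y.mat⁻¹, 1⟩ → y * ⟨w, 1⟩ * y⁻¹ = ⟨y.mat * w * y.mat⁻¹, 1⟩ →
      y * ⟨v * w, 1⟩ * y⁻¹ = ⟨y.mat * (v * w) * y.mat⁻¹, 1⟩ := by
    intro v w hv hw ev ew
    rw [hsec v w (hle hv) (hle hw)]
    have e1 : y * (⟨v, 1⟩ * ⟨w, 1⟩) * y⁻¹ = (y * ⟨v, 1⟩ * y⁻¹) * (y * ⟨w, 1⟩ * y⁻¹) := by group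
    have e2 : y.mat * (v * w) * y.mat⁻¹ = (y.mat * v * y.mat⁻¹) * (y.mat * w * y.mat⁻¹) := by
      group
    rw [e1, e2, ev, ew, hsec _ _ (hy v hv) (hy w hw)]
  have hpow : ∀ v : GL (Fin 2) F, v ∈ congruence F l →
      y * ⟨v ^ n, 1⟩ * y⁻¹ = ⟨y.mat * v ^ n * y.mat⁻¹, 1⟩ := by
    intro v hv
    have hp : ∀ (w : GL (Fin 2) F), w ∈ congruence F 1 → ∀ k : ℕ,
        (⟨w ^ k, 1⟩ : Cover n F) = ⟨w, 1⟩ ^ k := by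
      intro w hw k
      have := (congSection n F).map_pow ⟨w, hw⟩ k
      exact this
    obtain ⟨z, hz⟩ : ∃ z, y * ⟨v, 1⟩ * y⁻¹ = ⟨y.mat * v * y.mat⁻¹, 1⟩ * Cover.incl n z := by
      refine ⟨(y * ⟨v, 1⟩ * y⁻¹).root, ?_⟩
      rw [Cover.mul_incl]
      exact Cover.ext rfl (by rw [one_mul])
    have hzn : z ^ n = 1 := by
      apply Subtype.ext
      exact z.2
    have e3 : y.mat * v ^ n * y.mat⁻¹ = (y.mat * v * y.mat⁻¹) ^ n := by rw [conj_pow]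
    rw [hp v (hle hv), e3, hp _ (hy v hv), ← conj_pow, hz,
      (Cover.commute_incl n _ z).symm.mul_pow, ← map_pow, hzn, map_one, mul_one]
  obtain ⟨nu, hnu⟩ := isUnit_natCast (F := F) n
  have hdiv : ∀ x : 𝒪[F], x ∈ 𝓂[F] ^ l → ∃ x' ∈ 𝓂[F] ^ l, (x : F) = (n : F) * (x' : 𝒪[F]) := by
    intro x hx
    refine ⟨(nu⁻¹ : (𝒪[F])ˣ) * x, Ideal.mul_mem_left _ _ hx, ?_⟩
    have : (n : 𝒪[F]) * ((nu⁻¹ : (𝒪[F])ˣ) * x) = x := by rw [← hnu]; simp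
    conv_lhs => rw [← this]
    push_cast
    rfl
  obtain ⟨x, z, t, s, hx, hz, hts, rfl⟩ := exists_factor hl hu
  have m1 : lt (x : F) ∈ congruence F l := lt_mem hl x hx
  have m2 : ut (z : F) ∈ congruence F l := ut_mem hl z hz
  have hX : IsPrincipal t ∧ IsPrincipal s ∧
      IsPrincipal (Matrix.GeneralLinearGroup.det (dg t s)) := by
    obtain ⟨a, d, ha, hd, pa, pd, pD⟩ := exists_diag_of_mem (hle hts)
    have e1 : a = t := Units.ext (by rw [ha]; simp [dg])
    have e2 : d = s := Units.ext (by rw [hd]; simp [dg])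
    exact ⟨e1 ▸ pa, e2 ▸ pd, pD⟩
  have hc : IsPrincipal (X (y.mat * dg t s) / X y.mat) := by
    by_cases h : y.mat.val 1 0 = 0
    · rw [X_mul_left h, mul_div_cancel_left]
      have : X (dg t s) = s := Units.ext (by rw [X_of_eq] <;> simp [dg])
      rw [this]; exact hX.2.1
    · have e := X_mul_right_ne (g := y.mat) (h := dg t s) (by simp [dg]) h
      have : X (dg t s) = s := Units.ext (by rw [X_of_eq] <;> simp [dg])
      rw [eq_div_of_mul_eq' e, this, mul_div_assoc, mul_div_cancel_left]
      exact hX.2.2.div hX.2.1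
  have hdg : y * ⟨dg t s, 1⟩ * y⁻¹ = ⟨y.mat * dg t s * y.mat⁻¹, 1⟩ := by
    rw [mul_inv_eq_iff_eq_mul]
    have em : y.mat * dg t s * y.mat⁻¹ * y.mat = y.mat * dg t s := by group
    refine Cover.ext em.symm ?_
    have c1 : cocycle n y.mat (dg t s) = 1 := hilbert_principal_left _ _ _ hc
    have c2 : cocycle n (y.mat * dg t s * y.mat⁻¹) y.mat = 1 := by
      unfold cocycle
      rw [em, map_mul, map_mul, map_inv, mul_inv_cancel_comm]
      apply hilbert_principal_right
      rw [← div_div]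
      exact hc.div hX.2.2
    simp [c1, c2]
  have hlt : y * ⟨lt (x : F), 1⟩ * y⁻¹ = ⟨y.mat * lt (x : F) * y.mat⁻¹, 1⟩ := by
    obtain ⟨x', hx', e⟩ := hdiv x hx
    rw [e, lt_nsmul]
    exact hpow _ (lt_mem hl x' hx')
  have hut : y * ⟨ut (z : F), 1⟩ * y⁻¹ = ⟨y.mat * ut (z : F) * y.mat⁻¹, 1⟩ := by
    obtain ⟨x', hx', e⟩ := hdiv z hz
    rw [e, ut_nsmul]
    exact hpow _ (ut_mem hl x' hx')
  exact hmul _ _ (mul_mem m1 hts) m2 (hmul _ _ m1 hts hlt hdg) hut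

theorem congruence_conj {l : ℕ} {g u : GL (Fin 2) F} (hg : g ∈ maxCompact F)
    (hu : u ∈ congruence F l) : g * u * g⁻¹ ∈ congruence F l := by
  obtain ⟨g, rfl⟩ := hg
  obtain ⟨u, hu, rfl⟩ := hu
  exact ⟨g * u * g⁻¹, (MonoidHom.normal_ker _).conj_mem u hu g, by simp⟩

theorem exists_integral (π : 𝒪[F]) (hπ : Irreducible π) (g : Matrix (Fin 2) (Fin 2) F) :
    ∃ (N : ℕ), ∃ G : Matrix (Fin 2) (Fin 2) 𝒪[F], ∀ i j, (G i j : F) = (π : F) ^ N * g i j := by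
  have hπ0 : (π : F) ≠ 0 := fun h => hπ.ne_zero (Subtype.ext h)
  let p : Fˣ := Units.mk0 (π : F) hπ0
  have hp0 : 0 ≤ val p := (val_nonneg_iff p).2 π.2
  have hp1 : val p ≠ 0 := by
    intro h
    exact hπ.not_isUnit ((Valuation.integer.integers
      (ValuativeRel.valuation F)).isUnit_iff_valuation_eq_one.2 ((val_eq_zero_iff p).1 h))
  have key : ∀ x : F, ∃ N : ℕ, ∀ M : ℕ, N ≤ M →
      ValuativeRel.valuation F ((π : F) ^ M * x) ≤ 1 := by
    intro x
    by_cases hx : x = 0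
    · exact ⟨0, fun M _ => by simp [hx]⟩
    refine ⟨(val (Units.mk0 x hx)).natAbs, fun M hM => ?_⟩
    have h := (val_nonneg_iff (p ^ (M : ℤ) * Units.mk0 x hx)).1 (by
      rw [val_mul, val_zpow]
      have h1 : (1 : ℤ) ≤ val p := by omega
      have h2 : (M : ℤ) * 1 ≤ M * val p := by gcongr
      omega)
    simpa [p] using h
  choose N hN using key
  refine ⟨∑ i, ∑ j, N (g i j), fun i j => ⟨_, hN (g i j) _ ?_⟩, fun i j => rfl⟩
  calc N (g i j) ≤ ∑ j, N (g i j) :=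
        Finset.single_le_sum (f := fun j => N (g i j)) (fun _ _ => Nat.zero_le _)
          (Finset.mem_univ j)
    _ ≤ _ := Finset.single_le_sum (f := fun i => ∑ j, N (g i j)) (fun _ _ => Nat.zero_le _)
          (Finset.mem_univ i)

/-- Conjugation by `g` is continuous for the topology given by the congruence subgroups. -/
theorem exists_conj_le (g : GL (Fin 2) F) {l : ℕ} (hl : 1 ≤ l) :
    ∃ l', l ≤ l' ∧ ∀ u ∈ congruence F l', g * u * g⁻¹ ∈ congruence F l := by
  obtain ⟨π, hπ⟩ := IsDiscreteValuationRing.exists_irreducible 𝒪[F]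
  obtain ⟨N, G, hG⟩ := exists_integral π hπ g.val
  obtain ⟨N', G', hG'⟩ := exists_integral π hπ (g⁻¹).val
  refine ⟨l + N + N', by omega, fun u hu => ?_⟩
  obtain ⟨M, hM, e⟩ := exists_of_mem_congruence hu
  have h1 : ∀ i j, ∃ y : 𝒪[F], M i j = π ^ (l + N + N') * y := by
    intro i j
    have := hM i j
    rw [hπ.maximalIdeal_eq, Ideal.span_singleton_pow, Ideal.mem_span_singleton] at this
    exact this
  choose M' hM' using h1
  refine mem_congruence_of hl (π ^ l • (G * Matrix.of M' * G')) (fun i j => ?_) ?_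
  · rw [Matrix.smul_apply, smul_eq_mul]
    refine Ideal.mul_mem_right _ _ (Ideal.pow_mem_pow ?_ _)
    rw [hπ.maximalIdeal_eq]
    exact Ideal.mem_span_singleton_self π
  · have h2 : (g * u * g⁻¹).val = 1 + g.val * M.map (𝒪[F]).subtype * (g⁻¹).val := by
      rw [Units.val_mul, Units.val_mul, e, mul_add, add_mul, mul_one, Units.mul_inv]
    rw [h2]
    congr 1
    ext i j
    simp only [Matrix.mul_apply, Fin.sum_univ_two, Matrix.map_apply, Matrix.smul_apply,
      Matrix.of_apply, hM', smul_eq_mul, map_mul, map_add, map_pow, Subring.subtype_apply, hG,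
      hG']
    ring

/-- The image in `G̃` of `K_l`, `l ≥ 1`, under the splitting `u ↦ (u, 1)`. These subgroups form a
basis of open neighbourhoods of the identity in `G̃`. -/
def congSet (l : ℕ) : Set (Cover n F) := {x | x.mat ∈ congruence F l ∧ x.root = 1}

theorem congSet_conj {l l' : ℕ} (hl : 1 ≤ l) (hl' : l ≤ l') (y : Cover n F)
    (hy : ∀ u ∈ congruence F l', y.mat * u * y.mat⁻¹ ∈ congruence F l) {x : Cover n F}
    (hx : x ∈ congSet n l') : y * x * y⁻¹ ∈ congSet n l := by
  obtain ⟨u, z⟩ := x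
  obtain ⟨hu, hz⟩ := hx
  change z = 1 at hz
  subst hz
  rw [conj_congruence n (hl.trans hl') y (fun u hu => congruence_anti le_rfl hl (hy u hu)) u hu]
  exact ⟨hy u hu, rfl⟩

/-! ### Subgroups of the cover -/

variable (F)

/-- The diagonal torus `T` of `GL₂(F)`. -/
def torusMat : Subgroup (GL (Fin 2) F) where
  carrier := {g | g.val 0 1 = 0 ∧ g.val 1 0 = 0}
  one_mem' := by simp
  mul_mem' {g h} hg hh := by
    have h1 : g.val 0 1 = 0 ∧ g.val 1 0 = 0 := hg
    have h2 : h.val 0 1 = 0 ∧ h.val 1 0 = 0 := hh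
    constructor <;> simp [Matrix.mul_apply, Fin.sum_univ_two, h1, h2]
  inv_mem' {g} hg := by
    have h1 : g.val 0 1 = 0 ∧ g.val 1 0 = 0 := hg
    constructor <;> simp [Matrix.inv_def, Matrix.adjugate_fin_two, h1]

/-- The Borel subgroup `B` of upper triangular matrices. -/
def borelMat : Subgroup (GL (Fin 2) F) where
  carrier := {g | g.val 1 0 = 0}
  one_mem' := by simp
  mul_mem' {g h} hg hh := by
    have h1 : g.val 1 0 = 0 := hg
    have h2 : h.val 1 0 = 0 := hh
    simp [Matrix.mul_apply, Fin.sum_univ_two, h1, h2]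
  inv_mem' {g} hg := by
    have h1 : g.val 1 0 = 0 := hg
    simp [Matrix.inv_def, Matrix.adjugate_fin_two, h1]

/-- `T̃`, the inverse image of the torus. -/
noncomputable def torus : Subgroup (Cover n F) := (torusMat F).comap (Cover.proj n)

/-- `B̃`, the inverse image of the Borel subgroup. -/
noncomputable def borel : Subgroup (Cover n F) := (borelMat F).comap (Cover.proj n)

/-- `K̃`, the inverse image of `K = GL₂(𝒪)`. -/
noncomputable def maxK : Subgroup (Cover n F) := (maxCompact F).comap (Cover.proj n)

/-- `T̃¹`, the inverse image of the torus of `SL₂(F)`. -/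
noncomputable def torusOne : Subgroup (Cover n F) :=
  (torusMat F ⊓ (Matrix.GeneralLinearGroup.det (n := Fin 2) (R := F)).ker).comap (Cover.proj n)

/-- The centre `Z(T̃)` of `T̃`. -/
noncomputable def centerT : Subgroup (Cover n F) :=
  torus n F ⊓ Subgroup.centralizer (torus n F : Set (Cover n F))

/-- `A = C_{T̃}(T̃ ∩ K̃)`. -/
noncomputable def groupA : Subgroup (Cover n F) :=
  torus n F ⊓ Subgroup.centralizer ((torus n F ⊓ maxK n F : Subgroup (Cover n F)) : Set (Cover n F))

theorem centerT_le_groupA : centerT n F ≤ groupA n F :=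
  inf_le_inf_left _ (Subgroup.centralizer_le (fun _ hx => hx.1))

variable {F}

theorem X_dg (t s : Fˣ) : X (dg t s) = s := Units.ext (by rw [X_of_eq] <;> simp [dg])

theorem det_dg (t s : Fˣ) : Matrix.GeneralLinearGroup.det (dg t s) = t * s :=
  Units.ext (by rw [det_eq]; simp [dg])

theorem dg_mul (t s t' s' : Fˣ) : dg (t * t') (s * s') = dg t s * dg t' s' := by
  ext i j; fin_cases i <;> fin_cases j <;> simp [dg, Matrix.mul_apply, Fin.sum_univ_two]

theorem dg_mem (t s : Fˣ) : dg t s ∈ torusMat F := by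
  constructor <;> simp [dg]

/-- The lower right entry of an upper triangular matrix. -/
noncomputable def diagR (g : GL (Fin 2) F) : Fˣ := X g

/-- The upper left entry of an upper triangular matrix. -/
noncomputable def diagL (g : GL (Fin 2) F) : Fˣ := Matrix.GeneralLinearGroup.det g / X g

theorem diagR_coe {g : GL (Fin 2) F} (hg : g ∈ borelMat F) : (diagR g : F) = g.val 1 1 :=
  X_of_eq hg

theorem diagL_coe {g : GL (Fin 2) F} (hg : g ∈ borelMat F) : (diagL g : F) = g.val 0 0 := by
  have h : g.val 1 0 = 0 := hg
  have h2 := X_of_eq h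
  have h3 : g.val 1 1 ≠ 0 := by rw [← h2]; exact (X g).ne_zero
  rw [diagL, Units.val_div_eq_div_val, h2, det_eq, h]
  field_simp
  ring

theorem diagR_mul {g : GL (Fin 2) F} (hg : g ∈ borelMat F) (h : GL (Fin 2) F) :
    diagR (g * h) = diagR g * diagR h := X_mul_left hg

theorem diagL_mul {g : GL (Fin 2) F} (hg : g ∈ borelMat F) (h : GL (Fin 2) F) :
    diagL (g * h) = diagL g * diagL h := by
  rw [diagL, X_mul_left hg, map_mul, mul_div_mul_comm]; rfl

theorem torusMat_le : torusMat F ≤ borelMat F := fun _ h => h.2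

theorem dg_diag {g : GL (Fin 2) F} (hg : g ∈ torusMat F) : dg (diagL g) (diagR g) = g := by
  ext i j
  have h1 : g.val 0 1 = 0 := hg.1
  have h2 : g.val 1 0 = 0 := hg.2
  fin_cases i <;> fin_cases j <;>
    simp [dg, diagL_coe (torusMat_le hg), diagR_coe (torusMat_le hg), h1, h2]

theorem cocycle_borel {g : GL (Fin 2) F} (hg : g ∈ borelMat F) (h : GL (Fin 2) F) :
    cocycle n g h = hilbert n (diagR h) (diagL g)⁻¹ := by
  rw [cocycle, X_mul_left hg, mul_div_cancel_left, mul_comm (X h), mul_div_mul_right_eq_div,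
    diagL, inv_div]; rfl

/-- The projection `B̃ = T̃ ⋉ N → T̃`, `((a b; 0 d), ζ) ↦ (dg(a, d), ζ)`. -/
noncomputable def borelToTorus : borel n F →* torus n F where
  toFun b := ⟨⟨dg (diagL b.1.mat) (diagR b.1.mat), b.1.root⟩, dg_mem _ _⟩
  map_one' := by
    apply Subtype.ext
    refine Cover.ext ?_ rfl
    exact dg_diag (one_mem _)
  map_mul' b c := by
    apply Subtype.ext
    have hb : b.1.mat ∈ borelMat F := b.2
    refine Cover.ext ?_ ?_
    · change dg (diagL (b.1.mat * c.1.mat)) (diagR (b.1.mat * c.1.mat)) = dg _ _ * dg _ _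
      rw [diagL_mul hb, diagR_mul hb, dg_mul]
    · change cocycle n b.1.mat c.1.mat * _ = cocycle n (dg _ _) (dg _ _) * _
      rw [cocycle_borel n hb, cocycle_borel n (torusMat_le (dg_mem _ _))]
      simp only [diagL, diagR, X_dg, det_dg, div_mul_cancel]

theorem val_det_of_mem {g : GL (Fin 2) F} (hg : g ∈ maxCompact F) :
    val (Matrix.GeneralLinearGroup.det g) = 0 := by
  obtain ⟨h, rfl⟩ := hg
  rw [val_eq_zero_iff]
  have h1 : IsUnit (Matrix.GeneralLinearGroup.det h : 𝒪[F]ˣ).val := Units.isUnit _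
  have h2 := (Valuation.integer.integers
      (ValuativeRel.valuation F)).isUnit_iff_valuation_eq_one.1 h1
  rw [← h2]
  congr 1

theorem val_diag_of_mem {g : GL (Fin 2) F} (hg : g ∈ maxCompact F) (hb : g ∈ borelMat F) :
    val (diagL g) = 0 ∧ val (diagR g) = 0 := by
  have h0 := val_det_of_mem hg
  have h1 : Matrix.GeneralLinearGroup.det g = diagL g * diagR g := by
    rw [diagL, diagR, div_mul_cancel]
  have h2 : 0 ≤ val (diagL g) := by
    rw [val_nonneg_iff, diagL_coe hb]
    obtain ⟨h, rfl⟩ := hg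
    exact (h.val 0 0).2
  have h3 : 0 ≤ val (diagR g) := by
    rw [val_nonneg_iff, diagR_coe hb]
    obtain ⟨h, rfl⟩ := hg
    exact (h.val 1 1).2
  rw [h1, val_mul] at h0
  omega

theorem dg_mem_maxCompact {t s : Fˣ} (ht : val t = 0) (hs : val s = 0) :
    dg t s ∈ maxCompact F := by
  have hd : IsUnit (Matrix.det !![(toIntegerUnit ⟨t, ht⟩ : 𝒪[F]), 0;
      0, (toIntegerUnit ⟨s, hs⟩ : 𝒪[F])]) := by
    rw [Matrix.det_fin_two_of, mul_zero, sub_zero]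
    exact (Units.isUnit _).mul (Units.isUnit _)
  obtain ⟨g, hg⟩ : ∃ g : GL (Fin 2) 𝒪[F], g.val = !![(toIntegerUnit ⟨t, ht⟩ : 𝒪[F]), 0;
      0, (toIntegerUnit ⟨s, hs⟩ : 𝒪[F])] := ⟨Matrix.GeneralLinearGroup.mk'' _ hd, rfl⟩
  refine ⟨g, ?_⟩
  ext i j
  fin_cases i <;> fin_cases j <;> simp [hg, dg, toIntegerUnit]

/-- `T̃ ∩ K̃` is commutative, so it is contained in `A`. -/
theorem torus_inf_maxK_le : torus n F ⊓ maxK n F ≤ groupA n F := by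
  rintro x ⟨hx, hx'⟩
  refine ⟨hx, Subgroup.mem_centralizer_iff.2 ?_⟩
  rintro y ⟨hy, hy'⟩
  have mx : x.mat ∈ torusMat F := hx
  have my : y.mat ∈ torusMat F := hy
  obtain ⟨ax, bx⟩ := val_diag_of_mem (g := x.mat) hx' (torusMat_le mx)
  obtain ⟨ay, bY⟩ := val_diag_of_mem (g := y.mat) hy' (torusMat_le my)
  refine Cover.ext ?_ ?_
  · change y.mat * x.mat = x.mat * y.mat
    rw [← dg_diag mx, ← dg_diag my, ← dg_mul, ← dg_mul, mul_comm (diagL _), mul_comm (diagR _)]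
  · simp only [Cover.root_mul]
    rw [cocycle_borel n (torusMat_le my), cocycle_borel n (torusMat_le mx),
      hilbert_units _ _ _ bx (by rw [val_inv, ay, neg_zero]),
      hilbert_units _ _ _ bY (by rw [val_inv, ax, neg_zero]), mul_comm x.root]

/-- The element `(dg(t, s), 1)` of `T̃ ∩ K̃ ⊆ A`, for units `t`, `s`. -/
noncomputable def unitDiag (t s : Fˣ) (ht : val t = 0) (hs : val s = 0) : groupA n F :=
  ⟨⟨dg t s, 1⟩, torus_inf_maxK_le n ⟨dg_mem t s, dg_mem_maxCompact ht hs⟩⟩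

/-- The projection `B̃ ∩ K̃ → T̃ ∩ K̃ ⊆ A`. -/
noncomputable def borelKToA : (borel n F).subgroupOf (maxK n F) →* groupA n F where
  toFun b := ⟨borelToTorus n ⟨b.1.1, b.2⟩, torus_inf_maxK_le n ⟨(borelToTorus n ⟨b.1.1, b.2⟩).2, by
    have hb : b.1.1.mat ∈ borelMat F := b.2
    have hk : b.1.1.mat ∈ maxCompact F := b.1.2
    have h := val_diag_of_mem hk hb
    exact dg_mem_maxCompact h.1 h.2⟩⟩
  map_one' := by
    have h := congrArg Subtype.val (map_one (borelToTorus (F := F) n))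
    exact Subtype.ext h
  map_mul' b c := by
    have h := congrArg Subtype.val
      (map_mul (borelToTorus n) (⟨b.1.1, b.2⟩ : borel n F) ⟨c.1.1, c.2⟩)
    exact Subtype.ext h

theorem incl_mem_groupA (z : rootsOfUnity n 𝓀[F]) : Cover.incl n z ∈ groupA n F := by
  refine ⟨one_mem (torusMat F), Subgroup.mem_centralizer_iff.2 ?_⟩
  intro y _
  exact (Cover.commute_incl n y z).eq.symm

/-- `ϖ(a) = (ϖ, a)_n`, as a homomorphism on `Fˣ`. -/
noncomputable def varpiChar (ϖ : Fˣ) : Fˣ →* rootsOfUnity n 𝓀[F] where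
  toFun a := hilbert n ϖ a
  map_one' := hilbert_one_right n ϖ
  map_mul' := hilbert_mul_right n ϖ

/-- The character
`χ'_{i,j}(dg(s, t), ζ) = χ'₀(dg(s, t), ϖ(s)^{-j} ϖ(t)^{-i} ζ)` of `A`. For
`s = aϖ^{un}`, `t = bϖ^{vn}` with units `a`, `b` one has `ϖ(s) = ϖ(a)` and `ϖ(t) = ϖ(b)`. -/
noncomputable def chi (ϖ : Fˣ) (χ₀ : groupA n F →* ℂˣ) (i j : ℕ) : groupA n F →* ℂˣ where
  toFun x := χ₀ (x * ⟨Cover.incl n ((varpiChar n ϖ (diagL x.1.mat))⁻¹ ^ j *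
    (varpiChar n ϖ (diagR x.1.mat))⁻¹ ^ i), incl_mem_groupA n _⟩)
  map_one' := by
    have h1 : diagL (1 : GL (Fin 2) F) = 1 := by simp [diagL, X_one]
    have h2 : diagR (1 : GL (Fin 2) F) = 1 := by simp [diagR, X_one]
    have : (⟨Cover.incl n 1, incl_mem_groupA n 1⟩ : groupA n F) = 1 := Subtype.ext (map_one _)
    have e : varpiChar n ϖ 1 = 1 := map_one _
    rw [Subgroup.coe_one, Cover.mat_one, h1, h2]
    simp only [map_one, inv_one, one_pow, mul_one]
    rw [one_mul]
    exact (congrArg χ₀ this).trans (map_one χ₀)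
  map_mul' x y := by
    have hx : x.1.mat ∈ borelMat F := torusMat_le x.2.1
    rw [← map_mul]
    congr 1
    apply Subtype.ext
    have key : ∀ (a b : Cover n F) (z w : rootsOfUnity n 𝓀[F]),
        a * b * Cover.incl n (z * w) = a * Cover.incl n z * (b * Cover.incl n w) := by
      intro a b z w
      rw [map_mul, mul_assoc a (Cover.incl n z), ← mul_assoc (Cover.incl n z) b,
        (Cover.commute_incl n b z).eq]
      simp only [mul_assoc]
    have e : (varpiChar n ϖ (diagL (x * y).1.mat))⁻¹ ^ j *
        (varpiChar n ϖ (diagR (x * y).1.mat))⁻¹ ^ i =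
        (varpiChar n ϖ (diagL x.1.mat))⁻¹ ^ j * (varpiChar n ϖ (diagR x.1.mat))⁻¹ ^ i *
        ((varpiChar n ϖ (diagL y.1.mat))⁻¹ ^ j * (varpiChar n ϖ (diagR y.1.mat))⁻¹ ^ i) := by
      rw [Subgroup.coe_mul, Cover.mat_mul, diagL_mul hx, diagR_mul hx, map_mul, map_mul, mul_inv,
        mul_inv, mul_pow, mul_pow]
      exact mul_mul_mul_comm _ _ _ _
    change x.1 * y.1 * Cover.incl n _ = x.1 * Cover.incl n _ * (y.1 * Cover.incl n _)
    rw [e]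
    exact key _ _ _ _

/-! ### Smooth induction and fixed vectors -/

/-- A character as a one-dimensional representation. -/
noncomputable def charRep {G : Type*} [Group G] (χ : G →* ℂˣ) : Representation ℂ G ℂ where
  toFun g := ((χ g : ℂˣ) : ℂ) • LinearMap.id
  map_one' := by ext; simp
  map_mul' g h := by ext; simp [mul_comm]

variable {n}

/-- The vectors of a representation of `G` fixed by `K_l` for some `l ≥ 1`, where `G` maps to
`G̃` by `j` (in the applications `j` is the inclusion of a subgroup). -/
noncomputable def smoothVectors {G : Type*} [Group G] (j : G →* Cover n F) {W : Type*} [AddCommGroup W]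
    [Module ℂ W] (π : Representation ℂ G W) : Subrepresentation π where
  toSubmodule :=
    { carrier := {w | ∃ l, 1 ≤ l ∧ ∀ x : G, j x ∈ congSet n l → π x w = w}
      zero_mem' := ⟨1, le_rfl, fun x _ => map_zero _⟩
      add_mem' := by
        rintro v w ⟨l, hl, hv⟩ ⟨l', hl', hw⟩
        refine ⟨max l l', by omega, fun x hx => ?_⟩
        rw [map_add, hv x ⟨congruence_anti hl (le_max_left _ _) hx.1, hx.2⟩,
          hw x ⟨congruence_anti hl' (le_max_right _ _) hx.1, hx.2⟩]
      smul_mem' := by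
        rintro c v ⟨l, hl, hv⟩
        exact ⟨l, hl, fun x hx => by rw [map_smul, hv x hx]⟩ }
  apply_mem_toSubmodule y := by
    rintro v ⟨l, hl, hv⟩
    obtain ⟨l', hl', h⟩ := exists_conj_le ((j y).mat)⁻¹ hl
    refine ⟨l', hl.trans hl', fun x hx => ?_⟩
    have hm : j (y⁻¹ * x * y) ∈ congSet n l := by
      have := congSet_conj n hl hl' (j y)⁻¹ h hx
      rwa [inv_inv, ← map_inv, ← map_mul, ← map_mul] at this
    have e : x * y = y * (y⁻¹ * x * y) := by group
    rw [← Module.End.mul_apply, ← map_mul, e, map_mul, Module.End.mul_apply, hv _ hm]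

/-- The space of functions `f : G → V` which satisfy `f(hg) = σ(h) f(g)` and are fixed by right
translation by `K_l` for some `l ≥ 1`. -/
def SmoothIndSpace {G : Type*} [Group G] (j : G →* Cover n F) (H : Subgroup G)
    {V : Type*} [AddCommGroup V] [Module ℂ V] (σ : Representation ℂ H V) : Type _ :=
  (smoothVectors j (Representation.coind H.subtype σ)).toSubmodule

noncomputable instance {G : Type*} [Group G] (j : G →* Cover n F) (H : Subgroup G)
    {V : Type*} [AddCommGroup V] [Module ℂ V] (σ : Representation ℂ H V) :
    AddCommGroup (SmoothIndSpace j H σ) :=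
  inferInstanceAs (AddCommGroup (smoothVectors j (Representation.coind H.subtype σ)).toSubmodule)

noncomputable instance {G : Type*} [Group G] (j : G →* Cover n F) (H : Subgroup G)
    {V : Type*} [AddCommGroup V] [Module ℂ V] (σ : Representation ℂ H V) :
    Module ℂ (SmoothIndSpace j H σ) :=
  inferInstanceAs (Module ℂ (smoothVectors j (Representation.coind H.subtype σ)).toSubmodule)

/-- Smooth (non-normalized) induction from `H` to `G`: the action of `G` by right translation. -/
noncomputable def smoothInd {G : Type*} [Group G] (j : G →* Cover n F) (H : Subgroup G)
    {V : Type*} [AddCommGroup V] [Module ℂ V] (σ : Representation ℂ H V) :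
    Representation ℂ G (SmoothIndSpace j H σ) :=
  (smoothVectors j (Representation.coind H.subtype σ)).toRepresentation

/-- The `K_l`-fixed vectors (`l ≥ 1`) of a representation of `K̃`. -/
noncomputable def fixedVectors {W : Type*} [AddCommGroup W] [Module ℂ W]
    (π : Representation ℂ (maxK n F) W) (l : ℕ) (hl : 1 ≤ l) : Subrepresentation π where
  toSubmodule :=
    { carrier := {w | ∀ x : maxK n F, (x : Cover n F) ∈ congSet n l → π x w = w}
      zero_mem' := fun x _ => map_zero _
      add_mem' := fun {v w} hv hw x hx => by rw [map_add, hv x hx, hw x hx]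
      smul_mem' := fun c v hv x hx => by rw [map_smul, hv x hx] }
  apply_mem_toSubmodule y := by
    intro v hv x hx
    have hy : ((y : Cover n F)⁻¹).mat ∈ maxCompact F := inv_mem y.2
    have hm : ((y⁻¹ * x * y : maxK n F) : Cover n F) ∈ congSet n l := by
      have := congSet_conj n hl le_rfl (y : Cover n F)⁻¹ (fun u hu => congruence_conj hy hu) hx
      rwa [inv_inv] at this
    have e : x * y = y * (y⁻¹ * x * y) := by group
    rw [← Module.End.mul_apply, ← map_mul, e, map_mul, Module.End.mul_apply, hv _ hm]

/-- The representation of `K̃` on `W^{K_l}`. -/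
noncomputable def levelRep {W : Type*} [AddCommGroup W] [Module ℂ W]
    (π : Representation ℂ (maxK n F) W) (l : ℕ) (hl : 1 ≤ l) : Representation ℂ (maxK n F) (fixedVectors π l hl).toSubmodule :=
  (fixedVectors π l hl).toRepresentation

/-- `W^{K_{l-1}}` as a subspace of `W^{K_l}`. -/
noncomputable def prevLevel {W : Type*} [AddCommGroup W] [Module ℂ W]
    (π : Representation ℂ (maxK n F) W) (l : ℕ) (hl : 2 ≤ l) :
    Submodule ℂ (fixedVectors π l (one_le_two.trans hl)).toSubmodule :=
  (fixedVectors π (l - 1) (Nat.le_sub_one_of_lt hl)).toSubmodule.comap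
    (fixedVectors π l (one_le_two.trans hl)).toSubmodule.subtype

/-- The space `W^{K_l} / W^{K_{l-1}}`. -/
def LevelQuotient {W : Type*} [AddCommGroup W] [Module ℂ W]
    (π : Representation ℂ (maxK n F) W) (l : ℕ) (hl : 2 ≤ l) : Type _ :=
  (fixedVectors π l (one_le_two.trans hl)).toSubmodule ⧸ prevLevel π l hl

noncomputable instance {W : Type*} [AddCommGroup W] [Module ℂ W]
    (π : Representation ℂ (maxK n F) W) (l : ℕ) (hl : 2 ≤ l) :
    AddCommGroup (LevelQuotient π l hl) :=
  inferInstanceAs (AddCommGroup (_ ⧸ prevLevel π l hl))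

noncomputable instance {W : Type*} [AddCommGroup W] [Module ℂ W]
    (π : Representation ℂ (maxK n F) W) (l : ℕ) (hl : 2 ≤ l) :
    Module ℂ (LevelQuotient π l hl) :=
  inferInstanceAs (Module ℂ (_ ⧸ prevLevel π l hl))

/-- The representation of `K̃` on the quotient `W^{K_l} / W^{K_{l-1}}`. -/
noncomputable def levelQuotient {W : Type*} [AddCommGroup W] [Module ℂ W]
    (π : Representation ℂ (maxK n F) W) (l : ℕ) (hl : 2 ≤ l) :
    Representation ℂ (maxK n F) (LevelQuotient π l hl) :=
  (levelRep π l (one_le_two.trans hl)).quotient (prevLevel π l hl) (fun g _ hv =>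
    (fixedVectors π (l - 1) (Nat.le_sub_one_of_lt hl)).apply_mem_toSubmodule g hv)

/-- The space `W^{K_m} ⊕ ⨁_{l > m} W^{K_l} / W^{K_{l-1}}`. -/
def GradedSpace {W : Type*} [AddCommGroup W] [Module ℂ W]
    (π : Representation ℂ (maxK n F) W) (m : ℕ) (hm : 1 ≤ m) : Type _ :=
  (fixedVectors π m hm).toSubmodule ×
    ⨁ l : {l : ℕ // m < l}, LevelQuotient π l (lt_of_le_of_lt hm l.2)

noncomputable instance {W : Type*} [AddCommGroup W] [Module ℂ W]
    (π : Representation ℂ (maxK n F) W) (m : ℕ) (hm : 1 ≤ m) :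
    AddCommGroup (GradedSpace π m hm) :=
  inferInstanceAs (AddCommGroup ((fixedVectors π m hm).toSubmodule ×
    ⨁ l : {l : ℕ // m < l}, LevelQuotient π l (lt_of_le_of_lt hm l.2)))

noncomputable instance {W : Type*} [AddCommGroup W] [Module ℂ W]
    (π : Representation ℂ (maxK n F) W) (m : ℕ) (hm : 1 ≤ m) :
    Module ℂ (GradedSpace π m hm) :=
  inferInstanceAs (Module ℂ ((fixedVectors π m hm).toSubmodule ×
    ⨁ l : {l : ℕ // m < l}, LevelQuotient π l (lt_of_le_of_lt hm l.2)))

/-- The representation of `K̃` on `W^{K_m} ⊕ ⨁_{l > m} W^{K_l} / W^{K_{l-1}}`. -/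
noncomputable def gradedRep {W : Type*} [AddCommGroup W] [Module ℂ W]
    (π : Representation ℂ (maxK n F) W) (m : ℕ) (hm : 1 ≤ m) :
    Representation ℂ (maxK n F) (GradedSpace π m hm) :=
  (levelRep π m hm).prod (Representation.directSum
    (V := fun l : {l : ℕ // m < l} => LevelQuotient π l (lt_of_le_of_lt hm l.2))
    (fun l => levelQuotient π l (lt_of_le_of_lt hm l.2)))

variable (n)

/-- The principal series `Ind_{B̃}^{G̃} ρ'`, where `ρ'` is extended trivially over `N`. -/
noncomputable def principalSeries {V : Type*} [AddCommGroup V] [Module ℂ V]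
    (ρ : Representation ℂ (torus n F) V) : Representation ℂ (Cover n F)
      (SmoothIndSpace (MonoidHom.id (Cover n F)) (borel n F) (ρ.comp (borelToTorus n))) :=
  smoothInd (MonoidHom.id (Cover n F)) (borel n F) (ρ.comp (borelToTorus n))

/-- The space of `Ind_{B̃ ∩ K̃}^{K̃} χ`. -/
def IndKSpace (χ : groupA n F →* ℂˣ) : Type _ :=
  SmoothIndSpace (maxK n F).subtype ((borel n F).subgroupOf (maxK n F))
    (charRep (χ.comp (borelKToA n)))

noncomputable instance (χ : groupA n F →* ℂˣ) : AddCommGroup (IndKSpace n χ) :=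
  inferInstanceAs (AddCommGroup (SmoothIndSpace (maxK n F).subtype
    ((borel n F).subgroupOf (maxK n F)) (charRep (χ.comp (borelKToA n)))))

noncomputable instance (χ : groupA n F →* ℂˣ) : Module ℂ (IndKSpace n χ) :=
  inferInstanceAs (Module ℂ (SmoothIndSpace (maxK n F).subtype
    ((borel n F).subgroupOf (maxK n F)) (charRep (χ.comp (borelKToA n)))))

/-- `Ind_{B̃ ∩ K̃}^{K̃} χ`, for a character `χ` of `A`, restricted to `T̃ ∩ K̃` and extended
trivially to `B̃ ∩ K̃`. -/
noncomputable def indK (χ : groupA n F →* ℂˣ) :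
    Representation ℂ (maxK n F) (IndKSpace n χ) :=
  smoothInd (maxK n F).subtype ((borel n F).subgroupOf (maxK n F))
    (charRep (χ.comp (borelKToA n)))

/-- A character `γ` of a subgroup `D` of `G̃` is primitive mod `m` if `m` is the smallest
positive integer such that `γ` is trivial on `D ∩ K_m`. -/
def IsPrimitiveMod {D : Subgroup (Cover n F)} (γ : D →* ℂˣ) (m : ℕ) : Prop :=
  IsLeast {m : ℕ | 1 ≤ m ∧ ∀ z : D, (z : Cover n F) ∈ congSet n m → γ z = 1} m

end Cover

end CoverGL2

/-!
The representation `Ind_{B̃ ∩ K̃}^{K̃} χ` is a space of functions on `K̃`, and its `K_l`-fixed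
part is a representation of a finite quotient of `K̃`, so Maschke's theorem applies to it. Two
facts drive the proof.

*Irreducibility by counting spherical functions.* Let `ψ` be the character of `B̃ ∩ K̃` given by
`χ`. Evaluation at `1` is a functional on any nonzero subrepresentation that transforms by `ψ`, so
every nonzero subrepresentation of the `K_l`-fixed part contains a `ψ`-spherical vector that does
not vanish at `1` (`FunctionModel.exists_spherical`); and the function `δ` supported on
`(B̃ ∩ K̃)K_l` generates the whole space, because convolution with it is a nonzero multiple of the
identity (`FunctionModel.convolve_delta`). Hence one-dimensionality of the space of spherical
vectors gives irreducibility, a plane of spherical vectors gives a sum of two irreducibles, and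
one extra spherical vector in passing from level `l - 1` to level `l` makes the quotient
irreducible. Spherical vectors are functions on `K̃` with `f(bx) = ψ(b)f(x) = f(xb)`. They are
determined by their values at lower unitriangular elements with entry `z`, which depend only on
the valuation of `z`. For `l > m`, the double coset of valuation `l - 1` accounts for the extra
vector (`levelQuotient_isIrreducible`). At level `m`, conjugating a lower unitriangular element by
an upper triangular one (`IsBiEquivariant.apply_lowK_eq_zero`) shows that `f` vanishes at
valuations strictly between `0` and `m` when `χ` is primitive on the torus of `SL₂`, and at
valuation `0` unless `ψ(dg(1, u)) = ψ(dg(u, 1))` for all units `u`; in the latter case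
`exists_bigCell` writes down a spherical vector (`levelRep_isIrreducible`, `levelRep_exists_two`).

*Structure of `ρ'`.* The units of `T̃` have a simultaneous eigenvector `v` in `ρ'`, and modulo the
centre `T̃` is generated by the units and the elements `dg(ϖ^c, ϖ^d)`. Moving `v` by the latter
multiplies its eigencharacter by powers of `(ϖ, ·)_n`, so `ρ'` has a basis on which `T̃ ∩ K̃` acts
through the `n²` characters `χ'_{i,j}` (`exists_basis`). By the Iwasawa decomposition, restriction
to `K̃` followed by taking coordinates identifies `Ind_{B̃}^{G̃} ρ'` with the sum of the
`Ind_{B̃ ∩ K̃}^{K̃} χ'_{i,j}` (`nonempty_equiv_directSum`), each of which is isomorphic to its graded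
representation for the filtration by level (`nonempty_equiv_gradedRep`). Finally, the condition on
`ψ` at level `m` for `χ'_{i,j}` reads `χ'₀(dg(u, u⁻¹)) = ε(ϖ(u))^{j - i}`
(`borelChar_chi_eq_iff`).
-/

namespace CoverGL2

/-! ### Representations that factor through a finite quotient -/

section FiniteQuotient

variable {G W : Type*} [Group G] [AddCommGroup W] [Module ℂ W] {π : Representation ℂ G W}

theorem exists_add_of_isCompl {U U' : Subrepresentation π} (h : IsCompl U U') (w : W) :
    ∃ u ∈ U, ∃ u' ∈ U', u + u' = w := by
  have hw : w ∈ U.toSubmodule ⊔ U'.toSubmodule := by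
    rw [← Subrepresentation.toSubmodule_sup, h.sup_eq_top]
    exact Submodule.mem_top
  exact Submodule.mem_sup.1 hw

theorem eq_zero_of_isCompl {U U' : Subrepresentation π} (h : IsCompl U U') {w : W}
    (hw : w ∈ U) (hw' : w ∈ U') : w = 0 := by
  have h1 : w ∈ U ⊓ U' := ⟨hw, hw'⟩
  rw [h.inf_eq_bot] at h1
  exact h1

theorem subrep_eq_top {U : Subrepresentation π} (h : ∀ w, w ∈ U) : U = ⊤ :=
  Subrepresentation.toSubmodule_injective (Submodule.eq_top_iff'.2 h)

theorem exists_ne_zero_of_ne_bot {U : Subrepresentation π} (h : U ≠ ⊥) : ∃ w ∈ U, w ≠ 0 := by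
  by_contra! hc
  exact h (Subrepresentation.toSubmodule_injective ((Submodule.eq_bot_iff _).2 hc))

/-- Maschke's theorem for a representation of a possibly infinite group on which a normal subgroup
of finite index acts trivially. -/
theorem exists_isCompl_of_finiteIndex (N : Subgroup G) [N.Normal] [N.FiniteIndex]
    (hN : ∀ g ∈ N, ∀ w, π g w = w) (U : Subrepresentation π) : ∃ U', IsCompl U U' := by
  have : Representation.IsTrivial (π.comp N.subtype) :=
    ⟨fun g => LinearMap.ext fun w => hN g g.2 w⟩
  have : NeZero (Nat.card (G ⧸ N) : ℂ) := ⟨by exact_mod_cast Nat.card_pos.ne'⟩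
  let σ := π.ofQuotient N
  have hσ : ∀ (g : G) (w : W), σ (g : G ⧸ N) w = π g w := fun g w => rfl
  let U₁ : Subrepresentation σ := ⟨U.toSubmodule, fun q => by
    induction q using QuotientGroup.induction_on with
    | H g => exact fun v hv => U.apply_mem_toSubmodule g hv⟩
  obtain ⟨U₂, h⟩ := exists_isCompl U₁
  refine ⟨⟨U₂.toSubmodule, fun g v hv => U₂.apply_mem_toSubmodule (g : G ⧸ N) hv⟩, ?_, ?_⟩
  · rw [disjoint_iff]
    have h1 : U₁.toSubmodule ⊓ U₂.toSubmodule = ⊥ :=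
      congrArg Subrepresentation.toSubmodule h.inf_eq_bot
    exact Subrepresentation.toSubmodule_injective h1
  · rw [codisjoint_iff]
    have h1 : U₁.toSubmodule ⊔ U₂.toSubmodule = ⊤ :=
      congrArg Subrepresentation.toSubmodule h.sup_eq_top
    exact Subrepresentation.toSubmodule_injective h1

end FiniteQuotient

/-! ### Spaces of functions transforming by a character of a subgroup -/

section FunctionModel

variable {G W : Type*} [Group G] [AddCommGroup W] [Module ℂ W]

/-- The map `ev` realises the representation `π` on a space of functions `f` on `G` with
`f(hx) = ψ(h) f(x)` for `h ∈ H`, where `G` acts by right translation and the subgroup `N` acts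
trivially. -/
structure FunctionModel (π : Representation ℂ G W) {H : Subgroup G} (ψ : H →* ℂˣ)
    (N : Subgroup G) (ev : W →ₗ[ℂ] (G → ℂ)) : Prop where
  injective : Function.Injective ev
  translate : ∀ g w x, ev (π g w) x = ev w (x * g)
  equivariant : ∀ (h : H) w x, ev w (h * x) = ψ h * ev w x
  fixed : ∀ g ∈ N, ∀ w, π g w = w

/-- The vectors on which the subgroup `H` acts through the character `ψ`. -/
def spherical (π : Representation ℂ G W) {H : Subgroup G} (ψ : H →* ℂˣ) : Submodule ℂ W where
  carrier := {w | ∀ h : H, π h w = (ψ h : ℂ) • w}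
  zero_mem' h := by simp
  add_mem' ha hb h := by rw [map_add, ha h, hb h, smul_add]
  smul_mem' c w hw h := by rw [map_smul, hw h, smul_comm]

variable {π : Representation ℂ G W} {H : Subgroup G} {ψ : H →* ℂˣ} {N : Subgroup G}
  {ev : W →ₗ[ℂ] (G → ℂ)}

theorem FunctionModel.apply_mul_of_mem (M : FunctionModel π ψ N ev) (w : W) (x : G) {g : G}
    (hg : g ∈ N) : ev w (x * g) = ev w x := by
  rw [← M.translate, M.fixed g hg]

/-- Frobenius reciprocity: evaluation at `1` is an `H`-equivariant functional on any
subrepresentation, so a complement of its kernel consists of spherical vectors. -/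
theorem FunctionModel.exists_spherical [N.Normal] [N.FiniteIndex] (M : FunctionModel π ψ N ev)
    {U : Subrepresentation π} (hU : U ≠ ⊥) :
    ∃ w ∈ U, w ∈ spherical π ψ ∧ ev w 1 ≠ 0 := by
  obtain ⟨w, hw, hw0⟩ := exists_ne_zero_of_ne_bot hU
  obtain ⟨x, hx⟩ : ∃ x, ev w x ≠ 0 := by
    by_contra! hc
    exact hw0 (M.injective (by rw [map_zero]; exact funext hc))
  have hw1 : ev (π x w) 1 ≠ 0 := by rwa [M.translate, one_mul]
  let σ : Representation ℂ H U.toSubmodule := U.toRepresentation.comp H.subtype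
  have hσ : ∀ (h : H) (u : U.toSubmodule), ((σ h u : U.toSubmodule) : W) = π h u := fun _ _ => rfl
  have hev : ∀ (h : H) (u : W), ev (π h u) 1 = ψ h * ev u 1 := fun h u => by
    rw [M.translate, one_mul, ← mul_one (h : G), M.equivariant]
  let Z : Subrepresentation σ :=
    ⟨{ carrier := {u | ev u 1 = 0}
       zero_mem' := by simp
       add_mem' := fun {a b} (ha : ev a 1 = 0) (hb : ev b 1 = 0) => by simp [ha, hb]
       smul_mem' := fun c a (ha : ev a 1 = 0) => by simp [ha] },
      fun h u (hu : ev u 1 = 0) => by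
        change ev (π h u) 1 = 0
        rw [hev, hu, mul_zero]⟩
  have hZ : ∀ u : U.toSubmodule, u ∈ Z ↔ ev u 1 = 0 := fun _ => Iff.rfl
  have : (N.subgroupOf H).FiniteIndex := inferInstance
  obtain ⟨C, hC⟩ := exists_isCompl_of_finiteIndex (π := σ) (N.subgroupOf H)
    (fun g hg u => Subtype.ext (M.fixed g (Subgroup.mem_subgroupOf.1 hg) u)) Z
  obtain ⟨u, hu, c, hc, e⟩ := exists_add_of_isCompl hC
    ⟨π x w, U.apply_mem_toSubmodule x hw⟩
  have e1 : ev (c : W) 1 = ev (π x w) 1 := by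
    have h1 := congrArg (fun t : U.toSubmodule => ev (t : W) 1) e
    simpa [(hZ u).1 hu] using h1
  refine ⟨c, c.2, fun h => ?_, by rwa [e1]⟩
  have h1 : σ h c - (ψ h : ℂ) • c = 0 := by
    refine eq_zero_of_isCompl hC ?_ (C.toSubmodule.sub_mem (C.apply_mem_toSubmodule h hc)
      (C.toSubmodule.smul_mem _ hc))
    rw [hZ]
    change ev (π h c - (ψ h : ℂ) • (c : W)) 1 = 0
    rw [map_sub, map_smul, Pi.sub_apply, Pi.smul_apply, hev, smul_eq_mul, sub_self]
  have h2 := congrArg (fun t : U.toSubmodule => (t : W)) h1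
  exact sub_eq_zero.1 h2

/-- The endomorphism `w ↦ ∑_{q ∈ G/N} w(q) π(q⁻¹) w₀`, that is, convolution of functions with
`w₀`. -/
noncomputable def convolve (π : Representation ℂ G W) (N : Subgroup G) [Fintype (G ⧸ N)]
    (ev : W →ₗ[ℂ] (G → ℂ)) (w₀ : W) : W →ₗ[ℂ] W where
  toFun w := ∑ q : G ⧸ N, ev w q.out • π q.out⁻¹ w₀
  map_add' a b := by simp [add_smul, Finset.sum_add_distrib]
  map_smul' c a := by simp [mul_smul, Finset.smul_sum]

theorem FunctionModel.convolve_term [N.Normal] (M : FunctionModel π ψ N ev) (w₀ w : W) (g : G) :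
    ev w (g : G ⧸ N).out • π (g : G ⧸ N).out⁻¹ w₀ = ev w g • π g⁻¹ w₀ := by
  obtain ⟨k, hk⟩ := QuotientGroup.mk_out_eq_mul N g
  rw [hk, M.apply_mul_of_mem w g k.2, mul_inv_rev, map_mul, Module.End.mul_apply,
    M.fixed _ (inv_mem k.2)]

theorem FunctionModel.convolve_translate [N.Normal] [Fintype (G ⧸ N)] (M : FunctionModel π ψ N ev)
    (w₀ w : W) (g : G) : convolve π N ev w₀ (π g w) = π g (convolve π N ev w₀ w) := by
  change ∑ q : G ⧸ N, ev (π g w) q.out • π q.out⁻¹ w₀ =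
    π g (∑ q : G ⧸ N, ev w q.out • π q.out⁻¹ w₀)
  rw [map_sum, ← Equiv.sum_comp (Equiv.mulRight ((g : G ⧸ N)))
    (fun q : G ⧸ N => π g (ev w q.out • π q.out⁻¹ w₀))]
  refine Finset.sum_congr rfl fun q _ => ?_
  induction q using QuotientGroup.induction_on with
  | H x =>
    have e : Equiv.mulRight (g : G ⧸ N) (x : G ⧸ N) = ((x * g : G) : G ⧸ N) := rfl
    rw [e, M.convolve_term, M.convolve_term, M.translate, map_smul, ← Module.End.mul_apply,
      ← map_mul, mul_inv_rev, mul_inv_cancel_left]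

theorem convolve_mem [Fintype (G ⧸ N)] (U : Subrepresentation π) {w₀ : W} (h : w₀ ∈ U) (w : W) :
    convolve π N ev w₀ w ∈ U :=
  U.toSubmodule.sum_mem fun _ _ => U.toSubmodule.smul_mem _ (U.apply_mem_toSubmodule _ h)

/-- The function `δ` is supported on `HN`, where it is the extension of `ψ`. -/
structure IsDelta (ψ : H →* ℂˣ) (N : Subgroup G) (δ : G → ℂ) : Prop where
  apply_mul : ∀ (h : H), ∀ k ∈ N, δ (h * k) = ψ h
  apply_eq_zero : ∀ x, (∀ (h : H), ∀ k ∈ N, x ≠ h * k) → δ x = 0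

theorem exists_isDelta (hψ : ∀ h : H, (h : G) ∈ N → ψ h = 1) : ∃ δ, IsDelta ψ N δ := by
  classical
  refine ⟨fun x => if hx : ∃ h : H, ∃ k ∈ N, x = h * k then (ψ hx.choose : ℂ) else 0, ?_, ?_⟩
  · intro h k hk
    have hx : ∃ h' : H, ∃ k' ∈ N, (h : G) * k = h' * k' := ⟨h, k, hk, rfl⟩
    simp only [dif_pos hx]
    obtain ⟨k', hk', e⟩ := hx.choose_spec
    have h1 : ψ (hx.choose⁻¹ * h) = 1 := by
      apply hψ
      have : ((hx.choose⁻¹ * h : H) : G) = k' * k⁻¹ := by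
        rw [Subgroup.coe_mul, Subgroup.coe_inv, inv_mul_eq_iff_eq_mul, ← mul_assoc, ← e,
          mul_inv_cancel_right]
      rw [this]
      exact mul_mem hk' (inv_mem hk)
    rw [map_mul, map_inv, inv_mul_eq_one] at h1
    rw [h1]
  · intro x hx
    exact dif_neg (by push Not; exact hx)

theorem IsDelta.apply_one {δ : G → ℂ} (D : IsDelta ψ N δ) : δ 1 = 1 := by
  have := D.apply_mul 1 1 (one_mem N)
  simpa using this

theorem IsDelta.equivariant {δ : G → ℂ} (D : IsDelta ψ N δ) (h : H) (x : G) :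
    δ (h * x) = ψ h * δ x := by
  by_cases hx : ∃ h' : H, ∃ k ∈ N, x = h' * k
  · obtain ⟨h', k, hk, rfl⟩ := hx
    rw [← mul_assoc, ← Subgroup.coe_mul, D.apply_mul _ k hk, D.apply_mul _ k hk, map_mul,
      Units.val_mul]
  · push Not at hx
    rw [D.apply_eq_zero x hx, mul_zero]
    refine D.apply_eq_zero _ fun h' k hk e => hx (h⁻¹ * h') k hk ?_
    rw [Subgroup.coe_mul, mul_assoc, ← e, Subgroup.coe_inv, inv_mul_cancel_left]

theorem IsDelta.apply_mul_right {δ : G → ℂ} (D : IsDelta ψ N δ) (x : G) {k : G} (hk : k ∈ N) :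
    δ (x * k) = δ x := by
  by_cases hx : ∃ h' : H, ∃ k ∈ N, x = h' * k
  · obtain ⟨h', k', hk', rfl⟩ := hx
    rw [mul_assoc, D.apply_mul _ _ (mul_mem hk' hk), D.apply_mul _ _ hk']
  · push Not at hx
    rw [D.apply_eq_zero x hx]
    refine D.apply_eq_zero _ fun h' k' hk' e => hx h' (k' * k⁻¹) (mul_mem hk' (inv_mem hk)) ?_
    rw [← mul_assoc, ← e, mul_inv_cancel_right]

theorem FunctionModel.delta_mem_spherical [hN : N.Normal] (M : FunctionModel π ψ N ev) {d : W}
    (D : IsDelta ψ N (ev d)) : d ∈ spherical π ψ := by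
  intro h
  apply M.injective
  funext x
  rw [M.translate, map_smul, Pi.smul_apply, smul_eq_mul]
  by_cases hx : ∃ h' : H, ∃ k ∈ N, x = h' * k
  · obtain ⟨h', k, hk, rfl⟩ := hx
    have e : (h' : G) * k * h = ((h' * h : H) : G) * ((h : G)⁻¹ * k * h) := by
      rw [Subgroup.coe_mul]; group
    have hk' : (h : G)⁻¹ * k * h ∈ N := by simpa using hN.conj_mem k hk (h : G)⁻¹
    rw [e, D.apply_mul _ _ hk', D.apply_mul _ _ hk, map_mul, Units.val_mul, mul_comm]
  · push Not at hx
    rw [D.apply_eq_zero x hx, mul_zero]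
    refine D.apply_eq_zero _ fun h' k hk e =>
      hx (h' * h⁻¹) ((h : G) * k * (h : G)⁻¹) (hN.conj_mem k hk _) ?_
    rw [Subgroup.coe_mul, Subgroup.coe_inv, ← mul_assoc, ← mul_assoc, inv_mul_cancel_right, ← e,
      mul_inv_cancel_right]

open Classical in
/-- The order of the image of `H` in `G/N`. -/
noncomputable def imageCard (H N : Subgroup G) [Fintype (G ⧸ N)] : ℂ :=
  ∑ q : G ⧸ N, if ∃ h : H, ((h : G) : G ⧸ N) = q then 1 else 0

theorem imageCard_ne_zero [Fintype (G ⧸ N)] : imageCard H N ≠ 0 := by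
  classical
  rw [imageCard, Finset.sum_boole, Nat.cast_ne_zero, Finset.card_ne_zero]
  exact ⟨((1 : G) : G ⧸ N), by simpa using ⟨1, one_mem H, rfl⟩⟩

theorem IsDelta.apply_eq_zero_of_quotient {δ : G → ℂ} (D : IsDelta ψ N δ) {x : G}
    (hx : ¬ ∃ h : H, ((h : G) : G ⧸ N) = x) : δ x = 0 := by
  refine D.apply_eq_zero x fun h k hk e => hx ⟨h, ?_⟩
  rw [QuotientGroup.eq, e, inv_mul_cancel_left]
  exact hk

/-- Convolution with `δ` on the left is a nonzero multiple of the identity. -/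
theorem FunctionModel.convolve_delta [hN : N.Normal] [Fintype (G ⧸ N)]
    (M : FunctionModel π ψ N ev) {d : W} (D : IsDelta ψ N (ev d)) (w : W) :
    convolve π N ev d w = imageCard H N • w := by
  classical
  apply M.injective
  funext x
  change ev (∑ q : G ⧸ N, ev w q.out • π q.out⁻¹ d) x = _
  rw [map_sum, Finset.sum_apply, map_smul, Pi.smul_apply, imageCard, smul_eq_mul,
    Finset.sum_mul, ← Equiv.sum_comp ((Equiv.inv _).trans (Equiv.mulRight (x : G ⧸ N)))]
  refine Finset.sum_congr rfl fun q _ => ?_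
  induction q using QuotientGroup.induction_on with
  | H y =>
    have e : ((Equiv.inv _).trans (Equiv.mulRight (x : G ⧸ N))) (y : G ⧸ N) =
      ((y⁻¹ * x : G) : G ⧸ N) := rfl
    rw [e, M.convolve_term, map_smul, Pi.smul_apply, M.translate, smul_eq_mul, mul_inv_rev,
      mul_inv_cancel_left, inv_inv]
    split_ifs with hy
    · obtain ⟨h, hh⟩ := hy
      obtain ⟨k, hk, rfl⟩ : ∃ k ∈ N, y = h * k := ⟨(h : G)⁻¹ * y, QuotientGroup.eq.1 hh, by simp⟩
      have e : ((h : G) * k)⁻¹ * x =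
          ((h⁻¹ : H) : G) * (x * (x⁻¹ * ((h : G) * k⁻¹ * (h : G)⁻¹) * x)) := by
        rw [Subgroup.coe_inv]; group
      have hk' : x⁻¹ * ((h : G) * k⁻¹ * (h : G)⁻¹) * x ∈ N := by
        simpa using hN.conj_mem _ (hN.conj_mem _ (inv_mem hk) (h : G)) x⁻¹
      rw [e, M.equivariant, M.apply_mul_of_mem _ _ hk', D.apply_mul _ _ hk, mul_right_comm,
        ← Units.val_mul, ← map_mul, inv_mul_cancel, map_one, Units.val_one]
    · rw [D.apply_eq_zero_of_quotient hy, mul_zero, zero_mul]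

/-- Convolution with a spherical vector `w₀` maps `δ` to a nonzero multiple of `w₀`. -/
theorem FunctionModel.convolve_apply_delta [hN : N.Normal] [Fintype (G ⧸ N)]
    (M : FunctionModel π ψ N ev) {d w₀ : W} (D : IsDelta ψ N (ev d)) (hw : w₀ ∈ spherical π ψ) :
    convolve π N ev w₀ d = imageCard H N • w₀ := by
  classical
  change ∑ q : G ⧸ N, ev d q.out • π q.out⁻¹ w₀ = _
  rw [imageCard, Finset.sum_smul]
  refine Finset.sum_congr rfl fun q _ => ?_
  induction q using QuotientGroup.induction_on with
  | H y =>
    rw [M.convolve_term]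
    split_ifs with hy
    · obtain ⟨h, hh⟩ := hy
      obtain ⟨k, hk, rfl⟩ : ∃ k ∈ N, y = h * k := ⟨(h : G)⁻¹ * y, QuotientGroup.eq.1 hh, by simp⟩
      have e : ((h : G) * k)⁻¹ = ((h⁻¹ : H) : G) * ((h : G) * k⁻¹ * (h : G)⁻¹) := by
        rw [Subgroup.coe_inv]; group
      rw [e, map_mul, Module.End.mul_apply, M.fixed _ (hN.conj_mem _ (inv_mem hk) _), hw,
        D.apply_mul _ _ hk, smul_smul, ← Units.val_mul, ← map_mul, mul_inv_cancel, map_one,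
        Units.val_one]
    · rw [D.apply_eq_zero_of_quotient hy, zero_smul, zero_smul]

theorem FunctionModel.eq_top_of_delta_mem [N.Normal] [N.FiniteIndex] (M : FunctionModel π ψ N ev)
    {d : W} (D : IsDelta ψ N (ev d)) {U : Subrepresentation π} (hd : d ∈ U) : U = ⊤ := by
  have : Fintype (G ⧸ N) := Fintype.ofFinite _
  refine subrep_eq_top fun w => ?_
  have h := convolve_mem (N := N) (ev := ev) U hd w
  rw [M.convolve_delta D] at h
  exact (U.toSubmodule.smul_mem_iff (imageCard_ne_zero (H := H))).1 h

theorem IsDelta.ne_zero {d : W} (D : IsDelta ψ N (ev d)) : d ≠ 0 := by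
  rintro rfl
  have := D.apply_one
  simp at this

theorem isIrreducible_of (h0 : ∃ w : W, w ≠ 0)
    (h : ∀ U : Subrepresentation π, U ≠ ⊥ → U = ⊤) : π.IsIrreducible where
  exists_pair_ne := by
    obtain ⟨w, hw⟩ := h0
    refine ⟨⊥, ⊤, fun e => hw ?_⟩
    have h1 : w ∈ (⊤ : Subrepresentation π) := Submodule.mem_top (R := ℂ)
    rw [← e] at h1
    exact h1
  eq_bot_or_eq_top U := or_iff_not_imp_left.2 (h U)

/-- If evaluation at `1` is injective on spherical vectors, the representation is irreducible. -/
theorem FunctionModel.isIrreducible [N.Normal] [N.FiniteIndex] (M : FunctionModel π ψ N ev)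
    {d : W} (D : IsDelta ψ N (ev d)) (h : ∀ w ∈ spherical π ψ, ev w 1 = 0 → w = 0) :
    π.IsIrreducible := by
  refine isIrreducible_of ⟨d, D.ne_zero⟩ fun U hU => ?_
  obtain ⟨w, hw, hs, h1⟩ := M.exists_spherical hU
  apply M.eq_top_of_delta_mem D
  have e : d - (ev w 1)⁻¹ • w = 0 := by
    apply h _ (sub_mem (M.delta_mem_spherical D) (Submodule.smul_mem _ _ hs))
    rw [map_sub, map_smul, Pi.sub_apply, Pi.smul_apply, D.apply_one, smul_eq_mul,
      inv_mul_cancel₀ h1, sub_self]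
  rw [sub_eq_zero.1 e]
  exact U.toSubmodule.smul_mem _ hw

/-- If the spherical vectors in `P` are cut out by one linear condition, which `δ` does not
satisfy, the quotient by `P` is irreducible. -/
theorem FunctionModel.isIrreducible_quotient [N.Normal] [N.FiniteIndex]
    (M : FunctionModel π ψ N ev) {d : W} (D : IsDelta ψ N (ev d)) (P : Submodule ℂ W)
    (hP : ∀ g, P ≤ P.comap (π g)) (x : G) (hx : ev d x = 0)
    (h : ∀ w ∈ spherical π ψ, ev w x = ev w 1 → w ∈ P) (h' : ∀ w ∈ P, ev w x = ev w 1) :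
    (π.quotient P hP).IsIrreducible := by
  have hdP : d ∉ P := fun hd => by
    have := h' d hd
    rw [hx, D.apply_one] at this
    exact zero_ne_one this
  refine isIrreducible_of ⟨P.mkQ d, by simpa using hdP⟩ fun U hU => ?_
  let U₁ : Subrepresentation π := ⟨U.toSubmodule.comap P.mkQ, fun g v hv =>
    U.apply_mem_toSubmodule g hv⟩
  have hU₁ : ∀ w, w ∈ U₁ ↔ P.mkQ w ∈ U := fun w => Iff.rfl
  have hPU : ∀ w ∈ P, w ∈ U₁ := fun w hw => by
    rw [hU₁, (by simpa using hw : P.mkQ w = 0)]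
    exact U.toSubmodule.zero_mem
  suffices hd : d ∈ U₁ by
    have ht := M.eq_top_of_delta_mem D hd
    refine subrep_eq_top fun q => ?_
    obtain ⟨w, rfl⟩ := P.mkQ_surjective q
    rw [← hU₁, ht]
    exact Submodule.mem_top (R := ℂ)
  let P₁ : Subrepresentation π := ⟨P, fun g v hv => hP g hv⟩
  obtain ⟨C, hC⟩ := exists_isCompl_of_finiteIndex N M.fixed P₁
  have hUC : U₁ ⊓ C ≠ ⊥ := by
    intro hbot
    obtain ⟨q, hq, hq0⟩ := exists_ne_zero_of_ne_bot hU
    obtain ⟨w, rfl⟩ := P.mkQ_surjective q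
    obtain ⟨p, hp, c, hc, rfl⟩ := exists_add_of_isCompl hC w
    have hc' : c ∈ U₁ ⊓ C := ⟨by
      have := U₁.toSubmodule.sub_mem hq (hPU p hp)
      rwa [add_sub_cancel_left] at this, hc⟩
    rw [hbot] at hc'
    have hc0 : c = 0 := hc'
    apply hq0
    rw [hc0, add_zero]
    exact (Submodule.Quotient.mk_eq_zero P).2 hp
  obtain ⟨w, hw, hs, h1⟩ := M.exists_spherical hUC
  have hwx : ev w 1 - ev w x ≠ 0 := fun e => by
    have hwP : w ∈ P₁ := h w hs (sub_eq_zero.1 e).symm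
    have := eq_zero_of_isCompl hC hwP hw.2
    rw [this] at h1
    simp at h1
  have hdw : d - (ev w 1 - ev w x)⁻¹ • w ∈ P := by
    apply h _ (sub_mem (M.delta_mem_spherical D) (Submodule.smul_mem _ _ hs))
    rw [map_sub, map_smul]
    simp only [Pi.sub_apply, Pi.smul_apply, D.apply_one, hx, smul_eq_mul]
    field_simp
    ring
  have := U₁.toSubmodule.add_mem (hPU _ hdw) (U₁.toSubmodule.smul_mem (ev w 1 - ev w x)⁻¹ hw.1)
  rwa [sub_add_cancel] at this

theorem FunctionModel.finiteDimensional [N.Normal] [N.FiniteIndex] (M : FunctionModel π ψ N ev) :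
    FiniteDimensional ℂ W := by
  let f : W →ₗ[ℂ] (G ⧸ N → ℂ) := LinearMap.pi fun q => (LinearMap.proj q.out).comp ev
  refine FiniteDimensional.of_injective f fun a b hab => M.injective (funext fun x => ?_)
  have h := congrFun hab (x : G ⧸ N)
  change ev a (x : G ⧸ N).out = ev b (x : G ⧸ N).out at h
  obtain ⟨k, hk⟩ := QuotientGroup.mk_out_eq_mul N x
  rwa [hk, M.apply_mul_of_mem _ _ k.2, M.apply_mul_of_mem _ _ k.2] at h

/-- A spherical vector which is not proportional to `δ` gives a non-scalar intertwining operator,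
which prevents irreducibility. -/
theorem FunctionModel.exists_proper [N.Normal] [N.FiniteIndex] (M : FunctionModel π ψ N ev)
    {d f : W} (D : IsDelta ψ N (ev d)) (hf : f ∈ spherical π ψ) (hf1 : ev f 1 = 0) (hf0 : f ≠ 0) :
    ∃ U : Subrepresentation π, U ≠ ⊥ ∧ U ≠ ⊤ := by
  have : Fintype (G ⧸ N) := Fintype.ofFinite _
  have := M.finiteDimensional
  have : Nontrivial W := ⟨f, 0, hf0⟩
  obtain ⟨c, hc⟩ := Module.End.exists_eigenvalue (convolve π N ev f)
  obtain ⟨v, hv⟩ := hc.exists_hasEigenvector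
  let U : Subrepresentation π := ⟨Module.End.eigenspace (convolve π N ev f) c, fun g w hw => by
    rw [Module.End.mem_eigenspace_iff] at hw ⊢
    rw [M.convolve_translate, hw, map_smul]⟩
  refine ⟨U, fun e => hv.2 ?_, fun e => ?_⟩
  · have h1 : v ∈ U := hv.1
    rw [e] at h1
    exact h1
  · have h1 : d ∈ U := by rw [e]; exact Submodule.mem_top (R := ℂ)
    have h2 : convolve π N ev f d = c • d := Module.End.mem_eigenspace_iff.1 h1
    rw [M.convolve_apply_delta D hf] at h2
    have h3 := congrArg (fun w => ev w 1) h2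
    simp only [map_smul, Pi.smul_apply, hf1, D.apply_one, smul_eq_mul, mul_zero, mul_one] at h3
    rw [← h3, zero_smul, smul_eq_zero] at h2
    exact h2.elim imageCard_ne_zero hf0

/-- If the spherical vectors form a plane, the representation is the sum of two irreducible
subrepresentations. -/
theorem FunctionModel.exists_two [N.Normal] [N.FiniteIndex] (M : FunctionModel π ψ N ev)
    {d f : W} (D : IsDelta ψ N (ev d)) (hf : f ∈ spherical π ψ) (hf1 : ev f 1 = 0) (hf0 : f ≠ 0)
    (x : G) (h : ∀ w ∈ spherical π ψ, ev w 1 = 0 → ev w x = 0 → w = 0) :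
    ∃ U₁ U₂ : Subrepresentation π, IsCompl U₁ U₂ ∧ U₁.toRepresentation.IsIrreducible ∧
      U₂.toRepresentation.IsIrreducible := by
  obtain ⟨U, hU0, hU1⟩ := M.exists_proper D hf hf1 hf0
  obtain ⟨U', hU⟩ := exists_isCompl_of_finiteIndex N M.fixed U
  have hU0' : U' ≠ ⊥ := fun e => hU1 (by have := hU.sup_eq_top; rwa [e, sup_bot_eq] at this)
  -- There is no room for three independent spherical vectors.
  have key : ∀ A B : Subrepresentation π, IsCompl A B → A ≠ ⊥ → B ≠ ⊥ →
      A.toRepresentation.IsIrreducible := by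
    intro A B hAB hA hB
    obtain ⟨a₀, ha₀, ha₀'⟩ := exists_ne_zero_of_ne_bot hA
    refine isIrreducible_of ⟨⟨a₀, ha₀⟩, fun e => ha₀' (congrArg Subtype.val e)⟩ fun S hS => ?_
    obtain ⟨S', hS'⟩ := exists_isCompl_of_finiteIndex (π := A.toRepresentation) N
      (fun g hg w => Subtype.ext (M.fixed g hg w)) S
    by_contra hST
    have hS'0 : S' ≠ ⊥ := fun e => hST (by have := hS'.sup_eq_top; rwa [e, sup_bot_eq] at this)
    let push : Subrepresentation A.toRepresentation → Subrepresentation π := fun R =>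
      ⟨R.toSubmodule.map A.toSubmodule.subtype, by
        rintro g _ ⟨v, hv, rfl⟩
        exact ⟨A.toRepresentation g v, R.apply_mem_toSubmodule g hv, rfl⟩⟩
    have hpush : ∀ R, R ≠ ⊥ → push R ≠ ⊥ := by
      intro R hR e
      obtain ⟨r, hr, hr0⟩ := exists_ne_zero_of_ne_bot hR
      have h1 : (r : W) ∈ push R := ⟨r, hr, rfl⟩
      rw [e] at h1
      exact hr0 (Subtype.ext h1)
    obtain ⟨_, ⟨s, hs, rfl⟩, hss, hs1⟩ := M.exists_spherical (hpush S hS)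
    obtain ⟨_, ⟨t, ht, rfl⟩, hts, ht1⟩ := M.exists_spherical (hpush S' hS'0)
    obtain ⟨b, hb, hbs, hb1⟩ := M.exists_spherical hB
    simp only [Submodule.subtype_apply] at hss hs1 hts ht1
    have hindep : ∀ α β γ : ℂ, α • (s : W) + β • (t : W) + γ • b = 0 → α = 0 ∧ β = 0 ∧ γ = 0 := by
      intro α β γ e
      have hb0 : γ • b = 0 := eq_zero_of_isCompl hAB
        (by
          rw [← neg_eq_of_add_eq_zero_right e]
          exact A.toSubmodule.neg_mem (A.toSubmodule.add_mem (A.toSubmodule.smul_mem _ s.2)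
            (A.toSubmodule.smul_mem _ t.2)))
        (B.toSubmodule.smul_mem _ hb)
      rw [hb0, add_zero] at e
      have e' : α • s + β • t = 0 := Subtype.ext e
      have ht0 : β • t = 0 := eq_zero_of_isCompl hS'
        (by
          rw [← neg_eq_of_add_eq_zero_right e']
          exact S.toSubmodule.neg_mem (S.toSubmodule.smul_mem _ hs))
        (S'.toSubmodule.smul_mem _ ht)
      rw [ht0, add_zero] at e'
      refine ⟨(smul_eq_zero.1 e').resolve_right ?_, (smul_eq_zero.1 ht0).resolve_right ?_,
        (smul_eq_zero.1 hb0).resolve_right ?_⟩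
      · rintro rfl; simp at hs1
      · rintro rfl; simp at ht1
      · rintro rfl; simp at hb1
    -- The cross product of the values at `1` and at `x` is a linear relation.
    let v₁ := ev s 1 * ev t x - ev t 1 * ev s x
    let v₂ := ev t 1 * ev b x - ev b 1 * ev t x
    let v₃ := ev b 1 * ev s x - ev s 1 * ev b x
    have h0 : v₂ • (s : W) + v₃ • (t : W) + v₁ • b = 0 := by
      apply h _ (add_mem (add_mem (Submodule.smul_mem _ _ hss) (Submodule.smul_mem _ _ hts))
        (Submodule.smul_mem _ _ hbs))
      · simp only [map_add, map_smul, Pi.add_apply, Pi.smul_apply, smul_eq_mul, v₁, v₂, v₃]; ring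
      · simp only [map_add, map_smul, Pi.add_apply, Pi.smul_apply, smul_eq_mul, v₁, v₂, v₃]; ring
    obtain ⟨hv2, hv3, hv1⟩ := hindep _ _ _ h0
    have h1 : ev t 1 • (s : W) + (-ev s 1) • (t : W) + (0 : ℂ) • b = 0 := by
      apply h _ (add_mem (add_mem (Submodule.smul_mem _ _ hss) (Submodule.smul_mem _ _ hts))
        (Submodule.smul_mem _ _ hbs))
      · simp only [map_add, map_smul, Pi.add_apply, Pi.smul_apply, smul_eq_mul]; ring
      · simp only [map_add, map_smul, Pi.add_apply, Pi.smul_apply, smul_eq_mul]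
        linear_combination -hv1
    exact ht1 (hindep _ _ _ h1).1
  exact ⟨U, U', hU, key U U' hU hU0 hU0', key U' U hU.symm hU0' hU0⟩

end FunctionModel

/-! ### The congruence subgroups of the maximal compact subgroup of the cover -/

section Level

variable (n : ℕ) (F : Type*) [Field F] [ValuativeRel F] [TopologicalSpace F]
  [IsNonarchimedeanLocalField F] [hn : Fact (n ∣ Nat.card 𝓀[F] - 1)]

/-- The subgroup `K_l × {1}` of `K̃`, for `l ≥ 1`. -/
noncomputable def levelK (l : ℕ) : Subgroup (maxK n F) :=
  (((congruence F l).subgroupOf (congruence F 1)).map (congSection n F)).subgroupOf (maxK n F)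

variable {n F}

theorem mem_levelK {l : ℕ} (hl : 1 ≤ l) {x : maxK n F} :
    x ∈ levelK n F l ↔ (x : Cover n F) ∈ congSet n l := by
  constructor
  · rintro ⟨u, hu, e⟩
    have e' : (x : Cover n F) = ⟨u, 1⟩ := e.symm
    rw [e']
    exact ⟨hu, rfl⟩
  · rintro ⟨h1, h2⟩
    exact ⟨⟨(x : Cover n F).mat, congruence_anti le_rfl hl h1⟩, h1, Cover.ext rfl h2.symm⟩

theorem levelK_normal {l : ℕ} (hl : 1 ≤ l) : (levelK n F l).Normal where
  conj_mem x hx y := by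
    rw [mem_levelK hl] at hx ⊢
    exact congSet_conj n hl le_rfl (y : Cover n F) (fun u hu => congruence_conj y.2 hu) hx

theorem levelK_anti {l l' : ℕ} (hl : 1 ≤ l) (h : l ≤ l') : levelK n F l' ≤ levelK n F l := by
  intro x hx
  rw [mem_levelK (hl.trans h)] at hx
  rw [mem_levelK hl]
  exact ⟨congruence_anti hl h hx.1, hx.2⟩

theorem finite_quotient_pow (l : ℕ) : Finite (𝒪[F] ⧸ 𝓂[F] ^ l) := by
  have : Finite (𝒪[F] ⧸ 𝓂[F]) := inferInstanceAs (Finite 𝓀[F])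
  exact Ideal.finite_quotient_pow (IsNoetherian.noetherian _) l

theorem levelK_finiteIndex (hn0 : n ≠ 0) {l : ℕ} (hl : 1 ≤ l) : (levelK n F l).FiniteIndex := by
  have : NeZero n := ⟨hn0⟩
  have := finite_quotient_pow (F := F) l
  let r : GL (Fin 2) 𝒪[F] →* GL (Fin 2) (𝒪[F] ⧸ 𝓂[F] ^ l) :=
    Matrix.GeneralLinearGroup.map (Ideal.Quotient.mk (𝓂[F] ^ l))
  let i : GL (Fin 2) 𝒪[F] →* GL (Fin 2) F := Matrix.GeneralLinearGroup.map (𝒪[F]).subtype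
  have : Finite (GL (Fin 2) (𝒪[F] ⧸ 𝓂[F] ^ l)) :=
    Finite.of_injective (fun g => g.val) Units.val_injective
  have : Finite r.range := inferInstance
  choose s hs using fun q : r.range => q.2
  let f : r.range × rootsOfUnity n 𝓀[F] → maxK n F ⧸ levelK n F l := fun p =>
    ((⟨⟨i (s p.1), p.2⟩, ⟨s p.1, rfl⟩⟩ : maxK n F) : maxK n F ⧸ levelK n F l)
  have hf : Function.Surjective f := by
    intro q
    induction q using QuotientGroup.induction_on with
    | H x =>
      obtain ⟨g, hg⟩ := x.2
      let q : r.range := ⟨r g, g, rfl⟩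
      have hu : i ((s q)⁻¹ * g) ∈ congruence F l := by
        refine ⟨(s q)⁻¹ * g, ?_, rfl⟩
        change r ((s q)⁻¹ * g) = 1
        rw [map_mul, map_inv, hs q, inv_mul_cancel]
      let u : maxK n F := ⟨⟨i ((s q)⁻¹ * g), 1⟩, ⟨_, rfl⟩⟩
      refine ⟨(q, (x : Cover n F).root * (cocycle n (i (s q)) (i ((s q)⁻¹ * g)))⁻¹), ?_⟩
      refine QuotientGroup.eq.2 ?_
      have e : x = ⟨⟨i (s q), (x : Cover n F).root *
          (cocycle n (i (s q)) (i ((s q)⁻¹ * g)))⁻¹⟩, ⟨s q, rfl⟩⟩ * u := by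
        apply Subtype.ext
        refine Cover.ext ?_ ?_
        · change (x : Cover n F).mat = i (s q) * i ((s q)⁻¹ * g)
          rw [← map_mul, mul_inv_cancel_left]
          exact hg.symm
        · change (x : Cover n F).root = cocycle n (i (s q)) (i ((s q)⁻¹ * g)) *
            ((x : Cover n F).root * (cocycle n (i (s q)) (i ((s q)⁻¹ * g)))⁻¹ * 1)
          rw [mul_one, mul_comm, inv_mul_cancel_right]
      have hu' : u ∈ levelK n F l := (mem_levelK hl).2 ⟨hu, rfl⟩
      rw [← inv_mul_eq_iff_eq_mul.2 e] at hu'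
      exact hu'
  have := Finite.of_surjective f hf
  exact Subgroup.finiteIndex_of_finite_quotient

end Level

/-! ### The filtration by level -/

section Graded

variable {n : ℕ} {F : Type*} [Field F] [ValuativeRel F] [TopologicalSpace F]
  [IsNonarchimedeanLocalField F] [hn : Fact (n ∣ Nat.card 𝓀[F] - 1)]
  {W : Type*} [AddCommGroup W] [Module ℂ W] (π : Representation ℂ (maxK n F) W)

theorem fixedVectors_mono {l l' : ℕ} (hl : 1 ≤ l) (h : l ≤ l') {w : W}
    (hw : w ∈ fixedVectors π l hl) : w ∈ fixedVectors π l' (hl.trans h) :=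
  fun x hx => hw x ⟨congruence_anti hl h hx.1, hx.2⟩

theorem levelRep_fixed {l : ℕ} (hl : 1 ≤ l) (g : maxK n F) (hg : g ∈ levelK n F l)
    (w : (fixedVectors π l hl).toSubmodule) : levelRep π l hl g w = w :=
  Subtype.ext (w.2 g ((mem_levelK hl).1 hg))

/-- By Maschke's theorem, `W^{K_l} → W^{K_l} / W^{K_{l-1}}` has an equivariant section. -/
theorem exists_section (hn0 : n ≠ 0) {l : ℕ} (hl : 2 ≤ l) :
    ∃ s : LevelQuotient π l hl →ₗ[ℂ] W,
      (∀ q, ∃ h : s q ∈ fixedVectors π l (one_le_two.trans hl),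
        (prevLevel π l hl).mkQ ⟨s q, h⟩ = q) ∧
      ∀ g q, s (levelQuotient π l hl g q) = π g (s q) := by
  have hl1 : 1 ≤ l := one_le_two.trans hl
  have := levelK_normal (n := n) (F := F) hl1
  have := levelK_finiteIndex (n := n) (F := F) hn0 hl1
  let P : Subrepresentation (levelRep π l hl1) := ⟨prevLevel π l hl, fun g _ hv =>
    (fixedVectors π (l - 1) (Nat.le_sub_one_of_lt hl)).apply_mem_toSubmodule g hv⟩
  obtain ⟨C, hC⟩ := exists_isCompl_of_finiteIndex (levelK n F l) (levelRep_fixed π hl1) P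
  have hC' : IsCompl (prevLevel π l hl) C.toSubmodule := by
    constructor
    · rw [disjoint_iff]
      exact congrArg Subrepresentation.toSubmodule hC.inf_eq_bot
    · rw [codisjoint_iff]
      exact congrArg Subrepresentation.toSubmodule hC.sup_eq_top
  let e := Submodule.quotientEquivOfIsCompl _ _ hC'
  have he : ∀ q, (prevLevel π l hl).mkQ (e q : (fixedVectors π l hl1).toSubmodule) = q := fun q =>
    Submodule.mk_quotientEquivOfIsCompl_apply hC' q
  let t : LevelQuotient π l hl →ₗ[ℂ] (fixedVectors π l hl1).toSubmodule :=
    C.toSubmodule.subtype.comp e.toLinearMap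
  have ht : ∀ q, (prevLevel π l hl).mkQ (t q) = q := he
  refine ⟨(fixedVectors π l hl1).toSubmodule.subtype.comp t, fun q => ⟨(t q).2, ht q⟩,
    fun g q => ?_⟩
  have h1 : t (levelQuotient π l hl g q) - levelRep π l hl1 g (t q) = 0 := by
    refine eq_zero_of_isCompl hC ?_ (C.toSubmodule.sub_mem (e _).2
      (C.apply_mem_toSubmodule g (e q).2))
    refine (Submodule.Quotient.mk_eq_zero (prevLevel π l hl)).1 ?_
    change (prevLevel π l hl).mkQ (t (levelQuotient π l hl g q) - levelRep π l hl1 g (t q)) = 0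
    rw [map_sub, sub_eq_zero, ht]
    have h2 : levelQuotient π l hl g ((prevLevel π l hl).mkQ (t q)) =
      (prevLevel π l hl).mkQ (levelRep π l hl1 g (t q)) := rfl
    rw [ht] at h2
    exact h2
  exact congrArg Subtype.val (sub_eq_zero.1 h1)

/-- A smooth representation of `K̃` is isomorphic to its associated graded representation. -/
theorem nonempty_equiv_gradedRep (hn0 : n ≠ 0)
    (hsm : ∀ w, ∃ l, ∃ hl : 1 ≤ l, w ∈ fixedVectors π l hl) (m : ℕ) (hm : 1 ≤ m) :
    Nonempty (Representation.Equiv (gradedRep π m hm) π) := by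
  classical
  have hlt : ∀ l : {l : ℕ // m < l}, 2 ≤ l.1 := fun l => lt_of_le_of_lt hm l.2
  choose s hs hsg using fun l : {l : ℕ // m < l} => exists_section π hn0 (hlt l)
  let D : (⨁ l : {l : ℕ // m < l}, LevelQuotient π l.1 (hlt l)) →ₗ[ℂ] W :=
    DirectSum.toModule ℂ _ W s
  have hD : ∀ l x, D (DirectSum.lof ℂ _ _ l x) = s l x := fun l x =>
    DirectSum.toModule_lof ℂ l (φ := s) x
  let Ψ : GradedSpace π m hm →ₗ[ℂ] W := (fixedVectors π m hm).toSubmodule.subtype.coprod D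
  have hΨ : ∀ w x, Ψ (w, x) = w + D x := fun w x => rfl
  have hinj : Function.Injective Ψ := by
    rw [injective_iff_map_eq_zero]
    rintro ⟨w, x⟩ h0
    rw [hΨ] at h0
    by_cases hx : x = 0
    · subst hx
      rw [map_zero, add_zero] at h0
      exact Prod.ext (Subtype.ext h0) rfl
    exfalso
    have hne : (DFinsupp.support x).Nonempty := by
      rw [Finset.nonempty_iff_ne_empty, Ne, DFinsupp.support_eq_empty]
      exact hx
    -- The component of highest level is fixed by the preceding congruence subgroup.
    let l := (DFinsupp.support x).max' hne
    have hl : l ∈ DFinsupp.support x := Finset.max'_mem _ _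
    have hsum : D x = ∑ i ∈ DFinsupp.support x, s i (x i) := by
      conv_lhs => rw [← DirectSum.sum_support_of x]
      rw [map_sum]
      exact Finset.sum_congr rfl fun i _ => hD i _
    rw [hsum, ← Finset.add_sum_erase _ _ hl] at h0
    have hl1 : 1 ≤ l.1 - 1 := Nat.le_sub_one_of_lt (hlt l)
    have hmem : s l (x l) ∈ fixedVectors π (l.1 - 1) hl1 := by
      have e : s l (x l) = -((w : W) + ∑ i ∈ (DFinsupp.support x).erase l, s i (x i)) := by
        rw [eq_neg_iff_add_eq_zero, ← h0]; abel
      rw [e]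
      refine (fixedVectors π (l.1 - 1) hl1).toSubmodule.neg_mem (Submodule.add_mem _
        (fixedVectors_mono π hm (Nat.le_sub_one_of_lt l.2) w.2)
        (Submodule.sum_mem _ fun i hi => ?_))
      rw [Finset.mem_erase] at hi
      have hil : i < l := lt_of_le_of_ne (Finset.le_max' _ _ hi.2) hi.1
      obtain ⟨h1, -⟩ := hs i (x i)
      exact fixedVectors_mono π (one_le_two.trans (hlt i)) (Nat.le_sub_one_of_lt hil) h1
    obtain ⟨h1, h2⟩ := hs l (x l)
    have h3 : (prevLevel π l.1 (hlt l)).mkQ ⟨s l (x l), h1⟩ = 0 :=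
      (Submodule.Quotient.mk_eq_zero _).2 hmem
    rw [DFinsupp.mem_support_iff] at hl
    exact hl (h2.symm.trans h3)
  have hsurj : Function.Surjective Ψ := by
    have key : ∀ l, m ≤ l → ∀ (hl : 1 ≤ l), ∀ w ∈ fixedVectors π l hl, ∃ y, Ψ y = w := by
      intro l hml
      induction l, hml using Nat.le_induction with
      | base => exact fun _ w hw => ⟨(⟨w, hw⟩, 0), by rw [hΨ, map_zero, add_zero]⟩
      | succ l hml ih =>
        intro hl w hw
        let k : {l : ℕ // m < l} := ⟨l + 1, Nat.lt_succ_of_le hml⟩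
        let q : LevelQuotient π k.1 (hlt k) := (prevLevel π k.1 (hlt k)).mkQ ⟨w, hw⟩
        obtain ⟨h1, h2⟩ := hs k q
        have h3 : (⟨w, hw⟩ - ⟨s k q, h1⟩ : (fixedVectors π k.1 hl).toSubmodule) ∈
            prevLevel π k.1 (hlt k) := by
          rw [← Submodule.Quotient.mk_eq_zero]
          change (prevLevel π k.1 (hlt k)).mkQ (⟨w, hw⟩ - ⟨s k q, h1⟩) = 0
          rw [map_sub, h2, sub_self]
        obtain ⟨y, hy⟩ := ih (hm.trans hml) (w - s k q) h3
        let z : GradedSpace π m hm :=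
          (0, DirectSum.lof ℂ _ (fun l : {l : ℕ // m < l} => LevelQuotient π l.1 (hlt l)) k q)
        refine ⟨y + z, ?_⟩
        rw [map_add, hy, hΨ, hD]
        simp
    intro w
    obtain ⟨l, hl, hw⟩ := hsm w
    exact key (max m l) (le_max_left _ _) _ w (fixedVectors_mono π hl (le_max_right _ _) hw)
  refine ⟨Representation.Equiv.mk (LinearEquiv.ofBijective Ψ ⟨hinj, hsurj⟩) fun g => ?_⟩
  apply LinearMap.ext
  rintro ⟨w, x⟩
  change (π g w : W) + D (Representation.directSum (fun l : {l : ℕ // m < l} =>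
    levelQuotient π l.1 (hlt l)) g x) = π g ((w : W) + D x)
  rw [map_add]
  congr 1
  induction x using DirectSum.induction_on with
  | zero => simp only [map_zero]
  | of i y =>
    have e : Representation.directSum (fun l : {l : ℕ // m < l} => levelQuotient π l.1 (hlt l)) g
        (DirectSum.lof ℂ _ _ i y) = DirectSum.lof ℂ _ _ i (levelQuotient π i.1 (hlt i) g y) :=
      DirectSum.lmap_lof _ _ _
    rw [← DirectSum.lof_eq_of ℂ, e, hD, hD, hsg]
  | add a b ha hb => simp only [map_add, ha, hb]

end Graded

/-! ### Elements of the maximal compact subgroup of the cover -/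

section Elements

variable {n : ℕ} {F : Type*} [Field F] [ValuativeRel F] [TopologicalSpace F]
  [IsNonarchimedeanLocalField F] [hn : Fact (n ∣ Nat.card 𝓀[F] - 1)]

/-- A unit of `𝒪` as an element of `Fˣ`. -/
noncomputable def unitO : (𝒪[F])ˣ →* Fˣ := Units.map (𝒪[F]).subtype.toMonoidHom

@[simp] theorem unitO_coe (u : (𝒪[F])ˣ) : ((unitO u : Fˣ) : F) = ((u : 𝒪[F]) : F) := rfl

theorem val_unitO (u : (𝒪[F])ˣ) : val (unitO u) = 0 := by
  rw [val_eq_zero_iff]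
  exact (Valuation.integer.integers
    (ValuativeRel.valuation F)).isUnit_iff_valuation_eq_one.1 u.isUnit

theorem exists_unitO {x : Fˣ} (hx : val x = 0) : ∃ u : (𝒪[F])ˣ, unitO u = x :=
  ⟨toIntegerUnit ⟨x, hx⟩, Units.ext rfl⟩

theorem isPrincipal_unitO {u : (𝒪[F])ˣ} (h : (u : 𝒪[F]) - 1 ∈ 𝓂[F]) : IsPrincipal (unitO u) :=
  isPrincipal_of _ ⟨_, h, by push_cast; rw [unitO_coe]; ring⟩

theorem mem_maxCompact_of {g : GL (Fin 2) F} (M : Matrix (Fin 2) (Fin 2) 𝒪[F])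
    (hM : g.val = M.map (𝒪[F]).subtype) (hdet : IsUnit M.det) : g ∈ maxCompact F :=
  ⟨Matrix.GeneralLinearGroup.mk'' M hdet, Units.ext hM.symm⟩

theorem lt_mem_maxCompact (z : 𝒪[F]) : lt (z : F) ∈ maxCompact F :=
  mem_maxCompact_of !![1, 0; z, 1] (by ext i j; fin_cases i <;> fin_cases j <;> simp [lt])
    (by simp)

theorem ut_mem_maxCompact (z : 𝒪[F]) : ut (z : F) ∈ maxCompact F :=
  mem_maxCompact_of !![1, z; 0, 1] (by ext i j; fin_cases i <;> fin_cases j <;> simp [ut])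
    (by simp)

theorem ut_mem_borelMat (x : F) : ut x ∈ borelMat F := by simp [borelMat, ut]

theorem X_lt {z : F} (hz : z ≠ 0) : X (lt z) = Units.mk0 z hz :=
  Units.ext (by rw [X_of_ne (by simpa [lt] using hz)]; simp [lt])

theorem X_ut (z : F) : X (ut z) = 1 := Units.ext (by rw [X_of_eq] <;> simp [ut])

theorem det_lt (z : F) : Matrix.GeneralLinearGroup.det (lt z) = 1 :=
  Units.ext (by rw [det_eq]; simp [lt])

theorem det_ut (z : F) : Matrix.GeneralLinearGroup.det (ut z) = 1 :=
  Units.ext (by rw [det_eq]; simp [ut])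

theorem diagL_dg (t s : Fˣ) : diagL (dg t s) = t := by
  rw [diagL, det_dg, X_dg, mul_div_cancel_right]

theorem diagR_dg (t s : Fˣ) : diagR (dg t s) = s := X_dg t s

theorem diagL_ut (z : F) : diagL (ut z) = 1 := by rw [diagL, det_ut, X_ut, div_one]

theorem diagR_ut (z : F) : diagR (ut z) = 1 := X_ut z

theorem lt_zero : lt (0 : F) = 1 := by
  ext i j; fin_cases i <;> fin_cases j <;> simp [lt]

theorem hilbert_inv_left (a b : Fˣ) : hilbert n a⁻¹ b = (hilbert n a b)⁻¹ := by
  rw [eq_inv_iff_mul_eq_one, ← hilbert_mul_left, inv_mul_cancel, hilbert_one_left]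

theorem hilbert_inv_right (a b : Fˣ) : hilbert n a b⁻¹ = (hilbert n a b)⁻¹ :=
  map_inv (varpiChar n a) b

/-- The cocycle is trivial on lower unitriangular matrices, by the Steinberg relation for
`y / (y + z) + z / (y + z) = 1`. -/
theorem cocycle_lt (y z : F) : cocycle n (lt y) (lt z) = 1 := by
  by_cases hy : y = 0
  · rw [hy, lt_zero, cocycle_one_left]
  by_cases hz : z = 0
  · rw [hz, lt_zero, cocycle_one_right]
  rw [cocycle, ← lt_add, det_lt, mul_one, X_lt hy, X_lt hz]
  by_cases hyz : y + z = 0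
  · rw [hyz, lt_zero, X_one]
    have e : 1 / Units.mk0 z hz = -(1 / Units.mk0 y hy) := by
      apply Units.ext
      push_cast
      simp only [Units.val_mk0]
      rw [eq_neg_of_add_eq_zero_right hyz, div_neg]
    rw [e, hilbert_neg_self]
  · rw [X_lt hyz]
    have hS := hilbert_steinberg n (Units.mk0 (y + z) hyz / Units.mk0 y hy)⁻¹
      (Units.mk0 (y + z) hyz / Units.mk0 z hz)⁻¹ (by
        push_cast
        rw [inv_div, inv_div]
        simp only [Units.val_mk0]
        rw [← add_div, div_self hyz])
    rwa [hilbert_inv_left, hilbert_inv_right, inv_inv] at hS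

variable (n F) in
/-- The subgroup `B̃ ∩ K̃` of `K̃`. -/
noncomputable abbrev borelK : Subgroup (maxK n F) := (borel n F).subgroupOf (maxK n F)

variable (n) in
/-- The element `(g, 1)` of `K̃`, for `g ∈ K`. -/
noncomputable def liftK (g : GL (Fin 2) F) (hg : g ∈ maxCompact F) : maxK n F := ⟨⟨g, 1⟩, hg⟩

theorem liftK_mul {g h : GL (Fin 2) F} (hg : g ∈ maxCompact F) (hh : h ∈ maxCompact F)
    (hc : cocycle n g h = 1) : liftK n g hg * liftK n h hh = liftK n (g * h) (mul_mem hg hh) := by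
  apply Subtype.ext
  refine Cover.ext rfl ?_
  change cocycle n g h * (1 * 1) = 1
  rw [hc, mul_one, mul_one]

variable (n) in
/-- The element `((1 0; z 1), 1)` of `K̃`. -/
noncomputable def lowK (z : 𝒪[F]) : maxK n F := liftK n (lt (z : F)) (lt_mem_maxCompact z)

variable (n) in
/-- The element `((1 z; 0 1), 1)` of `B̃ ∩ K̃`. -/
noncomputable def upK (z : 𝒪[F]) : borelK n F :=
  ⟨liftK n (ut (z : F)) (ut_mem_maxCompact z), ut_mem_borelMat (z : F)⟩

variable (n) in
/-- The element `(dg(t, s), 1)` of `B̃ ∩ K̃`. -/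
noncomputable def diagK (t s : (𝒪[F])ˣ) : borelK n F :=
  ⟨liftK n (dg (unitO t) (unitO s)) (dg_mem_maxCompact (val_unitO t) (val_unitO s)),
    torusMat_le (dg_mem _ _)⟩

theorem lowK_add (y z : 𝒪[F]) : lowK n (y + z) = lowK n y * lowK n z := by
  rw [lowK, lowK, lowK, liftK_mul _ _ (cocycle_lt _ _)]
  apply Subtype.ext
  refine Cover.ext ?_ rfl
  change lt (((y + z : 𝒪[F])) : F) = lt (y : F) * lt (z : F)
  rw [← lt_add]
  rfl

theorem lowK_zero : lowK n (0 : 𝒪[F]) = 1 :=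
  Subtype.ext (Cover.ext lt_zero rfl)

/-- The identity `(1 0; 0 u)(1 y; 0 1)(1 0; z 1) = (1 0; z 1)(1 y; 0 1)(u 0; 0 1)` for `u = 1 + yz`,
lifted to `K̃`. The cover enters only through the symbol `(u, z)_n`. -/
theorem tri_mul_lowK (u : (𝒪[F])ˣ) (y z : 𝒪[F]) (hu : (u : 𝒪[F]) = 1 + y * z)
    (hz : ∀ hz : (z : F) ≠ 0, hilbert n (unitO u) (Units.mk0 (z : F) hz) = 1) :
    ((diagK n 1 u : borelK n F) : maxK n F) * (upK n y : maxK n F) * lowK n z =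
      lowK n z * ((upK n y : maxK n F) * (diagK n u 1 : maxK n F)) := by
  have huF : ((u : 𝒪[F]) : F) = 1 + (y : F) * z := by rw [hu]; push_cast; rfl
  have hdg := fun t s : (𝒪[F])ˣ => dg_mem_maxCompact (val_unitO t) (val_unitO s)
  have hdgB := fun t s : (𝒪[F])ˣ => torusMat_le (dg_mem (unitO t) (unitO s))
  have e1 : ((diagK n 1 u : borelK n F) : maxK n F) * (upK n y : maxK n F) =
      liftK n (dg (unitO 1) (unitO u) * ut (y : F)) (mul_mem (hdg _ _) (ut_mem_maxCompact y)) := by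
    refine liftK_mul _ _ ?_
    rw [cocycle_borel n (hdgB _ _), diagR_ut, hilbert_one_left]
  have e2 : (upK n y : maxK n F) * ((diagK n u 1 : borelK n F) : maxK n F) =
      liftK n (ut (y : F) * dg (unitO u) (unitO 1)) (mul_mem (ut_mem_maxCompact y) (hdg _ _)) := by
    refine liftK_mul _ _ ?_
    rw [cocycle_borel n (ut_mem_borelMat _), diagL_ut, inv_one, hilbert_one_right]
  rw [e1, e2, lowK, liftK_mul, liftK_mul]
  · apply Subtype.ext
    refine Cover.ext ?_ rfl
    change dg (unitO 1) (unitO u) * ut (y : F) * lt (z : F) =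
      lt (z : F) * (ut (y : F) * dg (unitO u) (unitO 1))
    ext i j
    fin_cases i <;> fin_cases j <;>
      simp [lt, ut, dg, Matrix.mul_apply, Fin.sum_univ_two, huF] <;> ring
  · by_cases h0 : (z : F) = 0
    · rw [h0, lt_zero, cocycle_one_left]
    have hB : ut (y : F) * dg (unitO u) (unitO 1) ∈ borelMat F :=
      mul_mem (ut_mem_borelMat _) (hdgB _ _)
    have hX : X (ut (y : F) * dg (unitO u) (unitO 1)) = 1 := by
      rw [X_mul_left (ut_mem_borelMat _), X_ut, X_dg, map_one, one_mul]
    have hdet : Matrix.GeneralLinearGroup.det (ut (y : F) * dg (unitO u) (unitO 1)) = unitO u := by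
      rw [map_mul, det_ut, det_dg, map_one, one_mul, mul_one]
    have hXX := X_mul_right_ne (g := lt (z : F)) hB (by simpa [lt] using h0)
    rw [hX, hdet, mul_one] at hXX
    rw [cocycle, hXX, hX, det_lt, mul_one, div_one, mul_div_cancel_left, hilbert_mul_right, X_lt h0,
      hz h0, one_mul]
    exact hilbert_units n _ _ (val_unitO u) (val_unitO u)
  · rw [cocycle_borel n (mul_mem (hdgB _ _) (ut_mem_borelMat _)), diagL_mul (hdgB _ _), diagL_dg,
      diagL_ut, map_one, mul_one, inv_one, hilbert_one_right]

theorem diagK_mul_lowK (u : (𝒪[F])ˣ) (z : 𝒪[F]) :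
    ((diagK n 1 u : borelK n F) : maxK n F) * lowK n z =
      lowK n ((u : 𝒪[F]) * z) * (diagK n 1 u : maxK n F) := by
  have hB := torusMat_le (dg_mem (unitO (1 : (𝒪[F])ˣ)) (unitO u))
  rw [diagK, lowK, lowK, liftK_mul, liftK_mul]
  · apply Subtype.ext
    refine Cover.ext ?_ rfl
    change dg (unitO 1) (unitO u) * lt (z : F) =
      lt (((u : 𝒪[F]) * z : 𝒪[F]) : F) * dg (unitO 1) (unitO u)
    ext i j
    fin_cases i <;> fin_cases j <;>
      simp [lt, dg, Matrix.mul_apply, Fin.sum_univ_two]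
  · by_cases h0 : (((u : 𝒪[F]) * z : 𝒪[F]) : F) = 0
    · rw [h0, lt_zero, cocycle_one_left]
    have hXX := X_mul_right_ne (g := lt (((u : 𝒪[F]) * z : 𝒪[F]) : F)) hB (by simpa [lt] using h0)
    rw [X_dg, det_dg, ← map_mul, one_mul, mul_left_inj] at hXX
    rw [cocycle, hXX, div_self', hilbert_one_left]
  · rw [cocycle_borel n hB, diagL_dg, map_one, inv_one, hilbert_one_right]

/-- An element of `K̃` whose lower right entry is a unit lies in `B̃` times a lower unitriangular
element. -/
theorem exists_eq_mul_lowK (g : maxK n F) (c d : 𝒪[F]) (hd : IsUnit d)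
    (hc' : (g : Cover n F).mat.val 1 0 = c) (hd' : (g : Cover n F).mat.val 1 1 = d) :
    ∃ (b : borelK n F) (z : 𝒪[F]), g = b * lowK n z ∧ c = d * z := by
  obtain ⟨d, rfl⟩ := hd
  refine ⟨⟨g * (lowK n (((d⁻¹ : (𝒪[F])ˣ) : 𝒪[F]) * c))⁻¹, ?_⟩,
    ((d⁻¹ : (𝒪[F])ˣ) : 𝒪[F]) * c, ?_, ?_⟩
  · change ((g : Cover n F).mat * (lt _)⁻¹).val 1 0 = 0
    have hz : ∀ x : F, (lt x)⁻¹ = lt (-x) := fun x => by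
      rw [inv_eq_iff_mul_eq_one, ← lt_add, add_neg_cancel, lt_zero]
    rw [hz, mul_apply_one_zero, hc', hd']
    have : ((d : 𝒪[F]) : F) * ((((d⁻¹ : (𝒪[F])ˣ) : 𝒪[F]) * c : 𝒪[F]) : F) = c := by
      rw [← Subring.coe_mul, Units.mul_inv_cancel_left]
    simp only [lt, Matrix.of_apply, Matrix.cons_val', Matrix.cons_val_zero, Matrix.cons_val_one]
    linear_combination -this
  · rw [inv_mul_cancel_right]
  · rw [Units.mul_inv_cancel_left]

theorem exists_integral_entries (g : maxK n F) : ∃ G : GL (Fin 2) 𝒪[F],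
    ∀ i j, (g : Cover n F).mat.val i j = (G.val i j : F) := by
  obtain ⟨G, hG⟩ := g.2
  exact ⟨G, fun i j => (congrArg (fun t => t.val i j) hG).symm⟩

theorem isUnit_or_isUnit_add (G : GL (Fin 2) 𝒪[F]) : IsUnit (G.val 1 1) ∨
    IsUnit (G.val 1 0 + G.val 1 1) := by
  by_cases hd : IsUnit (G.val 1 1)
  · exact Or.inl hd
  have hd' : G.val 1 1 ∈ 𝓂[F] := (IsLocalRing.mem_maximalIdeal _).2 hd
  have hc : IsUnit (G.val 1 0) := by
    by_contra hc
    have hc' : G.val 1 0 ∈ 𝓂[F] := (IsLocalRing.mem_maximalIdeal _).2 hc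
    have h : IsUnit (G.val.det) := (Matrix.isUnit_iff_isUnit_det _).1 G.isUnit
    rw [Matrix.det_fin_two] at h
    exact (IsLocalRing.mem_maximalIdeal _).1
      (Ideal.sub_mem _ (Ideal.mul_mem_left _ _ hd') (Ideal.mul_mem_left _ _ hc')) h
  refine Or.inr ?_
  by_contra h
  have h1 := Ideal.sub_mem _ ((IsLocalRing.mem_maximalIdeal _).2 h) hd'
  rw [add_sub_cancel_right] at h1
  exact (IsLocalRing.mem_maximalIdeal _).1 h1 hc

/-- Every element of `K̃` is, up to right translation by a fixed unipotent, in `B̃` times a lower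
unitriangular element. -/
theorem exists_decomposition (g : maxK n F) : ∃ (b : borelK n F) (z : 𝒪[F]),
    g = b * lowK n z ∨ g * ((upK n 1 : borelK n F) : maxK n F) = b * lowK n z := by
  obtain ⟨G, hG⟩ := exists_integral_entries g
  rcases isUnit_or_isUnit_add G with hd | hd
  · obtain ⟨b, z, h, -⟩ := exists_eq_mul_lowK g _ _ hd (hG 1 0) (hG 1 1)
    exact ⟨b, z, Or.inl h⟩
  · obtain ⟨b, z, h, -⟩ := exists_eq_mul_lowK (g * ((upK n 1 : borelK n F) : maxK n F))
      (G.val 1 0) _ hd (by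
        change ((g : Cover n F).mat * ut _).val 1 0 = _
        rw [mul_apply_one_zero, hG, hG]; simp [ut])
      (by
        change ((g : Cover n F).mat * ut _).val 1 1 = _
        rw [mul_apply_one_one, hG, hG]; simp [ut])
    exact ⟨b, z, Or.inr h⟩

theorem lowK_mem_levelK {l : ℕ} (hl : 1 ≤ l) {z : 𝒪[F]} (hz : z ∈ 𝓂[F] ^ l) :
    lowK n z ∈ levelK n F l :=
  (mem_levelK hl).2 ⟨lt_mem hl z hz, rfl⟩

theorem maximalIdeal_pow_le {l : ℕ} (hl : 1 ≤ l) : 𝓂[F] ^ l ≤ 𝓂[F] :=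
  Ideal.pow_le_self (by omega)

theorem isUnit_one_add {x : 𝒪[F]} (hx : x ∈ 𝓂[F]) : IsUnit (1 + x) := by
  by_contra hc
  have h1 := Ideal.sub_mem _ ((IsLocalRing.mem_maximalIdeal _).2 hc) hx
  rw [add_sub_cancel_right] at h1
  exact (IsLocalRing.mem_maximalIdeal _).1 h1 isUnit_one

/-- The Iwahori factorization of `K_l`. -/
theorem exists_levelK_eq {l : ℕ} (hl : 1 ≤ l) {k : maxK n F} (hk : k ∈ levelK n F l) :
    ∃ (b : borelK n F) (z : 𝒪[F]), z ∈ 𝓂[F] ^ l ∧ (b : maxK n F) ∈ levelK n F l ∧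
      k = b * lowK n z := by
  obtain ⟨M, hM, e⟩ := exists_of_mem_congruence ((mem_levelK hl).1 hk).1
  obtain ⟨b, z, h, hz⟩ := exists_eq_mul_lowK k (M 1 0) (1 + M 1 1)
    (isUnit_one_add (maximalIdeal_pow_le hl (hM _ _))) (by rw [e]; simp) (by rw [e]; simp)
  have hzl : z ∈ 𝓂[F] ^ l := by
    have h1 := hM 1 0
    rw [hz] at h1
    exact (Ideal.unit_mul_mem_iff_mem _ (isUnit_one_add (maximalIdeal_pow_le hl (hM _ _)))).1 h1
  refine ⟨b, z, hzl, ?_, h⟩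
  rw [← mul_inv_eq_iff_eq_mul] at h
  rw [← h]
  exact mul_mem hk (inv_mem (lowK_mem_levelK hl hzl))

/-- The lower unitriangular elements outside `K_l` are not in `B̃ K_l`. -/
theorem lowK_ne_mul {l : ℕ} (hl : 1 ≤ l) {z : 𝒪[F]} (hz : z ∉ 𝓂[F] ^ l) (b : borelK n F)
    {k : maxK n F} (hk : k ∈ levelK n F l) : lowK n z ≠ b * k := by
  intro h
  obtain ⟨M, hM, e⟩ := exists_of_mem_congruence ((mem_levelK hl).1 (inv_mem hk)).1
  have hb : ((b : maxK n F) : Cover n F).mat.val 1 0 = 0 := b.2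
  rw [← mul_inv_eq_iff_eq_mul.2 h] at hb
  change (lt (z : F) * ((k⁻¹ : maxK n F) : Cover n F).mat).val 1 0 = 0 at hb
  rw [mul_apply_one_zero, e] at hb
  have h1 : (1 + M 0 0) * z + M 1 0 = 0 := by
    apply Subtype.ext
    push_cast
    simp [lt] at hb
    linear_combination hb
  apply hz
  refine (Ideal.unit_mul_mem_iff_mem _ (isUnit_one_add (maximalIdeal_pow_le hl (hM 0 0)))).1 ?_
  rw [eq_neg_of_add_eq_zero_left h1]
  exact neg_mem (hM 1 0)

end Elements

/-! ### Functions on the maximal compact subgroup that are equivariant on both sides -/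

section BiEquivariant

variable {n : ℕ} {F : Type*} [Field F] [ValuativeRel F] [TopologicalSpace F]
  [IsNonarchimedeanLocalField F] [hn : Fact (n ∣ Nat.card 𝓀[F] - 1)]

/-- Functions on `K̃` on which `B̃ ∩ K̃` acts by `ψ` from both sides. -/
structure IsBiEquivariant (ψ : borelK n F →* ℂˣ) (f : maxK n F → ℂ) : Prop where
  left : ∀ (b : borelK n F) x, f (b * x) = ψ b * f x
  right : ∀ (b : borelK n F) x, f (x * b) = ψ b * f x

variable {ψ : borelK n F →* ℂˣ} {f : maxK n F → ℂ}

theorem IsBiEquivariant.conj (hf : IsBiEquivariant ψ f) (b : borelK n F) {x y : maxK n F}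
    (h : (b : maxK n F) * x = y * b) : f y = f x := by
  have h1 := hf.left b x
  rw [h, hf.right] at h1
  exact mul_left_cancel₀ (ψ b).ne_zero h1

theorem IsBiEquivariant.apply_unit_mul (hf : IsBiEquivariant ψ f) (u : (𝒪[F])ˣ) (z : 𝒪[F]) :
    f (lowK n ((u : 𝒪[F]) * z)) = f (lowK n z) :=
  hf.conj _ (diagK_mul_lowK u z)

/-- A bi-equivariant function is determined by its values on lower unitriangular elements. -/
theorem IsBiEquivariant.eq_zero (hf : IsBiEquivariant ψ f) (h : ∀ z, f (lowK n z) = 0) : f = 0 := by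
  funext g
  obtain ⟨b, z, e | e⟩ := exists_decomposition g
  · rw [e, hf.left, h, mul_zero]; rfl
  · have h1 := hf.right (upK n 1) g
    rw [e, hf.left, h, mul_zero] at h1
    exact (mul_eq_zero.1 h1.symm).resolve_left (ψ _).ne_zero

/-- A bi-equivariant function which is constant on `lowK (𝔭^l)` is invariant under `K_l`: moving an
element of `K_l` to the left replaces `lowK z` by `lowK (y + z)` with `y ∈ 𝔭^l`, and for `z ∉ 𝔭^l`
the elements `z` and `y + z` differ by a unit factor. -/
theorem IsBiEquivariant.apply_mul_levelK (hf : IsBiEquivariant ψ f) {l : ℕ} (hl : 1 ≤ l)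
    (hψ : ∀ b : borelK n F, (b : maxK n F) ∈ levelK n F l → ψ b = 1)
    (h : ∀ z ∈ 𝓂[F] ^ l, f (lowK n z) = f 1) (g : maxK n F) {k : maxK n F}
    (hk : k ∈ levelK n F l) : f (g * k) = f g := by
  have hN := levelK_normal (n := n) (F := F) hl
  have key : ∀ (z : 𝒪[F]), ∀ k ∈ levelK n F l, f (lowK n z * k) = f (lowK n z) := by
    intro z k hk
    obtain ⟨b, y, hy, hb, e⟩ := exists_levelK_eq hl (hN.conj_mem k hk (lowK n z))
    rw [mul_inv_eq_iff_eq_mul] at e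
    rw [e, mul_assoc, hf.left, hψ b hb, Units.val_one, one_mul, ← lowK_add]
    by_cases hz : z ∈ 𝓂[F] ^ l
    · rw [h _ (Ideal.add_mem _ hy hz), h _ hz]
    · obtain ⟨ϖ, hϖ⟩ := IsDiscreteValuationRing.exists_irreducible 𝒪[F]
      have hz0 : z ≠ 0 := fun e => hz (e ▸ Ideal.zero_mem _)
      obtain ⟨i, u, rfl⟩ := IsDiscreteValuationRing.eq_unit_mul_pow_irreducible hz0 hϖ
      rw [hϖ.maximalIdeal_eq, Ideal.span_singleton_pow, Ideal.mem_span_singleton] at hz hy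
      have hil : i < l := by
        by_contra hc
        exact hz (Dvd.dvd.mul_left (pow_dvd_pow _ (not_lt.1 hc)) _)
      obtain ⟨w, rfl⟩ := hy
      have hx : ((u⁻¹ : (𝒪[F])ˣ) : 𝒪[F]) * (ϖ ^ (l - i) * w) ∈ 𝓂[F] := by
        refine Ideal.mul_mem_left _ _ (Ideal.mul_mem_right _ _ (Ideal.pow_mem_of_mem _ ?_ _ ?_))
        · rw [hϖ.maximalIdeal_eq]; exact Ideal.mem_span_singleton_self ϖ
        · omega
      obtain ⟨v, hv⟩ := isUnit_one_add hx
      have e2 : ϖ ^ l * w + u * ϖ ^ i = (v : 𝒪[F]) * (u * ϖ ^ i) := by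
        rw [hv, ← Nat.sub_add_cancel hil.le, pow_add, Nat.sub_add_cancel hil.le]
        linear_combination (-(ϖ ^ (l - i) * w * ϖ ^ i)) * u.inv_mul
      rw [e2, hf.apply_unit_mul]
  obtain ⟨b, z, e | e⟩ := exists_decomposition g
  · rw [e, mul_assoc, hf.left, key z k hk, hf.left]
  · have h1 := hf.right (upK n 1) (g * k)
    have h2 := hf.right (upK n 1) g
    rw [e, hf.left] at h2
    have e2 : g * k * ((upK n 1 : borelK n F) : maxK n F) = b * (lowK n z *
        (((upK n 1 : borelK n F) : maxK n F)⁻¹ * k * ((upK n 1 : borelK n F) : maxK n F))) := by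
      rw [← mul_assoc, ← e]; group
    have hk' := hN.conj_mem k hk ((upK n 1 : borelK n F) : maxK n F)⁻¹
    rw [inv_inv] at hk'
    rw [e2, hf.left, key z _ hk', h2] at h1
    exact (mul_left_cancel₀ (ψ _).ne_zero h1).symm

/-- A bi-equivariant function can only be nonzero at `lowK z` if `ψ` takes the same value at
`dg(1, u)` and `dg(u, 1)` for all units `u ∈ 1 + z𝒪`. -/
theorem IsBiEquivariant.apply_lowK_eq_zero (hf : IsBiEquivariant ψ f)
    (hup : ∀ y, ψ (upK n y) = 1) (u : (𝒪[F])ˣ) (y z : 𝒪[F]) (hu : (u : 𝒪[F]) = 1 + y * z)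
    (hz : IsUnit z ∨ z ∈ 𝓂[F]) (h : ψ (diagK n 1 u) ≠ ψ (diagK n u 1)) : f (lowK n z) = 0 := by
  by_contra h0
  apply h
  have h1 := tri_mul_lowK (n := n) u y z hu (by
    intro hz0
    rcases hz with ⟨v, rfl⟩ | hz
    · exact hilbert_units n _ _ (val_unitO u) (val_unitO v)
    · refine hilbert_principal_left n _ _ (isPrincipal_unitO ?_)
      rw [hu, add_sub_cancel_left]
      exact Ideal.mul_mem_left _ _ hz)
  have h2 := congrArg f h1
  rw [mul_assoc, hf.left, hf.left, hup, ← Subgroup.coe_mul, hf.right, map_mul, hup, one_mul,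
    Units.val_one, one_mul] at h2
  exact Units.ext (mul_right_cancel₀ h0 h2)

variable (n) in
/-- The element `(1, ζ)` of `B̃ ∩ K̃`. -/
noncomputable def inclK : rootsOfUnity n 𝓀[F] →* borelK n F where
  toFun ζ := ⟨⟨Cover.incl n ζ, one_mem (maxCompact F)⟩, one_mem (borelMat F)⟩
  map_one' := Subtype.ext (Subtype.ext (map_one (Cover.incl n)))
  map_mul' a b := Subtype.ext (Subtype.ext (map_mul (Cover.incl n) a b))

theorem map_subtype_injective :
    Function.Injective (Matrix.GeneralLinearGroup.map (n := Fin 2) (𝒪[F]).subtype) :=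
  fun g g' e => by
    ext i j
    exact congrArg (fun t => t.val i j) e

/-- The matrix over `𝒪` underlying an element of `K̃`. -/
noncomputable def matO : maxK n F →* GL (Fin 2) 𝒪[F] where
  toFun x := x.2.choose
  map_one' := map_subtype_injective ((1 : maxK n F).2.choose_spec.trans (map_one _).symm)
  map_mul' x y := map_subtype_injective (by
    rw [map_mul]
    have hx : Matrix.GeneralLinearGroup.map (𝒪[F]).subtype x.2.choose = (x : Cover n F).mat :=
      x.2.choose_spec
    have hy : Matrix.GeneralLinearGroup.map (𝒪[F]).subtype y.2.choose = (y : Cover n F).mat :=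
      y.2.choose_spec
    rw [hx, hy]
    exact (x * y).2.choose_spec)

theorem matO_apply (x : maxK n F) (i j : Fin 2) :
    (((matO x).val i j : 𝒪[F]) : F) = (x : Cover n F).mat.val i j := by
  have h : Matrix.GeneralLinearGroup.map (𝒪[F]).subtype (matO x) = (x : Cover n F).mat :=
    x.2.choose_spec
  exact congrArg (fun t => t.val i j) h

theorem unitO_det_matO (x : maxK n F) : unitO (Matrix.GeneralLinearGroup.det (matO x)) =
    Matrix.GeneralLinearGroup.det (x : Cover n F).mat := by
  apply Units.ext
  rw [unitO_coe, det_eq, Matrix.GeneralLinearGroup.val_det_apply, Matrix.det_fin_two]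
  push_cast
  simp only [matO_apply]

theorem exists_borelK_eq (b : borelK n F) : ∃ (t s : (𝒪[F])ˣ) (y : 𝒪[F]),
    b = inclK n ((b : maxK n F) : Cover n F).root * (diagK n t s * upK n y) ∧
      t * s = Matrix.GeneralLinearGroup.det (matO (b : maxK n F)) := by
  have hB : ((b : maxK n F) : Cover n F).mat ∈ borelMat F := b.2
  have hK : ((b : maxK n F) : Cover n F).mat ∈ maxCompact F := (b : maxK n F).2
  obtain ⟨h1, h2⟩ := val_diag_of_mem hK hB
  obtain ⟨t, ht⟩ := exists_unitO h1
  obtain ⟨s, hs⟩ := exists_unitO h2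
  have ht' : ((t : 𝒪[F]) : F) = ((b : maxK n F) : Cover n F).mat.val 0 0 := by
    rw [← unitO_coe, ht, diagL_coe hB]
  have hs' : ((s : 𝒪[F]) : F) = ((b : maxK n F) : Cover n F).mat.val 1 1 := by
    rw [← unitO_coe, hs, diagR_coe hB]
  have h0 : ((b : maxK n F) : Cover n F).mat.val 1 0 = 0 := hB
  refine ⟨t, s, ((t⁻¹ : (𝒪[F])ˣ) : 𝒪[F]) * (matO (b : maxK n F)).val 0 1, ?_, ?_⟩
  · have e : diagK n t s * upK n (((t⁻¹ : (𝒪[F])ˣ) : 𝒪[F]) * (matO (b : maxK n F)).val 0 1) =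
        ⟨⟨⟨((b : maxK n F) : Cover n F).mat, 1⟩, hK⟩, hB⟩ := by
      apply Subtype.ext
      apply Subtype.ext
      refine Cover.ext ?_ ?_
      · change dg (unitO t) (unitO s) * ut _ = _
        have htt : (((t⁻¹ : (𝒪[F])ˣ) : 𝒪[F]) : F) = ((t : 𝒪[F]) : F)⁻¹ := by
          rw [← unitO_coe, ← unitO_coe, map_inv, Units.val_inv_eq_inv_val]
        have ht0 : ((t : 𝒪[F]) : F) ≠ 0 := by rw [← unitO_coe]; exact (unitO t).ne_zero
        ext i j
        fin_cases i <;> fin_cases j <;>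
          simp [dg, ut, Matrix.mul_apply, Fin.sum_univ_two, ht', hs', h0, htt, matO_apply]
        rw [← ht', mul_inv_cancel_left₀ ht0]
      · change cocycle n (dg _ _) (ut _) * (1 * 1) = 1
        rw [cocycle_borel n (torusMat_le (dg_mem _ _)), diagR_ut, hilbert_one_left, mul_one,
          mul_one]
    rw [e]
    apply Subtype.ext
    apply Subtype.ext
    change ((b : maxK n F) : Cover n F) = Cover.incl n _ * _
    rw [Cover.incl_mul, one_mul]
  · apply Units.ext
    apply Subtype.ext
    rw [← unitO_coe, ← unitO_coe, unitO_det_matO, map_mul, ht, hs, diagL, diagR, div_mul_cancel]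

theorem diagK_mul (t s t' s' : (𝒪[F])ˣ) :
    diagK n (t * t') (s * s') = diagK n t s * diagK n t' s' := by
  apply Subtype.ext
  apply Subtype.ext
  refine Cover.ext ?_ ?_
  · change dg (unitO _) (unitO _) = dg _ _ * dg _ _
    rw [map_mul, map_mul, dg_mul]
  · change 1 = cocycle n (dg _ _) (dg _ _) * (1 * 1)
    rw [cocycle_borel n (torusMat_le (dg_mem _ _)), diagR_dg, diagL_dg,
      hilbert_units _ _ _ (val_unitO _) (by rw [val_inv, val_unitO, neg_zero]), mul_one, mul_one]

/-- If `ψ(dg(1, u)) = ψ(dg(u, 1))`, then `(g, ζ) ↦ ψ(1, ζ) ψ(dg(det g, 1))`, restricted to the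
matrices whose lower left entry is a unit, is a bi-equivariant function. -/
theorem exists_bigCell (hup : ∀ y, ψ (upK n y) = 1)
    (hψ : ∀ u, ψ (diagK n 1 u) = ψ (diagK n u 1)) :
    ∃ f : maxK n F → ℂ, IsBiEquivariant ψ f ∧ (∀ z ∈ 𝓂[F], f (lowK n z) = 0) ∧ f ≠ 0 := by
  classical
  let D : maxK n F →* (𝒪[F])ˣ := Matrix.GeneralLinearGroup.det.comp matO
  let w : maxK n F → ℂˣ := fun x => ψ (inclK n (x : Cover n F).root) * ψ (diagK n (D x) 1)
  have hb : ∀ b : borelK n F, ψ b = w b := by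
    intro b
    obtain ⟨t, s, y, e, hD⟩ := exists_borelK_eq b
    conv_lhs => rw [e]
    rw [map_mul, map_mul, hup, mul_one]
    change _ = _ * ψ (diagK n (Matrix.GeneralLinearGroup.det (matO (b : maxK n F))) 1)
    have e1 : diagK n t s = diagK n t 1 * diagK n 1 s := by rw [← diagK_mul, mul_one, one_mul]
    have e2 : diagK n (t * s) 1 = diagK n t 1 * diagK n s 1 := by rw [← diagK_mul, mul_one]
    rw [← hD, e1, e2, map_mul, map_mul, hψ]
  have hw : ∀ x y : maxK n F, cocycle n (x : Cover n F).mat (y : Cover n F).mat = 1 →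
      w (x * y) = w x * w y := by
    intro x y h
    have e : ((x * y : maxK n F) : Cover n F).root =
        (x : Cover n F).root * (y : Cover n F).root := by
      change cocycle n _ _ * _ = _
      rw [h, one_mul]
    have e2 : diagK n (D x * D y) 1 = diagK n (D x) 1 * diagK n (D y) 1 := by
      rw [← diagK_mul, mul_one]
    simp only [w, e, map_mul, e2]
    exact mul_mul_mul_comm _ _ _ _
  let c : maxK n F → 𝒪[F] := fun x => (matO x).val 1 0
  -- On the big cell `X` is a unit, and the cocycle with elements of `B̃ ∩ K̃` is trivial.
  have hX : ∀ x, IsUnit (c x) → val (X (x : Cover n F).mat) = 0 := by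
    rintro x ⟨v, hv⟩
    have e : (x : Cover n F).mat.val 1 0 = (unitO v : F) := by
      rw [← matO_apply, unitO_coe, hv]
    have h0 : (x : Cover n F).mat.val 1 0 ≠ 0 := by rw [e]; exact (unitO v).ne_zero
    have : X (x : Cover n F).mat = unitO v := Units.ext (by rw [X_of_ne h0, e])
    rw [this, val_unitO]
  have hcmul : ∀ x y : maxK n F, c (x * y) =
      (matO x).val 1 0 * (matO y).val 0 0 + (matO x).val 1 1 * (matO y).val 1 0 := by
    intro x y
    simp only [c, map_mul]
    rw [Units.val_mul, Matrix.mul_apply, Fin.sum_univ_two]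
  have hb0 : ∀ b : borelK n F, (matO (b : maxK n F)).val 1 0 = 0 := fun b =>
    Subtype.ext (by rw [matO_apply]; exact b.2)
  have hbdet : ∀ b : borelK n F, IsUnit ((matO (b : maxK n F)).val 0 0) ∧
      IsUnit ((matO (b : maxK n F)).val 1 1) := by
    intro b
    have h : IsUnit ((matO (b : maxK n F)).val.det) :=
      (Matrix.isUnit_iff_isUnit_det _).1 (matO (b : maxK n F)).isUnit
    rwa [Matrix.det_fin_two, hb0, mul_zero, sub_zero, IsUnit.mul_iff] at h
  refine ⟨fun x => if IsUnit (c x) then (w x : ℂ) else 0, ⟨fun b x => ?_, fun b x => ?_⟩,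
    fun z hz => ?_, fun h => ?_⟩
  · have hc : IsUnit (c (b * x)) ↔ IsUnit (c x) := by
      rw [hcmul, hb0, zero_mul, zero_add, IsUnit.mul_iff, and_iff_right (hbdet b).2]
    simp only [hc]
    split_ifs with h
    · rw [hw, hb, Units.val_mul]
      have hB : ((b : maxK n F) : Cover n F).mat ∈ borelMat F := b.2
      rw [cocycle_borel n hB]
      refine hilbert_units _ _ _ (hX x h) ?_
      have hv := (val_diag_of_mem (g := ((b : maxK n F) : Cover n F).mat) (b : maxK n F).2 hB).1
      rw [val_inv, hv, neg_zero]
    · rw [mul_zero]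
  · have hc : IsUnit (c (x * b)) ↔ IsUnit (c x) := by
      rw [hcmul, hb0, mul_zero, add_zero, IsUnit.mul_iff, and_iff_left (hbdet b).1]
    simp only [hc]
    split_ifs with h
    · rw [hw, hb, Units.val_mul, mul_comm]
      have h1 := hX x h
      have h2 := hX (x * b) (hc.2 h)
      refine hilbert_units _ _ _ ?_ ?_
      · rw [val_div, h1, sub_zero]
        exact h2
      · have hv : val (X ((b : maxK n F) : Cover n F).mat) = 0 :=
          (val_diag_of_mem (g := ((b : maxK n F) : Cover n F).mat) (b : maxK n F).2 b.2).2
        rw [val_div, val_mul, val_det_of_mem (g := (x : Cover n F).mat) x.2, hv, add_zero,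
          sub_zero]
        exact h2
    · rw [mul_zero]
  · have h1 : c (lowK n z) = z := Subtype.ext (by
      change (((matO (lowK n z)).val 1 0 : 𝒪[F]) : F) = z
      rw [matO_apply]
      simp [lowK, liftK, lt])
    refine if_neg ?_
    rw [h1]
    exact (IsLocalRing.mem_maximalIdeal _).1 hz
  · have h1 : c (lowK n 1) = 1 := Subtype.ext (by
      change (((matO (lowK n 1)).val 1 0 : 𝒪[F]) : F) = _
      rw [matO_apply]
      simp [lowK, liftK, lt])
    have h2 := congrFun h (lowK n 1)
    simp only [h1, isUnit_one, if_true] at h2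
    exact (w _).ne_zero h2

end BiEquivariant

/-! ### The level pieces of the representations induced from the Borel subgroup -/

section Pieces

variable {n : ℕ} {F : Type*} [Field F] [ValuativeRel F] [TopologicalSpace F]
  [IsNonarchimedeanLocalField F] [hn : Fact (n ∣ Nat.card 𝓀[F] - 1)]

theorem smoothInd_apply_mul {G V : Type*} [Group G] {j : G →* Cover n F} {H : Subgroup G}
    [AddCommGroup V] [Module ℂ V] {σ : Representation ℂ H V} (w : SmoothIndSpace j H σ) (h : H)
    (x : G) : w.1.1 (h * x) = σ h (w.1.1 x) :=
  w.1.2 h x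

variable (n) in
/-- The character of `B̃ ∩ K̃` obtained from a character of `A`. -/
noncomputable def borelChar (χ : groupA n F →* ℂˣ) : borelK n F →* ℂˣ := χ.comp (borelKToA n)

variable {χ : groupA n F →* ℂˣ}

/-- The function on `K̃` underlying a vector of level `l`. -/
def evalLevel (χ : groupA n F →* ℂˣ) (l : ℕ) (hl : 1 ≤ l) :
    (fixedVectors (indK n χ) l hl).toSubmodule →ₗ[ℂ] (maxK n F → ℂ) where
  toFun w := w.1.1.1
  map_add' _ _ := rfl
  map_smul' _ _ := rfl

theorem indK_apply_mul (w : IndKSpace n χ) (b : borelK n F) (x : maxK n F) :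
    w.1.1 (b * x) = borelChar n χ b * w.1.1 x := smoothInd_apply_mul w b x

theorem evalLevel_model (χ : groupA n F →* ℂˣ) {l : ℕ} (hl : 1 ≤ l) :
    FunctionModel (levelRep (indK n χ) l hl) (borelChar n χ) (levelK n F l) (evalLevel χ l hl) where
  injective _ _ h := Subtype.ext (Subtype.ext (Subtype.ext h))
  translate _ _ _ := rfl
  equivariant h w x := indK_apply_mul w.1 h x
  fixed g hg w := levelRep_fixed _ hl g hg w

theorem exists_indK {f : maxK n F → ℂ}
    (hf : ∀ (b : borelK n F) x, f (b * x) = borelChar n χ b * f x)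
    {l : ℕ} (hl : 1 ≤ l) (hfl : ∀ x, ∀ k ∈ levelK n F l, f (x * k) = f x) :
    ∃ w : IndKSpace n χ, w.1.1 = f := by
  refine ⟨⟨⟨f, hf⟩, l, hl, fun k hk => ?_⟩, rfl⟩
  apply Subtype.ext
  funext x
  exact hfl x k ((mem_levelK hl).2 hk)

theorem mem_fixedVectors_iff (w : IndKSpace n χ) {l : ℕ} (hl : 1 ≤ l) :
    w ∈ fixedVectors (indK n χ) l hl ↔ ∀ x, ∀ k ∈ levelK n F l, w.1.1 (x * k) = w.1.1 x := by
  constructor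
  · intro h x k hk
    exact congrArg (fun w : IndKSpace n χ => w.1.1 x) (h k ((mem_levelK hl).1 hk))
  · intro h k hk
    refine Subtype.ext (Subtype.ext (funext fun x => ?_))
    exact h x k ((mem_levelK hl).2 hk)

theorem exists_evalLevel {f : maxK n F → ℂ}
    (hf : ∀ (b : borelK n F) x, f (b * x) = borelChar n χ b * f x)
    {l : ℕ} (hl : 1 ≤ l) (hfl : ∀ x, ∀ k ∈ levelK n F l, f (x * k) = f x) :
    ∃ w, evalLevel χ l hl w = f := by
  obtain ⟨w, rfl⟩ := exists_indK hf hl hfl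
  exact ⟨⟨w, (mem_fixedVectors_iff w hl).2 hfl⟩, rfl⟩

theorem isBiEquivariant_of_spherical {l : ℕ} (hl : 1 ≤ l)
    {w : (fixedVectors (indK n χ) l hl).toSubmodule}
    (hw : w ∈ spherical (levelRep (indK n χ) l hl) (borelChar n χ)) :
    IsBiEquivariant (borelChar n χ) (evalLevel χ l hl w) where
  left b x := (evalLevel_model χ hl).equivariant b w x
  right b x := by
    rw [← (evalLevel_model χ hl).translate, hw b]
    rfl

theorem dg_mem_congruence {l : ℕ} (hl : 1 ≤ l) {g : GL (Fin 2) F} (hg : g ∈ congruence F l)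
    (hB : g ∈ borelMat F) : dg (diagL g) (diagR g) ∈ congruence F l := by
  obtain ⟨M, hM, e⟩ := exists_of_mem_congruence hg
  refine mem_congruence_of hl !![M 0 0, 0; 0, M 1 1]
    (by intro i j; fin_cases i <;> fin_cases j <;> simp [hM]) ?_
  ext i j
  fin_cases i <;> fin_cases j <;> simp [dg, diagL_coe hB, diagR_coe hB, e]

theorem borelChar_eq_one {m : ℕ} (hm : 1 ≤ m)
    (hχ : ∀ z : groupA n F, (z : Cover n F) ∈ congSet n m → χ z = 1) {l : ℕ} (hml : m ≤ l)
    (b : borelK n F) (hb : (b : maxK n F) ∈ levelK n F l) : borelChar n χ b = 1 := by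
  have h := (mem_levelK hm).1 (levelK_anti hm hml hb)
  exact hχ _ ⟨dg_mem_congruence hm h.1 b.2, h.2⟩

theorem borelChar_upK (χ : groupA n F →* ℂˣ) (y : 𝒪[F]) : borelChar n χ (upK n y) = 1 := by
  have h : borelKToA n (upK n y) = 1 := by
    apply Subtype.ext
    refine Cover.ext ?_ rfl
    change dg (diagL (ut (y : F))) (diagR (ut (y : F))) = 1
    rw [diagL_ut, diagR_ut]
    ext i j
    fin_cases i <;> fin_cases j <;> simp [dg]
  rw [borelChar, MonoidHom.comp_apply, h, map_one]

theorem exists_delta {m : ℕ} (hm : 1 ≤ m)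
    (hχ : ∀ z : groupA n F, (z : Cover n F) ∈ congSet n m → χ z = 1) {l : ℕ} (hml : m ≤ l) :
    ∃ d, IsDelta (borelChar n χ) (levelK n F l) (evalLevel χ l (hm.trans hml) d) := by
  obtain ⟨δ, D⟩ := exists_isDelta (ψ := borelChar n χ) (N := levelK n F l)
    (fun b hb => borelChar_eq_one hm hχ hml b hb)
  obtain ⟨d, rfl⟩ := exists_evalLevel D.equivariant (hm.trans hml)
    (fun x k hk => D.apply_mul_right x hk)
  exact ⟨d, D⟩

theorem exists_unit_mul_of_mem {ϖ : 𝒪[F]} (hϖ : Irreducible ϖ) {k : ℕ} {z : 𝒪[F]}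
    (hz : z ∈ 𝓂[F] ^ k) (hz' : z ∉ 𝓂[F] ^ (k + 1)) : ∃ u : (𝒪[F])ˣ, z = u * ϖ ^ k := by
  rw [hϖ.maximalIdeal_eq, Ideal.span_singleton_pow, Ideal.mem_span_singleton] at hz hz'
  obtain ⟨w, rfl⟩ := hz
  have hw : IsUnit w := by
    by_contra hc
    have h1 : w ∈ 𝓂[F] := (IsLocalRing.mem_maximalIdeal _).2 hc
    rw [hϖ.maximalIdeal_eq, Ideal.mem_span_singleton] at h1
    exact hz' (by rw [pow_succ]; exact mul_dvd_mul_left _ h1)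
  obtain ⟨u, rfl⟩ := hw
  exact ⟨u, mul_comm _ _⟩

/-- For `l > m`, the double cosets of `B̃ ∩ K̃` in `K̃/K_l` carry exactly one spherical function
more than those in `K̃/K_{l-1}`. -/
theorem levelQuotient_isIrreducible (hn0 : n ≠ 0) {m : ℕ} (hm : 1 ≤ m)
    (hχ : ∀ z : groupA n F, (z : Cover n F) ∈ congSet n m → χ z = 1) {l : ℕ} (hl : m < l) :
    (levelQuotient (indK n χ) l (lt_of_le_of_lt hm hl)).IsIrreducible := by
  have hl1 : 1 ≤ l := hm.trans hl.le
  have hml : m ≤ l - 1 := Nat.le_sub_one_of_lt hl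
  have := levelK_normal (n := n) (F := F) hl1
  have := levelK_finiteIndex (n := n) (F := F) hn0 hl1
  obtain ⟨d, D⟩ := exists_delta hm hχ hl.le
  obtain ⟨ϖ, hϖ⟩ := IsDiscreteValuationRing.exists_irreducible 𝒪[F]
  have hϖl : ϖ ^ (l - 1) ∈ 𝓂[F] ^ (l - 1) := by
    rw [hϖ.maximalIdeal_eq, Ideal.span_singleton_pow]
    exact Ideal.mem_span_singleton_self _
  have hϖl' : ϖ ^ (l - 1) ∉ 𝓂[F] ^ l := by
    rw [hϖ.maximalIdeal_eq, Ideal.span_singleton_pow, Ideal.mem_span_singleton,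
      pow_dvd_pow_iff hϖ.ne_zero hϖ.not_isUnit]
    omega
  refine (evalLevel_model χ hl1).isIrreducible_quotient D
    (prevLevel (indK n χ) l (lt_of_le_of_lt hm hl)) _ (lowK n (ϖ ^ (l - 1))) ?_ ?_ ?_
  · exact D.apply_eq_zero _ fun b k hk => lowK_ne_mul hl1 hϖl' b hk
  · intro w hw hx
    refine (mem_fixedVectors_iff w.1 (hm.trans hml)).2 fun x k hk => ?_
    refine (isBiEquivariant_of_spherical hl1 hw).apply_mul_levelK (hm.trans hml)
      (borelChar_eq_one hm hχ hml) (fun z hz => ?_) x hk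
    by_cases hzl : z ∈ 𝓂[F] ^ l
    · rw [← one_mul (lowK n z)]
      exact (evalLevel_model χ hl1).apply_mul_of_mem w 1 (lowK_mem_levelK hl1 hzl)
    · rw [← Nat.sub_add_cancel hl1] at hzl
      obtain ⟨u, rfl⟩ := exists_unit_mul_of_mem hϖ hz hzl
      rw [(isBiEquivariant_of_spherical hl1 hw).apply_unit_mul, hx]
  · intro w hw
    have h := (mem_fixedVectors_iff w.1 (hm.trans hml)).1 hw 1 _
      (lowK_mem_levelK (n := n) (hm.trans hml) hϖl)
    rwa [one_mul] at h

/-- A spherical vector of level `m` vanishes at the intermediate double cosets. -/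
theorem apply_lowK_eq_zero_of_mem {m : ℕ} {f : maxK n F → ℂ} {ψ : borelK n F →* ℂˣ}
    (hf : IsBiEquivariant ψ f) (hup : ∀ y, ψ (upK n y) = 1)
    (hprim : 2 ≤ m → ∃ u : (𝒪[F])ˣ, (u : 𝒪[F]) - 1 ∈ 𝓂[F] ^ (m - 1) ∧
      ψ (diagK n 1 u) ≠ ψ (diagK n u 1)) {z : 𝒪[F]} (hz : z ∈ 𝓂[F]) (hzm : z ∉ 𝓂[F] ^ m) :
    f (lowK n z) = 0 := by
  obtain ⟨ϖ, hϖ⟩ := IsDiscreteValuationRing.exists_irreducible 𝒪[F]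
  have hz0 : z ≠ 0 := fun e => hzm (e ▸ Ideal.zero_mem _)
  obtain ⟨i, v, rfl⟩ := IsDiscreteValuationRing.eq_unit_mul_pow_irreducible hz0 hϖ
  have him : i < m := by
    by_contra hc
    apply hzm
    rw [hϖ.maximalIdeal_eq, Ideal.span_singleton_pow, Ideal.mem_span_singleton]
    exact Dvd.dvd.mul_left (pow_dvd_pow _ (not_lt.1 hc)) _
  have hi0 : i ≠ 0 := by
    rintro rfl
    rw [pow_zero, mul_one] at hz
    exact (IsLocalRing.mem_maximalIdeal _).1 hz v.isUnit
  obtain ⟨u, hu, hne⟩ := hprim (by omega)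
  rw [hϖ.maximalIdeal_eq, Ideal.span_singleton_pow, Ideal.mem_span_singleton] at hu
  have hdvd : (v : 𝒪[F]) * ϖ ^ i ∣ u - 1 := by
    rw [Units.mul_left_dvd]
    exact (pow_dvd_pow _ (by omega)).trans hu
  obtain ⟨y, hy⟩ := hdvd
  exact hf.apply_lowK_eq_zero hup u y _ (by linear_combination hy) (Or.inr hz) hne

/-- If `ψ(dg(u, u⁻¹)) ≠ 1` for some unit `u`, then all spherical vectors of level `m` are
proportional to `δ`. -/
theorem levelRep_isIrreducible (hn0 : n ≠ 0) {m : ℕ} (hm : 1 ≤ m)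
    (hχ : ∀ z : groupA n F, (z : Cover n F) ∈ congSet n m → χ z = 1)
    (hprim : 2 ≤ m → ∃ u : (𝒪[F])ˣ, (u : 𝒪[F]) - 1 ∈ 𝓂[F] ^ (m - 1) ∧
      borelChar n χ (diagK n 1 u) ≠ borelChar n χ (diagK n u 1))
    (hne : ∃ u, borelChar n χ (diagK n 1 u) ≠ borelChar n χ (diagK n u 1)) :
    (levelRep (indK n χ) m hm).IsIrreducible := by
  have := levelK_normal (n := n) (F := F) hm
  have := levelK_finiteIndex (n := n) (F := F) hn0 hm
  obtain ⟨d, D⟩ := exists_delta hm hχ le_rfl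
  refine (evalLevel_model χ hm).isIrreducible D fun w hw h1 => (evalLevel_model χ hm).injective ?_
  have hf := isBiEquivariant_of_spherical hm hw
  rw [map_zero]
  refine hf.eq_zero fun z => ?_
  by_cases hz : z ∈ 𝓂[F]
  · by_cases hzm : z ∈ 𝓂[F] ^ m
    · rw [← one_mul (lowK n z), (evalLevel_model χ hm).apply_mul_of_mem w 1
        (lowK_mem_levelK hm hzm), h1]
    · exact apply_lowK_eq_zero_of_mem hf (borelChar_upK χ) hprim hz hzm
  · have hz' : IsUnit z := by
      by_contra hc
      exact hz ((IsLocalRing.mem_maximalIdeal _).2 hc)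
    obtain ⟨v, rfl⟩ := hz'
    obtain ⟨u, hu⟩ := hne
    refine hf.apply_lowK_eq_zero (borelChar_upK χ) u
      (((u : 𝒪[F]) - 1) * ((v⁻¹ : (𝒪[F])ˣ) : 𝒪[F])) v ?_ (Or.inl v.isUnit) hu
    rw [Units.inv_mul_cancel_right]
    ring

/-- If `ψ(dg(u, u⁻¹)) = 1` for all units `u`, then the spherical vectors of level `m` form a plane,
spanned by `δ` and a function on the big cell. -/
theorem levelRep_exists_two (hn0 : n ≠ 0) {m : ℕ} (hm : 1 ≤ m)
    (hχ : ∀ z : groupA n F, (z : Cover n F) ∈ congSet n m → χ z = 1)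
    (hprim : 2 ≤ m → ∃ u : (𝒪[F])ˣ, (u : 𝒪[F]) - 1 ∈ 𝓂[F] ^ (m - 1) ∧
      borelChar n χ (diagK n 1 u) ≠ borelChar n χ (diagK n u 1))
    (heq : ∀ u, borelChar n χ (diagK n 1 u) = borelChar n χ (diagK n u 1)) :
    ∃ U₁ U₂ : Subrepresentation (levelRep (indK n χ) m hm), IsCompl U₁ U₂ ∧
      U₁.toRepresentation.IsIrreducible ∧ U₂.toRepresentation.IsIrreducible := by
  have := levelK_normal (n := n) (F := F) hm
  have := levelK_finiteIndex (n := n) (F := F) hn0 hm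
  obtain ⟨d, D⟩ := exists_delta hm hχ le_rfl
  obtain ⟨f, hf, hf0, hfne⟩ := exists_bigCell (borelChar_upK χ) heq
  have hf1 : f 1 = 0 := by rw [← lowK_zero]; exact hf0 0 (Ideal.zero_mem _)
  obtain ⟨w, rfl⟩ := exists_evalLevel hf.left hm fun x k hk => hf.apply_mul_levelK hm
    (borelChar_eq_one hm hχ le_rfl)
    (fun z hz => by rw [hf0 z (maximalIdeal_pow_le hm hz), hf1]) x hk
  refine (evalLevel_model χ hm).exists_two D (f := w) (fun b => ?_) hf1 ?_ (lowK n 1) ?_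
  · apply (evalLevel_model χ hm).injective
    funext x
    rw [(evalLevel_model χ hm).translate, hf.right]
    rfl
  · rintro rfl
    exact hfne (map_zero _)
  · intro w hw h1 h2
    apply (evalLevel_model χ hm).injective
    have hf := isBiEquivariant_of_spherical hm hw
    rw [map_zero]
    refine hf.eq_zero fun z => ?_
    by_cases hz : z ∈ 𝓂[F]
    · by_cases hzm : z ∈ 𝓂[F] ^ m
      · rw [← one_mul (lowK n z), (evalLevel_model χ hm).apply_mul_of_mem w 1
          (lowK_mem_levelK hm hzm), h1]
      · exact apply_lowK_eq_zero_of_mem hf (borelChar_upK χ) hprim hz hzm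
    · have hz' : IsUnit z := by
        by_contra hc
        exact hz ((IsLocalRing.mem_maximalIdeal _).2 hc)
      obtain ⟨v, rfl⟩ := hz'
      have h3 := hf.apply_unit_mul v 1
      rw [mul_one] at h3
      rw [h3, h2]

end Pieces

/-! ### The characters `χ'_{i,j}` -/

section Characters

variable {n : ℕ} {F : Type*} [Field F] [ValuativeRel F] [TopologicalSpace F]
  [IsNonarchimedeanLocalField F] [hn : Fact (n ∣ Nat.card 𝓀[F] - 1)]

/-- By Hensel's lemma, elements of `1 + 𝔭^l` have `n`-th roots in `1 + 𝔭^l`. -/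
theorem exists_pow_eq (hn0 : n ≠ 0) {l : ℕ} (hl : 1 ≤ l) {a : 𝒪[F]} (ha : a - 1 ∈ 𝓂[F] ^ l) :
    ∃ b : 𝒪[F], b ^ n = a ∧ b - 1 ∈ 𝓂[F] ^ l := by
  let _ := IsTopologicalAddGroup.rightUniformSpace F
  have := isUniformAddGroup_of_addCommGroup (G := F)
  have hH : HenselianRing 𝒪[F] 𝓂[F] := inferInstance
  have ha' : a - 1 ∈ 𝓂[F] := maximalIdeal_pow_le hl ha
  have hnu := isUnit_natCast (F := F) n
  obtain ⟨b, hb, hb1⟩ := hH.is_henselian (Polynomial.X ^ n - Polynomial.C a)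
    (Polynomial.monic_X_pow_sub_C a hn0) 1 (by
      have := neg_mem ha'
      simpa using this) (by
      rw [Polynomial.derivative_sub, Polynomial.derivative_C, sub_zero,
        Polynomial.derivative_X_pow]
      simpa using hnu.map (Ideal.Quotient.mk 𝓂[F]))
  have hba : b ^ n = a := by
    have h : Polynomial.eval b (Polynomial.X ^ n - Polynomial.C a) = 0 := hb
    simpa [sub_eq_zero] using h
  refine ⟨b, hba, ?_⟩
  -- The cofactor of `b - 1` in `b ^ n - 1` is congruent to `n`, hence a unit.
  obtain ⟨c, hc⟩ : ∃ c, ∑ i ∈ Finset.range n, b ^ i = n + (b - 1) * c := by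
    have h : (b - 1) ∣ ∑ i ∈ Finset.range n, (b ^ i - 1) :=
      Finset.dvd_sum fun i _ => by simpa using sub_dvd_pow_sub_pow b 1 i
    obtain ⟨c, hc⟩ := h
    exact ⟨c, by rw [← hc, Finset.sum_sub_distrib]; simp⟩
  have hu : IsUnit (∑ i ∈ Finset.range n, b ^ i) := by
    by_contra hcon
    have h1 := Ideal.sub_mem _ ((IsLocalRing.mem_maximalIdeal _).2 hcon)
      (Ideal.mul_mem_right c 𝓂[F] hb1)
    rw [hc, add_sub_cancel_right] at h1
    exact (IsLocalRing.mem_maximalIdeal _).1 h1 hnu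
  rw [← Ideal.unit_mul_mem_iff_mem _ hu, geom_sum_mul, hba]
  exact ha

theorem hilbert_pow_left (a b : Fˣ) (k : ℕ) : hilbert n (a ^ k) b = hilbert n a b ^ k :=
  map_pow (⟨⟨fun a => hilbert n a b, hilbert_one_left n b⟩, fun x y => hilbert_mul_left n x y b⟩ :
    Fˣ →* rootsOfUnity n 𝓀[F]) a k

theorem hilbert_pow_self_left (a b : Fˣ) : hilbert n (a ^ n) b = 1 := by
  rw [hilbert_pow_left]
  exact Subtype.ext (hilbert n a b).2

theorem hilbert_pow_self_right (a b : Fˣ) : hilbert n a (b ^ n) = 1 := by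
  have h : hilbert n a (b ^ n) = hilbert n a b ^ n := map_pow (varpiChar n a) b n
  rw [h]
  exact Subtype.ext (hilbert n a b).2

theorem torus_mul {x y : Cover n F} (hx : x ∈ torus n F) (hy : y ∈ torus n F) :
    x * y = ⟨dg (diagL x.mat * diagL y.mat) (diagR x.mat * diagR y.mat),
      hilbert n (diagR y.mat) (diagL x.mat)⁻¹ * (x.root * y.root)⟩ := by
  have mx : x.mat ∈ torusMat F := hx
  have my : y.mat ∈ torusMat F := hy
  refine Cover.ext ?_ ?_
  · change x.mat * y.mat = _
    rw [dg_mul, dg_diag mx, dg_diag my]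
  · change cocycle n _ _ * _ = _
    rw [cocycle_borel n (torusMat_le mx)]

theorem mem_centerT {x : Cover n F} (hx : x ∈ torus n F)
    (hL : ∃ a, diagL x.mat = a ^ n) (hR : ∃ b, diagR x.mat = b ^ n) : x ∈ centerT n F := by
  obtain ⟨a, ha⟩ := hL
  obtain ⟨b, hb⟩ := hR
  refine ⟨hx, Subgroup.mem_centralizer_iff.2 fun y hy => ?_⟩
  rw [torus_mul hx hy, torus_mul hy hx, ha, hb, mul_comm (diagL _), mul_comm (diagR _),
    hilbert_pow_self_left, hilbert_inv_right, hilbert_pow_self_right, inv_one, mul_comm x.root]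

variable {χ₀ : groupA n F →* ℂˣ}

theorem exists_unit_of_congruence {l : ℕ} (hl : 1 ≤ l) {g : GL (Fin 2) F} (hg : g ∈ congruence F l)
    (hB : g ∈ borelMat F) : ∃ t s : (𝒪[F])ˣ, diagL g = unitO t ∧ diagR g = unitO s ∧
      (t : 𝒪[F]) - 1 ∈ 𝓂[F] ^ l ∧ (s : 𝒪[F]) - 1 ∈ 𝓂[F] ^ l := by
  obtain ⟨M, hM, e⟩ := exists_of_mem_congruence hg
  obtain ⟨t, ht⟩ := isUnit_one_add (maximalIdeal_pow_le hl (hM 0 0))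
  obtain ⟨s, hs⟩ := isUnit_one_add (maximalIdeal_pow_le hl (hM 1 1))
  refine ⟨t, s, Units.ext ?_, Units.ext ?_, ?_, ?_⟩
  · rw [diagL_coe hB, unitO_coe, ht, e]; simp
  · rw [diagR_coe hB, unitO_coe, hs, e]; simp
  · rw [ht, add_sub_cancel_left]; exact hM _ _
  · rw [hs, add_sub_cancel_left]; exact hM _ _

theorem mem_centerT_of_congSet (hn0 : n ≠ 0) {l : ℕ} (hl : 1 ≤ l) {x : Cover n F}
    (hx : x ∈ torus n F) (hxl : x ∈ congSet n l) : x ∈ centerT n F := by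
  obtain ⟨t, s, ht, hs, ht1, hs1⟩ := exists_unit_of_congruence hl hxl.1 (torusMat_le hx)
  have key : ∀ u : (𝒪[F])ˣ, (u : 𝒪[F]) - 1 ∈ 𝓂[F] ^ l → ∃ v, unitO u = v ^ n := by
    intro u hu
    obtain ⟨v, hv, -⟩ := exists_pow_eq hn0 hl hu
    have hvu : IsUnit v := (isUnit_pow_iff hn0).1 (hv ▸ u.isUnit)
    obtain ⟨v, rfl⟩ := hvu
    exact ⟨unitO v, by rw [← map_pow]; exact congrArg _ (Units.ext hv.symm)⟩
  exact mem_centerT hx (ht ▸ key t ht1) (hs ▸ key s hs1)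

variable {ε : rootsOfUnity n 𝓀[F] →* ℂˣ} {ϖ : Fˣ}

theorem chi_apply (hε₀ : ∀ ζ, χ₀ ⟨Cover.incl n ζ, incl_mem_groupA n ζ⟩ = ε ζ) (i j : ℕ)
    (x : groupA n F) : chi n ϖ χ₀ i j x = χ₀ x *
      ((ε (varpiChar n ϖ (diagL (x : Cover n F).mat)))⁻¹ ^ j *
        (ε (varpiChar n ϖ (diagR (x : Cover n F).mat)))⁻¹ ^ i) := by
  change χ₀ (x * ⟨Cover.incl n _, _⟩) = _
  rw [map_mul, hε₀, map_mul, map_pow, map_pow, map_inv, map_inv]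

theorem varpiChar_pow_eq_one (x : Fˣ) : ε (varpiChar n ϖ x) ^ n = 1 := by
  have h : varpiChar n ϖ x ^ n = 1 := Subtype.ext (varpiChar n ϖ x).2
  rw [← map_pow, h, map_one]

theorem varpiChar_principal {u : (𝒪[F])ˣ} {l : ℕ} (hl : 1 ≤ l) (hu : (u : 𝒪[F]) - 1 ∈ 𝓂[F] ^ l) :
    varpiChar n ϖ (unitO u) = 1 :=
  hilbert_principal_right n _ _ (isPrincipal_unitO (maximalIdeal_pow_le hl hu))

theorem chi_eq_of_congSet (hε₀ : ∀ ζ, χ₀ ⟨Cover.incl n ζ, incl_mem_groupA n ζ⟩ = ε ζ) (i j : ℕ)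
    {l : ℕ} (hl : 1 ≤ l) {x : groupA n F} (hx : (x : Cover n F) ∈ congSet n l) :
    chi n ϖ χ₀ i j x = χ₀ x := by
  obtain ⟨t, s, ht, hs, ht1, hs1⟩ := exists_unit_of_congruence hl hx.1 (torusMat_le x.2.1)
  rw [chi_apply hε₀, ht, hs, varpiChar_principal hl ht1, varpiChar_principal hl hs1, map_one,
    inv_one, one_pow, one_pow, mul_one, mul_one]

theorem chi_trivial (hn0 : n ≠ 0)
    (hε₀ : ∀ ζ, χ₀ ⟨Cover.incl n ζ, incl_mem_groupA n ζ⟩ = ε ζ) {χ' : centerT n F →* ℂˣ}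
    (hχ₀ : ∀ z, χ₀ (Subgroup.inclusion (centerT_le_groupA n F) z) = χ' z) {m : ℕ} (hm : 1 ≤ m)
    (hχ' : ∀ z : centerT n F, (z : Cover n F) ∈ congSet n m → χ' z = 1) (i j : ℕ)
    (x : groupA n F) (hx : (x : Cover n F) ∈ congSet n m) : chi n ϖ χ₀ i j x = 1 := by
  rw [chi_eq_of_congSet hε₀ i j hm hx]
  exact (hχ₀ ⟨x, mem_centerT_of_congSet hn0 hm x.2.1 hx⟩).trans (hχ' _ hx)

theorem borelKToA_diagK (t s : (𝒪[F])ˣ) : borelKToA n (diagK n t s) =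
    unitDiag n (unitO t) (unitO s) (val_unitO t) (val_unitO s) := by
  apply Subtype.ext
  refine Cover.ext ?_ rfl
  change dg (diagL (dg _ _)) (diagR (dg _ _)) = dg _ _
  rw [diagL_dg, diagR_dg]

theorem unitDiag_inv_eq (u : (𝒪[F])ˣ) (h : val (unitO u)⁻¹ = 0) :
    unitDiag n (unitO u) (unitO u)⁻¹ (val_unitO u) h = borelKToA n (diagK n u u⁻¹) := by
  rw [borelKToA_diagK]
  apply Subtype.ext
  refine Cover.ext ?_ rfl
  change dg _ _ = dg _ _
  rw [map_inv]

/-- The condition on `χ'_{i,j}` that makes its level `m` piece reducible. -/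
theorem borelChar_chi_eq_iff (hε₀ : ∀ ζ, χ₀ ⟨Cover.incl n ζ, incl_mem_groupA n ζ⟩ = ε ζ) (i j : ℕ)
    (u : (𝒪[F])ˣ) :
    borelChar n (chi n ϖ χ₀ i j) (diagK n 1 u) = borelChar n (chi n ϖ χ₀ i j) (diagK n u 1) ↔
      χ₀ (borelKToA n (diagK n u u⁻¹)) * ε (varpiChar n ϖ (unitO u)) ^ i =
        ε (varpiChar n ϖ (unitO u)) ^ j := by
  have e : diagK n u u⁻¹ * diagK n 1 u = diagK n u 1 := by
    rw [← diagK_mul, mul_one, inv_mul_cancel]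
  rw [← e, map_mul, right_eq_mul, borelChar, MonoidHom.comp_apply, chi_apply hε₀, borelKToA_diagK]
  have e1 : diagL ((unitDiag n (unitO u) (unitO u⁻¹) (val_unitO u) (val_unitO u⁻¹) :
      groupA n F) : Cover n F).mat = unitO u := diagL_dg _ _
  have e2 : diagR ((unitDiag n (unitO u) (unitO u⁻¹) (val_unitO u) (val_unitO u⁻¹) :
      groupA n F) : Cover n F).mat = (unitO u)⁻¹ := by rw [← map_inv]; exact diagR_dg _ _
  rw [e1, e2, map_inv (varpiChar n ϖ), map_inv ε, inv_inv, inv_pow, mul_comm (_)⁻¹, ← mul_assoc,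
    mul_inv_eq_one]

/-- Primitivity on `Z(T̃) ∩ T̃¹` says that the level of `χ'_{i,j}` on `T̃¹ ∩ K̃` is exactly `m`. -/
theorem exists_borelChar_chi_ne
    (hε₀ : ∀ ζ, χ₀ ⟨Cover.incl n ζ, incl_mem_groupA n ζ⟩ = ε ζ) {χ' : centerT n F →* ℂˣ}
    (hχ₀ : ∀ z, χ₀ (Subgroup.inclusion (centerT_le_groupA n F) z) = χ' z) {m : ℕ}
    (hprim : IsPrimitiveMod n (χ'.comp (Subgroup.inclusion (inf_le_left :
      centerT n F ⊓ torusOne n F ≤ centerT n F))) m) (i j : ℕ) (hm : 2 ≤ m) :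
    ∃ u : (𝒪[F])ˣ, (u : 𝒪[F]) - 1 ∈ 𝓂[F] ^ (m - 1) ∧
      borelChar n (chi n ϖ χ₀ i j) (diagK n 1 u) ≠ borelChar n (chi n ϖ χ₀ i j) (diagK n u 1) := by
  by_contra! hcon
  have h1 : m ≤ m - 1 := by
    refine hprim.2 ⟨by omega, fun z hz => ?_⟩
    have hm1 : 1 ≤ m - 1 := by omega
    have hzT : (z : Cover n F) ∈ torus n F := z.2.1.1
    obtain ⟨t, s, ht, hs, ht1, hs1⟩ := exists_unit_of_congruence hm1 hz.1 (torusMat_le hzT)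
    have hdet : Matrix.GeneralLinearGroup.det (z : Cover n F).mat = 1 := z.2.2.2
    have hts : unitO s = (unitO t)⁻¹ := by
      rw [eq_inv_iff_mul_eq_one, ← ht, ← hs, diagL, diagR, mul_div_cancel, hdet]
    have h2 := (borelChar_chi_eq_iff hε₀ i j t).1 (hcon t ht1)
    rw [varpiChar_principal hm1 ht1, map_one, one_pow, one_pow, mul_one] at h2
    rw [MonoidHom.comp_apply, ← hχ₀, ← h2]
    congr 1
    apply Subtype.ext
    rw [borelKToA_diagK]
    refine Cover.ext ?_ hz.2
    change (z : Cover n F).mat = dg _ _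
    rw [← dg_diag (g := (z : Cover n F).mat) hzT, ht, hs, hts, map_inv]
  omega

/-- The group of units modulo `n`-th powers is cyclic of order `n`, and the symbol `(ϖ, ·)_n`
identifies it with `μ_n`. -/
theorem exists_orderOf_varpiChar (hn0 : n ≠ 0) (hϖ : val ϖ = 1) :
    ∃ u : (𝒪[F])ˣ, orderOf (varpiChar n ϖ (unitO u)) = n ∧
      ∀ v : (𝒪[F])ˣ, ∃ (k : ℤ) (w : (𝒪[F])ˣ), v = u ^ k * w ^ n := by
  obtain ⟨g, hg⟩ := IsCyclic.exists_generator (α := (𝓀[F])ˣ)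
  obtain ⟨u, hu⟩ := IsLocalRing.surjective_units_map_of_local_ringHom (IsLocalRing.residue 𝒪[F])
    IsLocalRing.residue_surjective inferInstance g
  refine ⟨u⁻¹, ?_, fun v => ?_⟩
  swap
  · let r := Units.map (IsLocalRing.residue 𝒪[F]).toMonoidHom
    obtain ⟨k, hk⟩ := Subgroup.mem_zpowers_iff.1 (hg (r v))
    have h1 : r (u ^ (-k) * v) = 1 := by
      have hu' : r u = g := hu
      rw [map_mul, map_zpow, hu', ← hk, ← zpow_add, neg_add_cancel, zpow_zero]
    have h2 : ((u ^ (-k) * v : (𝒪[F])ˣ) : 𝒪[F]) - 1 ∈ 𝓂[F] ^ 1 := by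
      rw [pow_one, ← IsLocalRing.residue_eq_zero_iff, map_sub, map_one, sub_eq_zero]
      exact congrArg Units.val h1
    obtain ⟨w, hw, -⟩ := exists_pow_eq hn0 le_rfl h2
    obtain ⟨w, rfl⟩ := (isUnit_pow_iff hn0).1 (hw ▸ Units.isUnit _)
    refine ⟨-k, w, ?_⟩
    have h3 : w ^ n = u ^ (-k) * v := Units.ext hw
    rw [h3, inv_zpow', neg_neg, ← mul_assoc, ← zpow_add, add_neg_cancel, zpow_zero, one_mul]
  rw [← Subgroup.orderOf_coe]
  have e : symbolArg ϖ (unitO u⁻¹) = ⟨unitO u, val_unitO u⟩ := by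
    apply Subtype.ext
    simp [symbolArg, val_unitO, hϖ, val_inv]
  have e2 : reduce ⟨unitO u, val_unitO u⟩ = g := by
    rw [← hu]
    rfl
  change orderOf (reduce (symbolArg ϖ (unitO u⁻¹)) ^ ((Nat.card 𝓀[F] - 1) / n)) = n
  have hq : Nat.card (𝓀[F])ˣ = Nat.card 𝓀[F] - 1 := Nat.card_units _
  have hq0 : Nat.card 𝓀[F] - 1 ≠ 0 := by rw [← hq]; exact Nat.card_pos.ne'
  rw [e, e2, orderOf_pow, orderOf_eq_card_of_forall_mem_zpowers hg, hq]
  obtain ⟨k, hk⟩ := hn.out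
  have hk0 : 0 < k := Nat.pos_of_ne_zero fun h => hq0 (by rw [hk, h, mul_zero])
  rw [hk, Nat.mul_div_cancel_left k (Nat.pos_of_ne_zero hn0), Nat.gcd_mul_left_left,
    Nat.mul_div_cancel _ hk0]

end Characters

/-! ### Irreducible representations of the torus of the cover -/

section Torus

theorem exists_eigenvector_of_pow_eq_one {V : Type*} [AddCommGroup V] [Module ℂ V]
    {f : Module.End ℂ V} {n : ℕ} (hn0 : n ≠ 0) (hf : f ^ n = 1) {W : Submodule ℂ V}
    (hW : ∀ w ∈ W, f w ∈ W) {v : V} (hv : v ∈ W) (hv0 : v ≠ 0) :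
    ∃ w ∈ W, w ≠ 0 ∧ ∃ α : ℂ, α ^ n = 1 ∧ f w = α • w := by
  let U : Submodule ℂ V := Submodule.span ℂ (Set.range fun i : Fin n => (f ^ (i : ℕ)) v)
  have hfd : FiniteDimensional ℂ U := FiniteDimensional.span_of_finite ℂ (Set.finite_range _)
  have hmem : ∀ k : ℕ, (f ^ k) v ∈ U := by
    intro k
    have e : (f ^ k) v = (f ^ (k % n)) v := by
      conv_lhs => rw [← Nat.mod_add_div k n, pow_add, pow_mul, hf, one_pow, mul_one]
    rw [e]
    exact Submodule.subset_span ⟨⟨k % n, Nat.mod_lt _ (Nat.pos_of_ne_zero hn0)⟩, rfl⟩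
  have hU : ∀ w ∈ U, f w ∈ U := by
    intro w hw
    induction hw using Submodule.span_induction with
    | mem w hw =>
      obtain ⟨i, rfl⟩ := hw
      have := hmem (i + 1)
      rwa [pow_succ'] at this
    | zero => rw [map_zero]; exact U.zero_mem
    | add a b _ _ ha hb => rw [map_add]; exact U.add_mem ha hb
    | smul c a _ ha => rw [map_smul]; exact U.smul_mem c ha
  have hUW : U ≤ W := by
    refine Submodule.span_le.2 ?_
    rintro _ ⟨i, rfl⟩
    change (f ^ (i : ℕ)) v ∈ W
    generalize (i : ℕ) = k
    induction k with
    | zero => exact hv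
    | succ k ih => rw [pow_succ']; exact hW _ ih
  have : Nontrivial U := ⟨⟨v, hmem 0⟩, 0, fun e => hv0 (congrArg Subtype.val e)⟩
  obtain ⟨α, hα⟩ := Module.End.exists_eigenvalue (f.restrict hU)
  obtain ⟨w, hw⟩ := hα.exists_hasEigenvector
  have hw1 : f w = α • (w : V) := congrArg Subtype.val hw.apply_eq_smul
  have hw0 : (w : V) ≠ 0 := fun e => hw.2 (Subtype.ext e)
  refine ⟨w, hUW w.2, hw0, α, ?_, hw1⟩
  have hk : ∀ k : ℕ, (f ^ k) w = α ^ k • (w : V) := by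
    intro k
    induction k with
    | zero => simp
    | succ k ih =>
      rw [pow_succ', Module.End.mul_apply, ih, map_smul, hw1, smul_smul, pow_succ]
  have h1 := hk n
  rw [hf, Module.End.one_apply] at h1
  have h2 : (1 - α ^ n) • (w : V) = 0 := by rw [sub_smul, one_smul, ← h1, sub_self]
  exact (sub_eq_zero.1 ((smul_eq_zero.1 h2).resolve_right hw0)).symm

/-- Nonzero simultaneous eigenvectors for distinct characters are linearly independent, by the
independence of characters. -/
theorem linearIndependent_of_characters {ι M V : Type*} [Monoid M] [AddCommGroup V] [Module ℂ V]
    (ρ : M → Module.End ℂ V) (χ : ι → M →* ℂˣ) (hχ : Function.Injective χ) (v : ι → V)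
    (hv : ∀ i g, ρ g (v i) = (χ i g : ℂ) • v i) (hv0 : ∀ i, v i ≠ 0) : LinearIndependent ℂ v := by
  rw [linearIndependent_iff']
  intro s c hc i hi
  have hli : LinearIndependent ℂ (fun i => (((Units.coeHom ℂ).comp (χ i) : M →* ℂ) : M → ℂ)) :=
    (linearIndependent_monoidHom M ℂ).comp (fun i => (Units.coeHom ℂ).comp (χ i)) fun i j h =>
      hχ (MonoidHom.ext fun g => Units.ext (DFunLike.congr_fun h g))
  have key : ∀ L : Module.Dual ℂ V, L (c i • v i) = 0 := by
    intro L
    rw [linearIndependent_iff'] at hli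
    rw [map_smul, smul_eq_mul]
    refine hli s (fun i => c i * L (v i)) (funext fun g => ?_) i hi
    have h1 := congrArg (fun w => L (ρ g w)) hc
    simp only [map_sum, map_smul, hv, map_zero, smul_eq_mul] at h1
    rw [Finset.sum_apply, Pi.zero_apply, ← h1]
    exact Finset.sum_congr rfl fun j _ => by
      rw [Pi.smul_apply, smul_eq_mul, MonoidHom.comp_apply, Units.coeHom_apply]; ring
  exact (smul_eq_zero.1 ((Module.forall_dual_apply_eq_zero_iff ℂ _).1 key)).resolve_right (hv0 i)

variable {n : ℕ} {F : Type*} [Field F] [ValuativeRel F] [TopologicalSpace F]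
  [IsNonarchimedeanLocalField F] [hn : Fact (n ∣ Nat.card 𝓀[F] - 1)]

variable (n F) in
/-- The homomorphism `(t, s) ↦ (dg(t, s), 1)` from `𝒪ˣ × 𝒪ˣ` to `A`. -/
noncomputable def unitA : (𝒪[F])ˣ × (𝒪[F])ˣ →* groupA n F where
  toFun p := borelKToA n (diagK n p.1 p.2)
  map_one' := by
    have h := diagK_mul (n := n) (F := F) 1 1 1 1
    rw [mul_one, left_eq_mul] at h
    change borelKToA n (diagK n 1 1) = 1
    rw [h, map_one]
  map_mul' p q := by rw [← map_mul, ← diagK_mul]; rfl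

variable (n F) in
/-- The inclusion of `A` in `T̃`. -/
noncomputable def aToTorus : groupA n F →* torus n F := Subgroup.inclusion inf_le_left

variable (n) in
/-- The element `(dg(x, y), 1)` of `T̃`. -/
noncomputable def diagT (x y : Fˣ) : torus n F := ⟨⟨dg x y, 1⟩, dg_mem x y⟩

theorem unitA_mat (p : (𝒪[F])ˣ × (𝒪[F])ˣ) :
    ((unitA n F p : groupA n F) : Cover n F) = ⟨dg (unitO p.1) (unitO p.2), 1⟩ := by
  change ((borelKToA n (diagK n p.1 p.2) : groupA n F) : Cover n F) = _
  rw [borelKToA_diagK]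
  rfl

/-- The commutation relation between units and powers of `ϖ` in `T̃`. -/
theorem unitA_mul_diagT (ϖ : Fˣ) (p : (𝒪[F])ˣ × (𝒪[F])ˣ) (c d : ℕ) :
    aToTorus n F (unitA n F p) * diagT n (ϖ ^ c) (ϖ ^ d) =
      diagT n (ϖ ^ c) (ϖ ^ d) * aToTorus n F (unitA n F p *
        ⟨Cover.incl n ((varpiChar n ϖ (unitO p.1))⁻¹ ^ d * (varpiChar n ϖ (unitO p.2))⁻¹ ^ c),
          incl_mem_groupA n _⟩) := by
  rw [map_mul, ← mul_assoc]
  apply Subtype.ext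
  have e1 : ((aToTorus n F (unitA n F p) * diagT n (ϖ ^ c) (ϖ ^ d) : torus n F) : Cover n F) =
      ⟨dg (unitO p.1 * ϖ ^ c) (unitO p.2 * ϖ ^ d),
        (hilbert n ϖ (unitO p.1))⁻¹ ^ d⟩ := by
    have h := torus_mul (aToTorus n F (unitA n F p)).2 (diagT n (ϖ ^ c) (ϖ ^ d)).2
    have h1 : ((aToTorus n F (unitA n F p) : torus n F) : Cover n F) =
      ⟨dg (unitO p.1) (unitO p.2), 1⟩ := unitA_mat p
    rw [Subgroup.coe_mul, h, h1]
    simp only [diagT, diagL_dg, diagR_dg, mul_one, hilbert_inv_right, hilbert_pow_left,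
      inv_pow]
  have e2 : ((diagT n (ϖ ^ c) (ϖ ^ d) * aToTorus n F (unitA n F p) : torus n F) : Cover n F) =
      ⟨dg (unitO p.1 * ϖ ^ c) (unitO p.2 * ϖ ^ d), hilbert n ϖ (unitO p.2) ^ c⟩ := by
    have h := torus_mul (diagT n (ϖ ^ c) (ϖ ^ d)).2 (aToTorus n F (unitA n F p)).2
    have h1 : ((aToTorus n F (unitA n F p) : torus n F) : Cover n F) =
      ⟨dg (unitO p.1) (unitO p.2), 1⟩ := unitA_mat p
    have hsk : hilbert n (unitO p.2) (ϖ ^ c)⁻¹ = hilbert n ϖ (unitO p.2) ^ c := by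
      rw [hilbert_inv_right, ← hilbert_pow_left, inv_eq_iff_mul_eq_one]
      exact hilbert_skew n _ _
    rw [Subgroup.coe_mul, h, h1]
    simp only [diagT, diagL_dg, diagR_dg, mul_one, hsk]
    rw [mul_comm (ϖ ^ c), mul_comm (ϖ ^ d)]
  rw [e1, Subgroup.coe_mul, e2]
  change _ = _ * Cover.incl n _
  rw [Cover.mul_incl]
  refine Cover.ext rfl ?_
  change (hilbert n ϖ (unitO p.1))⁻¹ ^ d = hilbert n ϖ (unitO p.2) ^ c *
    ((hilbert n ϖ (unitO p.1))⁻¹ ^ d * (hilbert n ϖ (unitO p.2))⁻¹ ^ c)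
  rw [mul_left_comm, ← mul_pow, mul_inv_cancel, one_pow, mul_one]

theorem val_pow_varpi {ϖ : Fˣ} (hϖ : val ϖ = 1) (k : ℤ) : val (ϖ ^ k) = k := by
  rw [val_zpow, hϖ, mul_one]

/-- Modulo the centre, every element of `T̃` is a power of `ϖ` times a unit in each coordinate, and
the exponents can be taken in any two intervals of length `n`. -/
theorem exists_torus_eq (hn0 : n ≠ 0) {ϖ : Fˣ} (hϖ : val ϖ = 1) (a b : ℕ) (y : torus n F) :
    ∃ (i j : Fin n) (z : centerT n F) (p : (𝒪[F])ˣ × (𝒪[F])ˣ),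
      y = diagT n (ϖ ^ ((i : ℕ) + b)) (ϖ ^ ((j : ℕ) + a)) *
        (aToTorus n F (Subgroup.inclusion (centerT_le_groupA n F) z) *
          aToTorus n F (unitA n F p)) := by
  have hpos : 0 < n := Nat.pos_of_ne_zero hn0
  have key : ∀ (x : Fˣ) (b : ℕ), ∃ (i : Fin n) (k : ℤ) (t : (𝒪[F])ˣ),
      (ϖ ^ ((i : ℕ) + b))⁻¹ * x * (unitO t)⁻¹ = (ϖ ^ k) ^ n := by
    intro x b
    have hnz : (n : ℤ) ≠ 0 := by exact_mod_cast hn0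
    have h0 := Int.emod_nonneg (val x - b) hnz
    have h1 := Int.emod_lt_of_pos (val x - b) (by exact_mod_cast hpos : (0 : ℤ) < n)
    obtain ⟨i, hi⟩ := Int.eq_ofNat_of_zero_le h0
    have hin : i < n := by rw [hi] at h1; exact_mod_cast h1
    let k := (val x - b) / n
    have hk : val x = i + b + n * k := by
      have := Int.emod_add_mul_ediv (val x - b) n
      rw [hi] at this
      linear_combination -this
    obtain ⟨t, ht⟩ := exists_unitO (x := (ϖ ^ (i + b))⁻¹ * x * ((ϖ ^ k) ^ n)⁻¹) (by
      rw [val_mul, val_mul, val_inv, val_inv, ← zpow_natCast, ← zpow_natCast, ← zpow_mul,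
        val_pow_varpi hϖ, val_pow_varpi hϖ, hk]
      push_cast
      ring)
    refine ⟨⟨i, hin⟩, k, t, ?_⟩
    rw [ht, mul_inv_eq_iff_eq_mul, mul_comm ((ϖ ^ k) ^ n), inv_mul_cancel_right]
  obtain ⟨i, k, t, hi⟩ := key (diagL (y : Cover n F).mat) b
  obtain ⟨j, l, s, hj⟩ := key (diagR (y : Cover n F).mat) a
  let z : torus n F := (diagT n (ϖ ^ ((i : ℕ) + b)) (ϖ ^ ((j : ℕ) + a)))⁻¹ * y *
    (aToTorus n F (unitA n F (t, s)))⁻¹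
  have hinvL : ∀ x : torus n F, diagL ((x⁻¹ : torus n F) : Cover n F).mat =
      (diagL (x : Cover n F).mat)⁻¹ := fun x => by
    rw [eq_inv_iff_mul_eq_one, ← diagL_mul (g := ((x⁻¹ : torus n F) : Cover n F).mat)
      (torusMat_le (x⁻¹).2)]
    change diagL (((x⁻¹ : torus n F) : Cover n F) * (x : Cover n F)).mat = 1
    rw [← Subgroup.coe_mul, inv_mul_cancel]
    change diagL (1 : GL (Fin 2) F) = 1
    rw [diagL, X_one, map_one, div_one]
  have hinvR : ∀ x : torus n F, diagR ((x⁻¹ : torus n F) : Cover n F).mat =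
      (diagR (x : Cover n F).mat)⁻¹ := fun x => by
    rw [eq_inv_iff_mul_eq_one, ← diagR_mul (g := ((x⁻¹ : torus n F) : Cover n F).mat)
      (torusMat_le (x⁻¹).2)]
    change diagR (((x⁻¹ : torus n F) : Cover n F) * (x : Cover n F)).mat = 1
    rw [← Subgroup.coe_mul, inv_mul_cancel]
    exact X_one
  have hmulL : ∀ x x' : torus n F, diagL ((x * x' : torus n F) : Cover n F).mat =
      diagL (x : Cover n F).mat * diagL (x' : Cover n F).mat := fun x x' =>
    diagL_mul (torusMat_le x.2) _
  have hmulR : ∀ x x' : torus n F, diagR ((x * x' : torus n F) : Cover n F).mat =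
      diagR (x : Cover n F).mat * diagR (x' : Cover n F).mat := fun x x' =>
    diagR_mul (torusMat_le x.2) _
  have hu : ((aToTorus n F (unitA n F (t, s)) : torus n F) : Cover n F) =
      ⟨dg (unitO t) (unitO s), 1⟩ := unitA_mat (t, s)
  have hz : (z : Cover n F) ∈ centerT n F := by
    refine mem_centerT z.2 ⟨ϖ ^ k, ?_⟩ ⟨ϖ ^ l, ?_⟩
    · rw [hmulL, hmulL, hinvL, hinvL, hu, ← hi]
      simp only [diagT, diagL_dg]
    · rw [hmulR, hmulR, hinvR, hinvR, hu, ← hj]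
      simp only [diagT, diagR_dg]
  refine ⟨i, j, ⟨z, hz⟩, (t, s), ?_⟩
  have e : aToTorus n F (Subgroup.inclusion (centerT_le_groupA n F) ⟨z, hz⟩) = z := rfl
  rw [e]
  simp only [z]
  rw [inv_mul_cancel_right, mul_inv_cancel_left]

end Torus

section TorusBasis

/-- If the `n`-th powers of `U × U` act trivially and `U` is generated by `u` modulo `n`-th powers,
there is a simultaneous eigenvector, whose eigencharacter is given by powers of any character `η` of
`U` such that `η u` has order `n`. -/
theorem exists_eigenvector_of_cyclic {U V : Type*} [CommGroup U] [AddCommGroup V] [Module ℂ V]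
    [Nontrivial V] {n : ℕ} (hn0 : n ≠ 0) (f : U × U →* Module.End ℂ V) (hf : ∀ p, f (p ^ n) = 1)
    (η : U →* ℂˣ) (hη : ∀ x, η x ^ n = 1) (u : U) (hu : orderOf (η u) = n)
    (hgen : ∀ x, ∃ (k : ℤ) (w : U), x = u ^ k * w ^ n) :
    ∃ v : V, v ≠ 0 ∧ ∃ a b : ℕ, ∀ p : U × U, f p v = ((η p.1 ^ a * η p.2 ^ b : ℂˣ) : ℂ) • v := by
  have hprim : IsPrimitiveRoot ((η u : ℂˣ) : ℂ) n :=
    (IsPrimitiveRoot.coe_units_iff).2 (hu ▸ IsPrimitiveRoot.orderOf (η u))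
  obtain ⟨v₀, hv₀⟩ := exists_ne (0 : V)
  have hpow : ∀ p, f p ^ n = 1 := fun p => by rw [← map_pow, hf]
  obtain ⟨v₁, -, hv₁, α, hα, hSv₁⟩ := exists_eigenvector_of_pow_eq_one hn0 (hpow (u, 1))
    (W := ⊤) (fun _ _ => trivial) (v := v₀) trivial hv₀
  obtain ⟨v, hv, hv0, β, hβ, hTv⟩ := exists_eigenvector_of_pow_eq_one hn0 (hpow (1, u))
    (W := Module.End.eigenspace (f (u, 1)) α) (fun w hw => by
      rw [Module.End.mem_eigenspace_iff] at hw ⊢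
      rw [← Module.End.mul_apply, ← map_mul, mul_comm, map_mul, Module.End.mul_apply, hw, map_smul])
    (Module.End.mem_eigenspace_iff.2 hSv₁) hv₁
  rw [Module.End.mem_eigenspace_iff] at hv
  have : NeZero n := ⟨hn0⟩
  obtain ⟨a, -, rfl⟩ := hprim.eq_pow_of_pow_eq_one hα
  obtain ⟨b, -, rfl⟩ := hprim.eq_pow_of_pow_eq_one hβ
  have hgen' : ∀ x, ∃ (k : ℕ) (w : U), x = u ^ k * w ^ n := by
    intro x
    obtain ⟨k, w, rfl⟩ := hgen x
    obtain ⟨k', hk'⟩ := Int.eq_ofNat_of_zero_le (Int.emod_nonneg k (Int.natCast_ne_zero.2 hn0))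
    refine ⟨k', u ^ (k / n) * w, ?_⟩
    rw [mul_pow, ← mul_assoc, ← zpow_natCast u, ← hk', ← zpow_natCast (u ^ (k / n)), ← zpow_mul,
      ← zpow_add, mul_comm (k / n), Int.emod_add_mul_ediv]
  have hk : ∀ (g : U × U) (c : ℂ), f g v = c • v → ∀ (k : ℕ) (w : U × U),
      f (g ^ k * w ^ n) v = c ^ k • v := by
    intro g c hg k w
    rw [map_mul, hf, mul_one]
    induction k with
    | zero => simp
    | succ k ih =>
      rw [pow_succ', map_mul, Module.End.mul_apply, ih, map_smul, hg, smul_smul, pow_succ]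
  have hηx : ∀ (k : ℕ) (w : U), η (u ^ k * w ^ n) = η u ^ k := fun k w => by
    rw [map_mul, map_pow, map_pow, hη, mul_one]
  have h1 : ∀ x, f (x, 1) v = ((η x ^ a : ℂˣ) : ℂ) • v := by
    intro x
    obtain ⟨k, w, rfl⟩ := hgen' x
    have h := hk (u, 1) _ hv k (w, 1)
    rw [Prod.pow_mk, Prod.pow_mk, one_pow, one_pow, Prod.mk_mul_mk, mul_one] at h
    rw [h, hηx]
    push_cast
    rw [← pow_mul, ← pow_mul, mul_comm]
  have h2 : ∀ x, f (1, x) v = ((η x ^ b : ℂˣ) : ℂ) • v := by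
    intro x
    obtain ⟨k, w, rfl⟩ := hgen' x
    have h := hk (1, u) _ hTv k (1, w)
    rw [Prod.pow_mk, Prod.pow_mk, one_pow, one_pow, Prod.mk_mul_mk, mul_one] at h
    rw [h, hηx]
    push_cast
    rw [← pow_mul, ← pow_mul, mul_comm]
  refine ⟨v, hv0, a, b, fun p => ?_⟩
  have e : p = (p.1, 1) * (1, p.2) := by simp
  conv_lhs => rw [e, map_mul, Module.End.mul_apply, h2, map_smul, h1, smul_smul]
  rw [Units.val_mul, mul_comm]

variable {n : ℕ} {F : Type*} [Field F] [ValuativeRel F] [TopologicalSpace F]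
  [IsNonarchimedeanLocalField F] [hn : Fact (n ∣ Nat.card 𝓀[F] - 1)]
  {V : Type*} [AddCommGroup V] [Module ℂ V] {ρ' : Representation ℂ (torus n F) V}
  {ε : rootsOfUnity n 𝓀[F] →* ℂˣ} {χ' : centerT n F →* ℂˣ} {χ₀ : groupA n F →* ℂˣ} {ϖ : Fˣ}

theorem apply_incl_eq [Nontrivial V]
    (hgen : ∀ (z : rootsOfUnity n 𝓀[F]) (v : V),
      ρ' ⟨Cover.incl n z, (incl_mem_groupA n z).1⟩ v = (ε z : ℂ) • v)
    (hχ' : ∀ (z : centerT n F) (v : V), ρ' ⟨z, z.2.1⟩ v = (χ' z : ℂ) • v)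
    (hχ₀ : ∀ z, χ₀ (Subgroup.inclusion (centerT_le_groupA n F) z) = χ' z)
    (ζ : rootsOfUnity n 𝓀[F]) : χ₀ ⟨Cover.incl n ζ, incl_mem_groupA n ζ⟩ = ε ζ := by
  obtain ⟨v, hv⟩ := exists_ne (0 : V)
  have hz : Cover.incl n ζ ∈ centerT n F := ⟨(incl_mem_groupA n ζ).1,
    Subgroup.mem_centralizer_iff.2 fun y _ => (Cover.commute_incl n y ζ).eq.symm⟩
  have h1 := hχ' ⟨_, hz⟩ v
  have h2 := hgen ζ v
  have h3 := hχ₀ ⟨_, hz⟩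
  change χ₀ ⟨Cover.incl n ζ, incl_mem_groupA n ζ⟩ = _ at h3
  rw [h3]
  exact Units.ext (smul_left_injective ℂ hv (h1.symm.trans h2))

theorem borelKToA_eq (b : borelK n F) : ∃ p : (𝒪[F])ˣ × (𝒪[F])ˣ, borelKToA n b =
    unitA n F p * ⟨Cover.incl n (b : maxK n F).1.root, incl_mem_groupA n _⟩ := by
  have hv := val_diag_of_mem (g := (b : maxK n F).1.mat) b.1.2 b.2
  obtain ⟨t, ht⟩ := exists_unitO hv.1
  obtain ⟨s, hs⟩ := exists_unitO hv.2
  refine ⟨(t, s), Subtype.ext ?_⟩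
  change _ = ((unitA n F (t, s) : groupA n F) : Cover n F) * Cover.incl n _
  rw [unitA_mat, Cover.mul_incl]
  refine Cover.ext ?_ (one_mul _).symm
  change dg _ _ = dg _ _
  rw [ht, hs]

/-- As a representation of `T̃ ∩ K̃`, the irreducible representation `ρ'` of dimension `n²` is the
direct sum of the characters `χ'_{i,j}`. The torus is generated modulo its centre by units and
powers of `ϖ`; a simultaneous eigenvector `v` of the units exists, and conjugation by
`dg(ϖ^c, ϖ^d)` changes its eigencharacter by powers of `(ϖ, ·)_n`. -/
theorem exists_basis (hn0 : n ≠ 0) (hϖ : val ϖ = 1) (hε : Function.Injective ε)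
    (hirr : ρ'.IsIrreducible)
    (hgen : ∀ (z : rootsOfUnity n 𝓀[F]) (v : V),
      ρ' ⟨Cover.incl n z, (incl_mem_groupA n z).1⟩ v = (ε z : ℂ) • v)
    (hχ' : ∀ (z : centerT n F) (v : V), ρ' ⟨z, z.2.1⟩ v = (χ' z : ℂ) • v)
    (hχ₀ : ∀ z, χ₀ (Subgroup.inclusion (centerT_le_groupA n F) z) = χ' z)
    (hε₀ : ∀ ζ, χ₀ ⟨Cover.incl n ζ, incl_mem_groupA n ζ⟩ = ε ζ) [Nontrivial V] :
    ∃ e : Module.Basis (Fin n × Fin n) ℂ V, ∀ (b : borelK n F) (p : Fin n × Fin n),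
      ρ' (borelToTorus n ⟨b.1.1, b.2⟩) (e p) =
        (borelChar n (chi n ϖ χ₀ p.1 p.2) b : ℂ) • e p := by
  obtain ⟨u, hu, hU⟩ := exists_orderOf_varpiChar (n := n) (F := F) hn0 hϖ
  let η : (𝒪[F])ˣ →* ℂˣ := ε.comp ((varpiChar n ϖ).comp unitO)
  have hηu : orderOf (η u) = n := (orderOf_injective ε hε _).trans hu
  have hη : ∀ x, η x ^ n = 1 := fun x => varpiChar_pow_eq_one (unitO x)
  let D : (𝒪[F])ˣ × (𝒪[F])ˣ →* Module.End ℂ V := ρ'.comp ((aToTorus n F).comp (unitA n F))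
  let f : (𝒪[F])ˣ × (𝒪[F])ˣ →* Module.End ℂ V :=
    { toFun := fun p => ((χ₀ (unitA n F p))⁻¹ : ℂˣ) • D p
      map_one' := by rw [map_one, map_one, map_one, inv_one, one_smul]
      map_mul' := fun p q => by
        rw [map_mul, map_mul, map_mul, mul_inv, smul_mul_smul_comm] }
  have hf : ∀ p, f (p ^ n) = 1 := by
    intro p
    have hz : ((unitA n F (p ^ n) : groupA n F) : Cover n F) ∈ centerT n F := by
      refine mem_centerT (unitA n F (p ^ n)).2.1 ⟨unitO p.1, ?_⟩ ⟨unitO p.2, ?_⟩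
      · rw [unitA_mat, diagL_dg, ← map_pow]; rfl
      · rw [unitA_mat, diagR_dg, ← map_pow]; rfl
    ext v
    change ((χ₀ (unitA n F (p ^ n)))⁻¹ : ℂˣ) • ρ' _ v = v
    have h1 := hχ' ⟨_, hz⟩ v
    have h2 : χ₀ (unitA n F (p ^ n)) = χ' ⟨_, hz⟩ := hχ₀ ⟨_, hz⟩
    rw [h2, inv_smul_eq_iff]
    exact h1
  obtain ⟨v, hv0, a, b, hv⟩ := exists_eigenvector_of_cyclic hn0 f hf η hη u hηu hU
  have hDv : ∀ p, D p v = ((χ₀ (unitA n F p) * (η p.1 ^ a * η p.2 ^ b) : ℂˣ) : ℂ) • v := by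
    intro p
    have h : ((χ₀ (unitA n F p))⁻¹ : ℂˣ) • D p v = _ := hv p
    rw [inv_smul_eq_iff] at h
    rw [h, Units.smul_def, smul_smul, ← Units.val_mul]
  have hincl : ∀ (ζ : rootsOfUnity n 𝓀[F]) (w : V),
    ρ' (aToTorus n F ⟨Cover.incl n ζ, incl_mem_groupA n ζ⟩) w = (ε ζ : ℂ) • w := hgen
  -- The shifts by `b` and `a` cancel the eigencharacter `η^a η^b` of `v` relative to `χ₀`.
  let w : Fin n × Fin n → V := fun p =>
    ρ' (diagT n (ϖ ^ ((p.1 : ℕ) + b)) (ϖ ^ ((p.2 : ℕ) + a))) v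
  have hchi : ∀ (i j : ℕ) (p : (𝒪[F])ˣ × (𝒪[F])ˣ), chi n ϖ χ₀ i j (unitA n F p) =
      χ₀ (unitA n F p) * ((η p.1)⁻¹ ^ j * (η p.2)⁻¹ ^ i) := by
    intro i j p
    rw [chi_apply hε₀, unitA_mat, diagL_dg, diagR_dg]
    rfl
  have hDw : ∀ p q, D p (w q) = (chi n ϖ χ₀ q.1 q.2 (unitA n F p) : ℂ) • w q := by
    intro p q
    change ρ' _ (ρ' _ v) = _ • ρ' _ v
    rw [← Module.End.mul_apply, ← map_mul]
    have h := unitA_mul_diagT (n := n) ϖ p ((q.1 : ℕ) + b) ((q.2 : ℕ) + a)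
    change ρ' (aToTorus n F (unitA n F p) * _) v = _
    rw [h, map_mul, Module.End.mul_apply, map_mul, map_mul, Module.End.mul_apply, hincl, map_smul]
    have h' : ρ' (aToTorus n F (unitA n F p)) v = D p v := rfl
    rw [h', hDv, smul_smul, map_smul]
    congr 1
    rw [← Units.val_mul, hchi]
    congr 1
    rw [map_mul, map_pow, map_pow, map_inv, map_inv]
    change (η p.1)⁻¹ ^ _ * (η p.2)⁻¹ ^ _ * _ = _
    rw [pow_add, pow_add]
    calc _ = χ₀ (unitA n F p) * ((η p.1)⁻¹ ^ (q.2 : ℕ) * (η p.2)⁻¹ ^ (q.1 : ℕ)) *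
          (((η p.1)⁻¹ ^ a * η p.1 ^ a) * ((η p.2)⁻¹ ^ b * η p.2 ^ b)) := by ac_rfl
      _ = _ := by
        rw [← mul_pow, ← mul_pow, inv_mul_cancel, inv_mul_cancel, one_pow, one_pow, mul_one,
          mul_one]
  have hw0 : ∀ q, w q ≠ 0 := by
    intro q h
    apply hv0
    have h1 := congrArg (ρ' (diagT n (ϖ ^ ((q.1 : ℕ) + b)) (ϖ ^ ((q.2 : ℕ) + a)))⁻¹) h
    rw [map_zero] at h1
    rw [← h1]
    change v = ρ' _ (ρ' _ v)
    rw [← Module.End.mul_apply, ← map_mul, inv_mul_cancel, map_one, Module.End.one_apply]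
  have hpinj : ∀ i j : Fin n, (η u)⁻¹ ^ (i : ℕ) = (η u)⁻¹ ^ (j : ℕ) → i = j := by
    intro i j h
    rw [inv_pow, inv_pow, inv_inj] at h
    refine Fin.ext (pow_injOn_Iio_orderOf ?_ ?_ h)
    · rw [hηu]; exact i.2
    · rw [hηu]; exact j.2
  have hchar : ∀ q q' : Fin n × Fin n, (∀ p : (𝒪[F])ˣ × (𝒪[F])ˣ,
      χ₀ (unitA n F p) * ((η p.1)⁻¹ ^ (q.2 : ℕ) * (η p.2)⁻¹ ^ (q.1 : ℕ)) =
        χ₀ (unitA n F p) * ((η p.1)⁻¹ ^ (q'.2 : ℕ) * (η p.2)⁻¹ ^ (q'.1 : ℕ))) → q = q' := by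
    intro q q' h
    refine Prod.ext (hpinj _ _ ?_) (hpinj _ _ ?_)
    · have h1 := mul_left_cancel (h (1, u))
      rwa [map_one, inv_one, one_pow, one_pow, one_mul, one_mul] at h1
    · have h1 := mul_left_cancel (h (u, 1))
      rwa [map_one, inv_one, one_pow, one_pow, mul_one, mul_one] at h1
  have hli : LinearIndependent ℂ w := by
    have hinj : Function.Injective
        (fun q : Fin n × Fin n => (chi n ϖ χ₀ q.1 q.2).comp (unitA n F)) := by
      intro q q' h
      have h' : ∀ p, (χ₀ (unitA n F p) * ((η p.1)⁻¹ ^ (q.2 : ℕ) * (η p.2)⁻¹ ^ (q.1 : ℕ)) : ℂˣ) =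
          χ₀ (unitA n F p) * ((η p.1)⁻¹ ^ (q'.2 : ℕ) * (η p.2)⁻¹ ^ (q'.1 : ℕ)) := by
        intro p
        rw [← hchi, ← hchi]
        exact DFunLike.congr_fun h p
      exact hchar q q' h'
    exact linearIndependent_of_characters (fun p => D p) _ hinj w (fun q p => hDw p q) hw0
  have hstab : ∀ (y : torus n F) (x : V), x ∈ Submodule.span ℂ (Set.range w) →
      ρ' y x ∈ Submodule.span ℂ (Set.range w) := by
    intro y x hx
    induction hx using Submodule.span_induction with
    | mem x hx =>
      obtain ⟨q, rfl⟩ := hx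
      change ρ' y (ρ' _ v) ∈ _
      rw [← Module.End.mul_apply, ← map_mul]
      obtain ⟨i, j, z, p, h⟩ := exists_torus_eq hn0 hϖ a b
        (y * diagT n (ϖ ^ ((q.1 : ℕ) + b)) (ϖ ^ ((q.2 : ℕ) + a)))
      have hz : ∀ x, ρ' (aToTorus n F (Subgroup.inclusion (centerT_le_groupA n F) z)) x =
        (χ' z : ℂ) • x := hχ' z
      have h' : ρ' (aToTorus n F (unitA n F p)) v = D p v := rfl
      rw [h, map_mul, Module.End.mul_apply, map_mul, Module.End.mul_apply, hz, h', hDv, smul_smul,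
        map_smul]
      exact Submodule.smul_mem _ _ (Submodule.subset_span ⟨(i, j), rfl⟩)
    | zero => rw [map_zero]; exact Submodule.zero_mem _
    | add x x' _ _ hx hx' => rw [map_add]; exact Submodule.add_mem _ hx hx'
    | smul c x _ hx => rw [map_smul]; exact Submodule.smul_mem _ c hx
  have hspan : ⊤ ≤ Submodule.span ℂ (Set.range w) := by
    let W : Subrepresentation ρ' := ⟨Submodule.span ℂ (Set.range w), fun g {x} hx => hstab g x hx⟩
    have hn1 : 0 < n := Nat.pos_of_ne_zero hn0
    have hmem : w (⟨0, hn1⟩, ⟨0, hn1⟩) ∈ W := Submodule.subset_span ⟨_, rfl⟩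
    have hW : W = ⊤ := by
      rcases eq_bot_or_eq_top W with h | h
      · exact absurd (by rw [h] at hmem; exact hmem) (hw0 (⟨0, hn1⟩, ⟨0, hn1⟩))
      · exact h
    intro x _
    have : x ∈ (⊤ : Subrepresentation ρ') := trivial
    rw [← hW] at this
    exact this
  refine ⟨Module.Basis.mk hli hspan, fun c p => ?_⟩
  rw [Module.Basis.mk_apply]
  obtain ⟨x, hx⟩ := borelKToA_eq c
  change ρ' (aToTorus n F (borelKToA n c)) (w p) =
    ((chi n ϖ χ₀ p.1 p.2 (borelKToA n c) : ℂˣ) : ℂ) • w p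
  have h' : ρ' (aToTorus n F (unitA n F x)) (w p) = D x (w p) := rfl
  have hchi1 : ∀ ζ, chi n ϖ χ₀ p.1 p.2 ⟨Cover.incl n ζ, incl_mem_groupA n ζ⟩ = ε ζ := by
    intro ζ
    have e1 : diagL (Cover.incl (F := F) n ζ).mat = 1 := by
      change diagL (1 : GL (Fin 2) F) = 1
      rw [diagL, X_one, map_one, div_one]
    have e2 : diagR (Cover.incl (F := F) n ζ).mat = 1 := X_one
    rw [chi_apply hε₀, hε₀]
    simp only [e1, e2, map_one, inv_one, one_pow, mul_one]
  rw [hx, map_mul, map_mul, Module.End.mul_apply, hincl, map_smul, h', hDw, map_mul, hchi1,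
    smul_smul, Units.val_mul, mul_comm]

end TorusBasis

/-! ### Restriction of the principal series to the maximal compact subgroup -/

section Restriction

variable {n : ℕ} {F : Type*} [Field F] [ValuativeRel F] [TopologicalSpace F]
  [IsNonarchimedeanLocalField F] [hn : Fact (n ∣ Nat.card 𝓀[F] - 1)]
  {V : Type*} [AddCommGroup V] [Module ℂ V] {ρ' : Representation ℂ (torus n F) V}

/-- The Iwasawa decomposition. -/
theorem exists_iwasawa (g : Cover n F) : ∃ (b : borel n F) (k : maxK n F), g = b * k := by
  suffices h : ∃ k : maxK n F, (g * k).mat.val 1 0 = 0 by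
    obtain ⟨k, hk⟩ := h
    exact ⟨⟨g * k, hk⟩, k⁻¹, by rw [Subgroup.coe_inv, mul_inv_cancel_right]⟩
  have key : ∀ (h : GL (Fin 2) F) (hh : h ∈ maxCompact F),
      g.mat.val 1 0 * h.val 0 0 + g.mat.val 1 1 * h.val 1 0 = 0 →
        ∃ k : maxK n F, (g * k).mat.val 1 0 = 0 := fun h hh e =>
    ⟨liftK n h hh, (mul_apply_one_zero g.mat h).trans e⟩
  let v := ValuativeRel.valuation F
  by_cases hc : g.mat.val 1 0 = 0
  · exact key 1 (one_mem _) (by rw [hc]; simp)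
  rcases le_total (v (g.mat.val 1 1)) (v (g.mat.val 1 0)) with h | h
  · have hz : v (g.mat.val 1 1 / g.mat.val 1 0) ≤ 1 := by
      rw [map_div₀]
      exact div_le_one_of_le₀ h zero_le
    let z : 𝒪[F] := ⟨_, hz⟩
    -- The first column `(-d/c, 1)` is orthogonal to the bottom row `(c, d)`.
    have hM : IsUnit (!![-z, 1; 1, 0] : Matrix (Fin 2) (Fin 2) 𝒪[F]).det := by
      rw [Matrix.det_fin_two_of]; simp
    refine key (Matrix.GeneralLinearGroup.map (𝒪[F]).subtype
      (Matrix.GeneralLinearGroup.mk'' _ hM)) ⟨_, rfl⟩ ?_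
    change g.mat.val 1 0 * (-(g.mat.val 1 1 / g.mat.val 1 0)) + g.mat.val 1 1 * 1 = 0
    field_simp
    ring
  · have hd : g.mat.val 1 1 ≠ 0 := by
      intro h0
      rw [h0, map_zero, le_zero_iff, map_eq_zero] at h
      exact hc h
    have hz : v (-(g.mat.val 1 0 / g.mat.val 1 1)) ≤ 1 := by
      rw [Valuation.map_neg, map_div₀]
      exact div_le_one_of_le₀ h zero_le
    refine key (lt ((⟨_, hz⟩ : 𝒪[F]) : F)) (lt_mem_maxCompact _) ?_
    change g.mat.val 1 0 * 1 + g.mat.val 1 1 * (-(g.mat.val 1 0 / g.mat.val 1 1)) = 0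
    field_simp
    ring

/-- A function on `K̃` with the equivariance of the principal series under `B̃ ∩ K̃` extends to
`G̃`. -/
theorem exists_extension (f : maxK n F → V)
    (hf : ∀ (b : borelK n F) x, f (b * x) = ρ' (borelToTorus n ⟨b.1.1, b.2⟩) (f x)) :
    ∃ φ : Cover n F → V, ∀ (b : borel n F) (k : maxK n F),
      φ (b * k) = ρ' (borelToTorus n b) (f k) := by
  choose β κ h using exists_iwasawa (n := n) (F := F)
  refine ⟨fun g => ρ' (borelToTorus n (β g)) (f (κ g)), fun b k => ?_⟩
  have hg := h (b * k)
  change ρ' (borelToTorus n (β (b * k))) (f (κ (b * k))) = _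
  generalize β (b * k) = b' at hg ⊢
  generalize κ (b * k) = k' at hg ⊢
  let c : maxK n F := k' * k⁻¹
  have e : (c : Cover n F) = ((b' : Cover n F))⁻¹ * b := by
    change (k' : Cover n F) * (k : Cover n F)⁻¹ = _
    rw [mul_inv_eq_iff_eq_mul, mul_assoc, hg, inv_mul_cancel_left]
  have hc : c ∈ borelK n F := by
    change (c : Cover n F) ∈ borel n F
    rw [e]
    exact mul_mem (inv_mem b'.2) b.2
  have hk : k' = c * k := (inv_mul_cancel_right _ _).symm
  have hb : b = b' * ⟨c, hc⟩ := Subtype.ext (by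
    change (b : Cover n F) = b' * (c : Cover n F)
    rw [e, mul_inv_cancel_left])
  rw [hk, hf ⟨c, hc⟩ k, hb, map_mul, map_mul]
  rfl

theorem coord_apply {ι : Type*} {e : Module.Basis ι ℂ V} {χ : ι → groupA n F →* ℂˣ}
    (he : ∀ (b : borelK n F) (p : ι), ρ' (borelToTorus n ⟨b.1.1, b.2⟩) (e p) =
      (borelChar n (χ p) b : ℂ) • e p) (b : borelK n F) (p : ι) (v : V) :
    e.coord p (ρ' (borelToTorus n ⟨b.1.1, b.2⟩) v) = (borelChar n (χ p) b : ℂ) * e.coord p v := by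
  classical
  have h : e.coord p ∘ₗ ρ' (borelToTorus n ⟨b.1.1, b.2⟩) =
      (borelChar n (χ p) b : ℂ) • e.coord p := by
    refine e.ext fun q => ?_
    rw [LinearMap.comp_apply, he, map_smul, LinearMap.smul_apply, Module.Basis.coord_apply,
      Module.Basis.repr_self]
    by_cases hq : q = p
    · rw [hq]
    · rw [Finsupp.single_eq_of_ne (Ne.symm hq), smul_zero, smul_zero]
  exact LinearMap.congr_fun h v

/-- The components, with respect to a basis of eigenvectors of `T̃ ∩ K̃`, of the restriction to `K̃`
of a function in the principal series. -/
noncomputable def components {ι : Type*} {e : Module.Basis ι ℂ V} {χ : ι → groupA n F →* ℂˣ}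
    (he : ∀ (b : borelK n F) (p : ι), ρ' (borelToTorus n ⟨b.1.1, b.2⟩) (e p) =
      (borelChar n (χ p) b : ℂ) • e p) (p : ι) :
    SmoothIndSpace (MonoidHom.id (Cover n F)) (borel n F) (ρ'.comp (borelToTorus n)) →ₗ[ℂ]
      IndKSpace n (χ p) where
  toFun w := ⟨⟨fun k => e.coord p (w.1.1 k), fun b k => by
      have h := smoothInd_apply_mul w ⟨b.1.1, b.2⟩ (k : Cover n F)
      change e.coord p (w.1.1 (b.1.1 * k)) = _
      exact (congrArg (e.coord p) h).trans (coord_apply he b p _)⟩, by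
    obtain ⟨l, hl, h⟩ := w.2
    refine ⟨l, hl, fun k hk => Subtype.ext (funext fun x => ?_)⟩
    have h1 := congrArg (fun u => u.1 (x : Cover n F)) (h (k : Cover n F) hk)
    exact congrArg (e.coord p) h1⟩
  map_add' w w' := Subtype.ext (Subtype.ext (funext fun k => map_add (e.coord p) _ _))
  map_smul' c w := Subtype.ext (Subtype.ext (funext fun k => map_smul (e.coord p) _ _))

theorem components_apply {ι : Type*} {e : Module.Basis ι ℂ V} {χ : ι → groupA n F →* ℂˣ}
    (he : ∀ (b : borelK n F) (p : ι), ρ' (borelToTorus n ⟨b.1.1, b.2⟩) (e p) =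
      (borelChar n (χ p) b : ℂ) • e p) (p : ι)
    (w : SmoothIndSpace (MonoidHom.id (Cover n F)) (borel n F) (ρ'.comp (borelToTorus n)))
    (k : maxK n F) : (components he p w).1.1 k = e.coord p (w.1.1 (k : Cover n F)) := rfl

theorem components_injective {ι : Type*} {e : Module.Basis ι ℂ V}
    {χ : ι → groupA n F →* ℂˣ}
    (he : ∀ (b : borelK n F) (p : ι), ρ' (borelToTorus n ⟨b.1.1, b.2⟩) (e p) =
      (borelChar n (χ p) b : ℂ) • e p) {w} (hw : ∀ p, components he p w = 0) : w = 0 := by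
  refine Subtype.ext (Subtype.ext (funext fun g => ?_))
  obtain ⟨b, k, rfl⟩ := exists_iwasawa g
  rw [smoothInd_apply_mul w b]
  have h0 : w.1.1 (k : Cover n F) = 0 := by
    rw [← e.forall_coord_eq_zero_iff]
    intro p
    rw [← components_apply he, hw]
    rfl
  rw [h0, map_zero]
  rfl

theorem components_surjective {ι : Type*} [Fintype ι] {e : Module.Basis ι ℂ V}
    {χ : ι → groupA n F →* ℂˣ}
    (he : ∀ (b : borelK n F) (p : ι), ρ' (borelToTorus n ⟨b.1.1, b.2⟩) (e p) =
      (borelChar n (χ p) b : ℂ) • e p) (u : ∀ p, IndKSpace n (χ p)) :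
    ∃ w, ∀ p, components he p w = u p := by
  classical
  let f : maxK n F → V := fun k => ∑ p, (u p).1.1 k • e p
  obtain ⟨φ, hφ⟩ := exists_extension (ρ' := ρ') f fun b x => by
    simp only [f, map_sum, map_smul, he, smul_smul]
    exact Finset.sum_congr rfl fun p _ => by rw [indK_apply_mul, mul_comm]
  have hφK : ∀ k : maxK n F, φ k = f k := fun k => by
    have h := hφ 1 k
    rwa [Subgroup.coe_one, one_mul, map_one, map_one] at h
  choose l hl hlu using fun p => (u p).2
  let L := 1 + ∑ p, l p
  have hL : ∀ p, l p ≤ L := fun p =>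
    (Finset.single_le_sum (fun _ _ => Nat.zero_le _) (Finset.mem_univ p)).trans
      (Nat.le_add_left _ _)
  have hmul : ∀ (b : borel n F) (g : Cover n F), φ (b * g) = ρ' (borelToTorus n b) (φ g) := by
    intro b g
    obtain ⟨c, k, rfl⟩ := exists_iwasawa g
    rw [← mul_assoc, ← Subgroup.coe_mul, hφ, hφ, map_mul, map_mul, Module.End.mul_apply]
  refine ⟨⟨⟨φ, hmul⟩, L, Nat.le_add_right 1 _, fun x hx => ?_⟩, fun p => ?_⟩
  · refine Subtype.ext (funext fun g => ?_)
    change φ (g * x) = φ g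
    obtain ⟨b, k, rfl⟩ := exists_iwasawa g
    have hxK : x ∈ maxK n F := congruence_le L hx.1
    have hux : ∀ p, (u p).1.1 (k * ⟨x, hxK⟩) = (u p).1.1 k := fun p =>
      congrArg (fun w => w.1 k)
        (hlu p ⟨x, hxK⟩ ⟨congruence_anti (hl p) (hL p) hx.1, hx.2⟩)
    have hf : f (k * ⟨x, hxK⟩) = f k := Finset.sum_congr rfl fun p _ => by rw [hux]
    have e : (b : Cover n F) * k * x = b * ((k * ⟨x, hxK⟩ : maxK n F) : Cover n F) :=
      mul_assoc _ _ _
    rw [e, hφ, hφ, hf]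
  · refine Subtype.ext (Subtype.ext (funext fun k => ?_))
    change e.coord p (φ k) = _
    rw [hφK, Module.Basis.coord_apply, Module.Basis.repr_sum_self]

/-- The restriction of the principal series to `K̃` is the direct sum of the representations induced
from the characters by which `T̃ ∩ K̃` acts on a basis of `ρ'`. -/
theorem nonempty_equiv_directSum (hn0 : n ≠ 0) {ι : Type*} [Fintype ι] {e : Module.Basis ι ℂ V}
    {χ : ι → groupA n F →* ℂˣ}
    (he : ∀ (b : borelK n F) (p : ι), ρ' (borelToTorus n ⟨b.1.1, b.2⟩) (e p) =
      (borelChar n (χ p) b : ℂ) • e p) (m : ℕ) (hm : 1 ≤ m) :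
    Nonempty (Representation.Equiv ((principalSeries n ρ').comp (maxK n F).subtype)
      (Representation.directSum fun p => gradedRep (indK n (χ p)) m hm)) := by
  classical
  have hsm : ∀ (p : ι) (w : IndKSpace n (χ p)), ∃ l, ∃ hl : 1 ≤ l,
      w ∈ fixedVectors (indK n (χ p)) l hl := fun p w => by
    obtain ⟨l, hl, h⟩ := w.2
    exact ⟨l, hl, fun x hx => Subtype.ext (h x hx)⟩
  let G := fun p => (nonempty_equiv_gradedRep (indK n (χ p)) hn0 (hsm p) m hm).some.symm
  let Ψ : SmoothIndSpace (MonoidHom.id (Cover n F)) (borel n F) (ρ'.comp (borelToTorus n)) →ₗ[ℂ]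
      ⨁ p, GradedSpace (indK n (χ p)) m hm :=
    (DirectSum.linearEquivFunOnFintype ℂ ι fun p =>
      GradedSpace (indK n (χ p)) m hm).symm.toLinearMap ∘ₗ
      LinearMap.pi fun p => (G p).toLinearEquiv.toLinearMap ∘ₗ components he p
  have hΨ : ∀ w p, Ψ w p = G p (components he p w) := fun w p => congrFun
    ((DirectSum.linearEquivFunOnFintype ℂ ι fun p =>
      GradedSpace (indK n (χ p)) m hm).apply_symm_apply (fun p => G p (components he p w))) p
  have hinj : Function.Injective Ψ := by
    rw [injective_iff_map_eq_zero]
    intro w hw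
    refine components_injective he fun p => (G p).toLinearEquiv.injective ?_
    have h := hΨ w p
    rw [hw] at h
    exact h.symm.trans (map_zero (G p).toLinearEquiv).symm
  have hsurj : Function.Surjective Ψ := by
    intro y
    obtain ⟨w, hw⟩ := components_surjective he fun p => (G p).toLinearEquiv.symm (y p)
    refine ⟨w, DFinsupp.ext fun p => ?_⟩
    rw [hΨ, hw]
    exact (G p).toLinearEquiv.apply_symm_apply _
  refine ⟨Representation.Equiv.mk (LinearEquiv.ofBijective Ψ ⟨hinj, hsurj⟩) fun k => ?_⟩
  refine LinearMap.ext fun w => DFinsupp.ext fun p => ?_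
  change Ψ (principalSeries n ρ' k w) p =
    (DirectSum.lmap fun p => gradedRep (indK n (χ p)) m hm k) (Ψ w) p
  rw [DirectSum.lmap_apply, hΨ, hΨ]
  have h1 : components he p (principalSeries n ρ' k w) = indK n (χ p) k (components he p w) := rfl
  rw [h1]
  exact (G p).toIntertwiningMap.isIntertwining _ _ k _

end Restriction

/-! ### The reducibility condition at the level of the central character -/

section Reducibility

variable {n : ℕ} {F : Type*} [Field F] [ValuativeRel F] [TopologicalSpace F]
  [IsNonarchimedeanLocalField F] [hn : Fact (n ∣ Nat.card 𝓀[F] - 1)]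
  {ε : rootsOfUnity n 𝓀[F] →* ℂˣ} {χ₀ : groupA n F →* ℂˣ} {ϖ : Fˣ}

/-- The condition `χ'_{0,0}(dg(a, a⁻¹), 1) = ε(ϖ(a))^k` on units `a` of `F`, in terms of units of
the ring of integers. -/
theorem forall_unitDiag_iff (hε₀ : ∀ ζ, χ₀ ⟨Cover.incl n ζ, incl_mem_groupA n ζ⟩ = ε ζ) (k : ℕ) :
    (∀ (a : Fˣ) (ha : val a = 0), chi n ϖ χ₀ 0 0 (unitDiag n a a⁻¹ ha
      (by rw [val_inv, ha, neg_zero])) = ε (varpiChar n ϖ a) ^ k) ↔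
    ∀ u : (𝒪[F])ˣ, χ₀ (borelKToA n (diagK n u u⁻¹)) = ε (varpiChar n ϖ (unitO u)) ^ k := by
  have hchi : ∀ x, chi n ϖ χ₀ 0 0 x = χ₀ x := fun x => by
    rw [chi_apply hε₀, pow_zero, pow_zero, mul_one, mul_one]
  constructor
  · intro h u
    have h1 := h (unitO u) (val_unitO u)
    rwa [hchi, unitDiag_inv_eq] at h1
  · intro h a ha
    obtain ⟨u, rfl⟩ := exists_unitO ha
    rw [hchi, unitDiag_inv_eq]
    exact h u

theorem ncard_modEq (hn0 : n ≠ 0) (k : ℕ) :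
    {p : Fin n × Fin n | (p.2 : ℕ) ≡ p.1 + k [MOD n]}.ncard = n := by
  have hpos : 0 < n := Nat.pos_of_ne_zero hn0
  let s : Fin n → Fin n := fun i => ⟨(i + k) % n, Nat.mod_lt _ hpos⟩
  have e : {p : Fin n × Fin n | (p.2 : ℕ) ≡ p.1 + k [MOD n]} = Set.range fun i => (i, s i) := by
    ext ⟨i, j⟩
    constructor
    · intro h
      have h' : (j : ℕ) ≡ i + k [MOD n] := h
      refine ⟨i, Prod.ext rfl (Fin.ext ?_)⟩
      change (i + k) % n = (j : ℕ)
      rw [← h', Nat.mod_eq_of_lt j.2]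
    · rintro ⟨i', h⟩
      obtain ⟨rfl, rfl⟩ := Prod.ext_iff.1 h
      exact Nat.mod_modEq _ _
  rw [e, Set.ncard_range_of_injective fun i j h => congrArg Prod.fst h, Nat.card_fin]

end Reducibility

end CoverGL2

theorem mainTheorem6 {F : Type*} [Field F] [ValuativeRel F] [TopologicalSpace F]
    [IsNonarchimedeanLocalField F] (n : ℕ) (hn : 2 ≤ n) [Fact (n ∣ Nat.card 𝓀[F] - 1)]
    (ϖ : Fˣ) (hϖ : CoverGL2.val ϖ = 1)
    (ε : rootsOfUnity n 𝓀[F] →* ℂˣ) (hε : Function.Injective ε)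
    {V : Type*} [AddCommGroup V] [Module ℂ V]
    (ρ' : Representation ℂ (CoverGL2.torus n F) V)
    (hirr : ρ'.IsIrreducible)
    (hsmooth : ∀ v, v ∈ CoverGL2.smoothVectors (CoverGL2.torus n F).subtype ρ')
    (hgen : ∀ (z : rootsOfUnity n 𝓀[F]) (v : V),
      ρ' ⟨CoverGL2.Cover.incl n z, (CoverGL2.incl_mem_groupA n z).1⟩ v = (ε z : ℂ) • v)
    (χ' : CoverGL2.centerT n F →* ℂˣ)
    (hχ' : ∀ (z : CoverGL2.centerT n F) (v : V), ρ' ⟨z, z.2.1⟩ v = (χ' z : ℂ) • v)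
    (χ₀ : CoverGL2.groupA n F →* ℂˣ)
    (hχ₀ : ∀ z, χ₀ (Subgroup.inclusion (CoverGL2.centerT_le_groupA n F) z) = χ' z)
    (m : ℕ) (hm : CoverGL2.IsPrimitiveMod n χ' m) :
    Nonempty (Representation.Equiv
      ((CoverGL2.principalSeries n ρ').comp (CoverGL2.maxK n F).subtype)
      (Representation.directSum (fun p : Fin n × Fin n =>
        CoverGL2.gradedRep (CoverGL2.indK n (CoverGL2.chi n ϖ χ₀ p.1 p.2)) m hm.1.1))) ∧
    (∀ (i j : Fin n) (l : ℕ) (hl : m < l),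
      (CoverGL2.levelQuotient (CoverGL2.indK n (CoverGL2.chi n ϖ χ₀ i j)) l
        (lt_of_le_of_lt hm.1.1 hl)).IsIrreducible) ∧
    (CoverGL2.IsPrimitiveMod n
        (χ'.comp (Subgroup.inclusion (inf_le_left :
          CoverGL2.centerT n F ⊓ CoverGL2.torusOne n F ≤ CoverGL2.centerT n F))) m →
      ((∀ k < n, ¬ ∀ (a : Fˣ) (ha : CoverGL2.val a = 0),
          CoverGL2.chi n ϖ χ₀ 0 0 (CoverGL2.unitDiag n a a⁻¹ ha
            (by rw [CoverGL2.val_inv, ha, neg_zero])) = ε (CoverGL2.varpiChar n ϖ a) ^ k) →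
        ∀ i j : Fin n,
          (CoverGL2.levelRep (CoverGL2.indK n (CoverGL2.chi n ϖ χ₀ i j)) m
            hm.1.1).IsIrreducible) ∧
      (∀ k < n, (∀ (a : Fˣ) (ha : CoverGL2.val a = 0),
          CoverGL2.chi n ϖ χ₀ 0 0 (CoverGL2.unitDiag n a a⁻¹ ha
            (by rw [CoverGL2.val_inv, ha, neg_zero])) = ε (CoverGL2.varpiChar n ϖ a) ^ k) →
        {p : Fin n × Fin n | (p.2 : ℕ) ≡ p.1 + k [MOD n]}.ncard = n ∧
        (∀ i j : Fin n, (j : ℕ) ≡ i + k [MOD n] →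
          ∃ U₁ U₂ : Subrepresentation
              (CoverGL2.levelRep (CoverGL2.indK n (CoverGL2.chi n ϖ χ₀ i j)) m hm.1.1),
            IsCompl U₁ U₂ ∧ U₁.toRepresentation.IsIrreducible ∧
              U₂.toRepresentation.IsIrreducible) ∧
        (∀ i j : Fin n, ¬ (j : ℕ) ≡ i + k [MOD n] →
          (CoverGL2.levelRep (CoverGL2.indK n (CoverGL2.chi n ϖ χ₀ i j)) m
            hm.1.1).IsIrreducible))) := by
  have hn0 : n ≠ 0 := by omega
  have hV : Nontrivial V := by
    by_contra hc
    have := not_nontrivial_iff_subsingleton.1 hc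
    obtain ⟨U, U', hU⟩ := hirr.exists_pair_ne
    exact hU (Subrepresentation.toSubmodule_injective (Subsingleton.elim _ _))
  have hε₀ := CoverGL2.apply_incl_eq hgen hχ' hχ₀
  have htriv := fun i j : ℕ => CoverGL2.chi_trivial (ϖ := ϖ) hn0 hε₀ hχ₀ hm.1.1 hm.1.2 i j
  obtain ⟨e, he⟩ := CoverGL2.exists_basis hn0 hϖ hε hirr hgen hχ' hχ₀ hε₀
  refine ⟨CoverGL2.nonempty_equiv_directSum hn0
    (χ := fun p : Fin n × Fin n => CoverGL2.chi n ϖ χ₀ p.1 p.2) he m hm.1.1, fun i j l hl =>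
    CoverGL2.levelQuotient_isIrreducible hn0 hm.1.1 (htriv i j) hl, fun hprim => ⟨?_, ?_⟩⟩
  · intro hk i j
    refine CoverGL2.levelRep_isIrreducible hn0 hm.1.1 (htriv i j)
      (CoverGL2.exists_borelChar_chi_ne hε₀ hχ₀ hprim i j) ?_
    by_contra! hcon
    -- Equality for all units would say that the hypothesis fails for `k ≡ j - i`.
    refine hk ((j + (n - i)) % n) (Nat.mod_lt _ (by omega))
      ((CoverGL2.forall_unitDiag_iff hε₀ _).2 fun u => ?_)
    have h := (CoverGL2.borelChar_chi_eq_iff hε₀ i j u).1 (hcon u)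
    have hpow := CoverGL2.varpiChar_pow_eq_one (ε := ε) (ϖ := ϖ) (CoverGL2.unitO u)
    rw [← pow_eq_pow_mod _ hpow, pow_add, ← h, mul_assoc, ← pow_add,
      Nat.add_sub_cancel' i.2.le, hpow, mul_one]
  · intro k hk hall
    have hiff : ∀ (i j : Fin n) u, CoverGL2.borelChar n (CoverGL2.chi n ϖ χ₀ i j)
          (CoverGL2.diagK n 1 u) =
        CoverGL2.borelChar n (CoverGL2.chi n ϖ χ₀ i j) (CoverGL2.diagK n u 1) ↔
          ε (CoverGL2.varpiChar n ϖ (CoverGL2.unitO u)) ^ (i + k : ℕ) =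
            ε (CoverGL2.varpiChar n ϖ (CoverGL2.unitO u)) ^ (j : ℕ) := fun i j u => by
      rw [CoverGL2.borelChar_chi_eq_iff hε₀, (CoverGL2.forall_unitDiag_iff hε₀ k).1 hall, add_comm,
        pow_add]
    refine ⟨CoverGL2.ncard_modEq hn0 k, fun i j hij => ?_, fun i j hij => ?_⟩
    · refine CoverGL2.levelRep_exists_two hn0 hm.1.1 (htriv i j)
        (CoverGL2.exists_borelChar_chi_ne hε₀ hχ₀ hprim i j) fun u => (hiff i j u).2 ?_
      have hpow := CoverGL2.varpiChar_pow_eq_one (ε := ε) (ϖ := ϖ) (CoverGL2.unitO u)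
      rw [pow_eq_pow_mod (i + k : ℕ) hpow, pow_eq_pow_mod (j : ℕ) hpow, hij]
    · refine CoverGL2.levelRep_isIrreducible hn0 hm.1.1 (htriv i j)
        (CoverGL2.exists_borelChar_chi_ne hε₀ hχ₀ hprim i j) ?_
      -- A unit whose symbol with `ϖ` has order `n` separates the powers `i + k` and `j`.
      obtain ⟨u, hu, -⟩ := CoverGL2.exists_orderOf_varpiChar (n := n) hn0 hϖ
      refine ⟨u, fun h => hij ?_⟩
      have h1 := pow_eq_pow_iff_modEq.1 ((hiff i j u).1 h)
      rw [orderOf_injective ε hε, hu] at h1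
      exact h1.symm
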